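/- For an integer $k \ge 1$ let $B(k)$ be the following graph. It has two yellow vertices, $2k$ blue vertices grouped into $k$ disjoint pairs, and, for each of these pairs, $2k-2$ red vertices. Each yellow vertex is adjacent to all $2k$ blue vertices (forming a $K_{2,2k}$), each red vertex is adjacent to exactly the two blue vertices of its pair (forming a $K_{2,2k-2}$ for each pair), and there are no other edges. A Lombardi drawing of a finite simple graph $G$ places the vertices at distinct points of the plane and draws each edge $uv$ as a circular arc (a proper arc of a circle, or a line segment) between the points of $u$ and $v$, in such a way that at each vertex $v$ the $\deg(v)$ edges at $v$ leave $v$ in equally spaced directions, consecutive ones forming an angle of $2\pi/\deg(v)$. The drawing is planar if the arcs of two distinct edges meet only at the point of a common endpoint, and no arc passes through the point of a vertex that is not one of its endpoints. Theorem. For every integer $k > 8$, the graph $B(k)$ is bipartite and planar (it has a crossing-free drawing in the plane with simple curves as edges), but it has no planar Lombardi drawing. -/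

import Mathlib

open Set

/-- The vertices of `B(k)`: two yellow vertices; `2k` blue vertices, grouped into `k` pairs
(the vertex `blue i b` belongs to the pair `i`); and `2k - 2` red vertices for each pair. -/
inductive BVertex (k : ℕ) : Type
  | yellow (y : Fin 2)
  | blue (i : Fin k) (b : Fin 2)
  | red (i : Fin k) (r : Fin (2 * k - 2))

/-- The edges of `B(k)`, listed from the yellow/red side to the blue side: every yellow vertex is
joined to every blue vertex, and every red vertex to the two blue vertices of its pair. -/
def BEdge (k : ℕ) : BVertex k → BVertex k → Prop
  | .yellow _, .blue _ _ => True
  | .red i _, .blue j _ => i = j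
  | _, _ => False

/-- The graph `B(k)`: the complete bipartite graph `K_{2,2k}`, together with one complete bipartite
graph `K_{2,2k-2}` attached to each of the `k` pairs of blue vertices. -/
def B (k : ℕ) : SimpleGraph (BVertex k) where
  Adj u v := BEdge k u v ∨ BEdge k v u
  symm := ⟨fun _ _ h => h.symm⟩
  loopless := ⟨fun u h => by cases u <;> simp [BEdge] at h⟩

/-- A drawing of a graph in the plane: distinct points for the vertices, and for every edge a simple
curve, parametrized by `[0, 1]`, between the points of its endpoints. An edge is given by two
darts (one for each direction), whose curves are the reversals of each other. -/
structure Drawing {V : Type*} (G : SimpleGraph V) where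
  pos : V → ℂ
  pos_injective : Function.Injective pos
  curve : G.Dart → ℝ → ℂ
  curve_zero : ∀ d, curve d 0 = pos d.fst
  curve_one : ∀ d, curve d 1 = pos d.snd
  curve_symm : ∀ d, ∀ u ∈ Icc (0 : ℝ) 1, curve d.symm u = curve d (1 - u)
  curve_continuousOn : ∀ d, ContinuousOn (curve d) (Icc 0 1)
  curve_injOn : ∀ d, InjOn (curve d) (Icc 0 1)

/-- On `[0, 1]`, `γ` is a constant-speed parametrization of a circular arc: a proper arc of a circle
(with centre `c`, radius `r`, initial angle `a` and swept signed angle `s`), or a line segment. -/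
def IsCircularArc (γ : ℝ → ℂ) : Prop :=
  (∃ (c : ℂ) (r a s : ℝ), 0 < r ∧ s ≠ 0 ∧ |s| < 2 * Real.pi ∧
    ∀ u ∈ Icc (0 : ℝ) 1, γ u = c + r * Complex.exp (((a + u * s : ℝ) : ℂ) * Complex.I)) ∨
  (∃ z w : ℂ, w ≠ 0 ∧ ∀ u ∈ Icc (0 : ℝ) 1, γ u = z + u * w)

namespace Drawing

variable {V : Type*} {G : SimpleGraph V}

/-- The drawing has no crossings: the curves of two different edges meet only at the point of a
common endpoint, and no curve passes through the point of a vertex that is not its endpoint. -/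
def IsPlane (D : Drawing G) : Prop :=
  (∀ d d' : G.Dart, d.edge ≠ d'.edge → ∀ u ∈ Icc (0 : ℝ) 1, ∀ u' ∈ Icc (0 : ℝ) 1,
    D.curve d u = D.curve d' u' → ∃ v, v ∈ d.edge ∧ v ∈ d'.edge ∧ D.curve d u = D.pos v) ∧
  (∀ (d : G.Dart) (v : V), ∀ u ∈ Icc (0 : ℝ) 1, D.curve d u = D.pos v → v ∈ d.edge)

/-- The unit tangent vector in which the curve of a dart leaves its first vertex. -/
noncomputable def direction (D : Drawing G) (d : G.Dart) : ℂ :=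
  derivWithin (D.curve d) (Icc 0 1) 0 / (‖derivWithin (D.curve d) (Icc 0 1) 0‖ : ℂ)

/-- Every edge is a circular arc, and at every vertex `v` the edges can be numbered
`0, …, n - 1`, where `n` is the degree of `v`, such that each of them leaves `v` at an
angle `2π / n` counterclockwise from the preceding one. -/
def IsLombardi (D : Drawing G) : Prop :=
  (∀ d, IsCircularArc (D.curve d)) ∧
  ∀ v : V, ∃ (a : ℝ) (σ : G.neighborSet v ≃ Fin (Nat.card (G.neighborSet v))),
    ∀ w : G.neighborSet v, D.direction ⟨(v, (w : V)), w.2⟩ =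
      Complex.exp (((a + 2 * Real.pi * ((σ w : ℕ) : ℝ) / (Nat.card (G.neighborSet v) : ℝ) : ℝ) : ℂ)
        * Complex.I)

end Drawing

/-- A graph is planar if it has a plane drawing (with arbitrary simple curves as edges). -/
def IsPlanarGraph {V : Type*} (G : SimpleGraph V) : Prop :=
  ∃ D : Drawing G, D.IsPlane

/-- A planar Lombardi drawing is a Lombardi drawing without crossings. -/
def HasPlanarLombardiDrawing {V : Type*} (G : SimpleGraph V) : Prop :=
  ∃ D : Drawing G, D.IsPlane ∧ D.IsLombardi

open ComplexConjugate
open Filter Topology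
open Complex (arg slitPlane)

/-! ### Bipartiteness -/

/-! Bipartiteness is a colouring, and planarity is an explicit drawing. The content is that a planar
Lombardi drawing is impossible.

A Möbius map sends the yellow vertices to `0` and `∞` and keeps circles and angles. Each blue vertex
`j` then gives a path from `0` to `∞`: a circular arc leaving `0` in direction `B j * u j` and
ending at `B j`, followed by a ray in direction `B j * v j`. The `2k` paths are disjoint, and their
directions at `0` and at `∞` are spaced by `β = π / k` (`exists_isPathSystem`).

Topology fixes all angles. Cutting the plane along one path gives a branch of the argument,
`cutArg`. Following another path in it (`exists_lift_between`) shows that the cyclic orders at `0`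
and `∞` agree, hence differ by a rotation (`exists_rotation`), so `arg (v j) - arg (u j)` is a
constant `2μ`. Walking over a red vertex from `B j` to its partner meets no third path, so partners
are neighbours in the cyclic order (`neighbours_of_not_separated`), and all `2k - 2` red edges leave
`B j` on the side of the partner. The angle on the other side is therefore a single `β`, which gives
`arg (u j) + arg (v j) = ±(π - β)`, the sign telling on which side the partner lies (`turn_eq`).
Only the radii `‖B j‖` remain free.

Geometry then gives a contradiction. Let `ρ₀, ρ₁` be the radii of a pair and `ρ₂` the first radius
of the next pair, in counterclockwise order, and let `μ ≥ 0`. The arcs of the pair bend towards each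
other, and not crossing bounds `ρ₁` by a multiple of `ρ₀` (`le_of_arcs_disjoint`). The ray of the
second path and the arc of the third do not cross, which bounds `ρ₂` by a multiple of `ρ₁`
(`lt_of_ray_arc_disjoint`). For small `β` the product of the two factors is below `1`, so `ρ₂ < ρ₀`
(`radius_lt`). For `μ < 0`, inversion in the unit circle exchanges `0` with `∞` and gives the same
for the inverse radii. The radii would thus change strictly monotonically all the way round a finite
cycle (`false_of_eight_lt`). -/

theorem B_isBipartite (k : ℕ) : (B k).IsBipartite := by
  refine ⟨SimpleGraph.Coloring.mk
    (fun v => match v with | .blue _ _ => (0 : Fin 2) | _ => 1) ?_⟩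
  intro u v h
  rcases u with _ | _ | _ <;> rcases v with _ | _ | _ <;> simp_all [B, BEdge]

/-! ### A plane drawing -/

/-- The map `(F, Y) ↦ (F (1 - |Y|), Y)`, which collapses the lines `Y = 1` and `Y = -1`. -/
def pinch (F Y : ℝ) : ℂ := ⟨F * (1 - |Y|), Y⟩

namespace BVertex

variable {k : ℕ}

/-- The first coordinate of a vertex before pinching. -/
noncomputable def abscissa : BVertex k → ℝ
  | yellow _ => 0
  | blue i b => 2 * (i : ℕ) + (b : ℕ)
  | red i _ => 2 * (i : ℕ) + 1 / 2

/-- The second coordinate of a vertex. -/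
noncomputable def height : BVertex k → ℝ
  | yellow y => 1 - 2 * (y : ℕ)
  | blue _ _ => 0
  | red _ r => 1 / ((r : ℕ) + 2)

/-- The first coordinate at which an edge from `p` to `q` starts. -/
noncomputable def startAbscissa (p q : BVertex k) : ℝ :=
  match p with
  | yellow _ => abscissa q
  | _ => abscissa p

/-- The point of a vertex. -/
noncomputable def point (v : BVertex k) : ℂ := pinch v.abscissa v.height

/-- The curve of an edge. -/
noncomputable def edgeCurve (p q : BVertex k) (u : ℝ) : ℂ :=
  pinch ((1 - u) * startAbscissa p q + u * startAbscissa q p)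
    ((1 - u) * p.height + u * q.height)

theorem height_yellow_abs (y : Fin 2) : |height (yellow y : BVertex k)| = 1 := by
  fin_cases y <;> norm_num [height]

theorem pinch_startAbscissa (p q : BVertex k) : pinch (startAbscissa p q) p.height = p.point := by
  rcases p with y | _ | _
  · simp [pinch, point, height_yellow_abs]
  · rfl
  · rfl

theorem height_red_mem (i : Fin k) (r : Fin (2 * k - 2)) :
    0 < height (red i r) ∧ height (red i r) < 1 := by
  have : (0 : ℝ) ≤ ((r : ℕ) : ℝ) := by positivity
  refine ⟨by simp only [height]; positivity, ?_⟩
  simp only [height]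
  rw [div_lt_one (by positivity)]
  linarith

theorem height_red_injective {i j : Fin k} {r s : Fin (2 * k - 2)}
    (h : height (red i r) = height (red j s)) : r = s := by
  simp only [height, one_div, inv_inj, add_left_inj, Nat.cast_inj] at h
  exact Fin.ext h

theorem two_mul_add_injective {i j : ℕ} {x y : ℝ} (hx : 0 ≤ x) (hx' : x ≤ 1) (hy : 0 ≤ y)
    (hy' : y ≤ 1) (h : 2 * (i : ℝ) + x = 2 * j + y) : i = j := by
  have h1 : (i : ℝ) < j + 1 := by linarith
  have h2 : (j : ℝ) < i + 1 := by linarith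
  have h3 : i < j + 1 := by exact_mod_cast h1
  have h4 : j < i + 1 := by exact_mod_cast h2
  omega

theorem fin_two_cast_mem (b : Fin 2) : (0 : ℝ) ≤ ((b : ℕ) : ℝ) ∧ ((b : ℕ) : ℝ) ≤ 1 := by
  fin_cases b <;> norm_num

theorem blue_eq_of_abscissa_eq {i j : Fin k} {b c : Fin 2}
    (h : abscissa (blue i b) = abscissa (blue j c)) : i = j ∧ b = c := by
  simp only [abscissa] at h
  have hb := fin_two_cast_mem b
  have hc := fin_two_cast_mem c
  have hij := two_mul_add_injective hb.1 hb.2 hc.1 hc.2 h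
  rw [hij] at h
  have : ((b : ℕ) : ℝ) = ((c : ℕ) : ℝ) := by linarith
  exact ⟨Fin.ext hij, Fin.ext (by exact_mod_cast this)⟩

theorem pinch_injective {F F' Y Y' : ℝ} (hY : |Y| ≠ 1) (h : pinch F Y = pinch F' Y') :
    F = F' ∧ Y = Y' := by
  have h2 : Y = Y' := congrArg Complex.im h
  have h1 : F * (1 - |Y|) = F' * (1 - |Y'|) := congrArg Complex.re h
  subst h2
  exact ⟨mul_right_cancel₀ (sub_ne_zero.2 hY.symm) h1, rfl⟩

theorem point_injective : Function.Injective (point : BVertex k → ℂ) := by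
  intro v w h
  have him : v.height = w.height := congrArg Complex.im h
  by_cases hv : |v.height| = 1
  · have hw : |w.height| = 1 := him ▸ hv
    have key : ∀ x : BVertex k, |x.height| = 1 → ∃ y, x = yellow y := by
      rintro (y | ⟨i, b⟩ | ⟨i, r⟩) hx
      · exact ⟨y, rfl⟩
      · simp [height] at hx
      · have := height_red_mem i r
        rw [abs_of_pos this.1] at hx
        linarith
    obtain ⟨y, rfl⟩ := key v hv
    obtain ⟨y', rfl⟩ := key w hw
    fin_cases y <;> fin_cases y' <;> first | rfl | norm_num [height] at him
  · obtain ⟨hF, -⟩ := pinch_injective hv h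
    rcases v with y | ⟨i, b⟩ | ⟨i, r⟩
    · exact absurd (height_yellow_abs y) hv
    · rcases w with y | ⟨j, c⟩ | ⟨j, s⟩
      · rw [him] at hv; exact absurd (height_yellow_abs y) hv
      · obtain ⟨rfl, rfl⟩ := blue_eq_of_abscissa_eq hF; rfl
      · have := (height_red_mem j s).1
        simp only [height] at him this
        linarith
    · rcases w with y | ⟨j, c⟩ | ⟨j, s⟩
      · rw [him] at hv; exact absurd (height_yellow_abs y) hv
      · have := (height_red_mem i r).1
        simp only [height] at him this
        linarith
      · obtain rfl := height_red_injective him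
        simp only [abscissa] at hF
        have := two_mul_add_injective (i := i) (j := j) (by norm_num) (by norm_num) (by norm_num)
          (by norm_num) hF
        rw [Fin.ext this]

theorem edgeCurve_symm (p q : BVertex k) (u : ℝ) : edgeCurve q p u = edgeCurve p q (1 - u) := by
  simp only [edgeCurve]
  congr 1 <;> ring

theorem height_ne_of_adj {p q : BVertex k} (h : (B k).Adj p q) : p.height ≠ q.height := by
  have key : ∀ p q : BVertex k, BEdge k p q → p.height ≠ q.height := by
    rintro (y | ⟨i, b⟩ | ⟨i, r⟩) (y' | ⟨j, c⟩ | ⟨j, s⟩) h <;> simp only [BEdge] at h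
    · intro h'
      have := height_yellow_abs (k := k) y
      rw [h'] at this
      simp [height] at this
    · exact (height_red_mem i r).1.ne'
  rcases h with h | h
  · exact key _ _ h
  · exact (key _ _ h).symm

/-- A normal form that forgets the orientation of the dart: `t` is always measured from the blue
end. It leaves only two kinds of edges to compare in the crossing analysis. -/
theorem edgeCurve_cases {p q : BVertex k} (h : (B k).Adj p q) {u : ℝ} (hu : u ∈ Icc (0 : ℝ) 1) :
    ∃ (i : Fin k) (b : Fin 2), ∃ t ∈ Icc (0 : ℝ) 1,
      (∃ y, s(p, q) = s(blue i b, yellow y) ∧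
        edgeCurve p q u = pinch (abscissa (blue i b)) (t * height (yellow y : BVertex k))) ∨
      (∃ r, s(p, q) = s(blue i b, red i r) ∧
        edgeCurve p q u = pinch (2 * (i : ℕ) + ((b : ℕ) + t * (1 / 2 - (b : ℕ))))
          (t * height (red i r))) := by
  have key : ∀ p q : BVertex k, BEdge k q p → ∀ u ∈ Icc (0 : ℝ) 1,
      ∃ (i : Fin k) (b : Fin 2), ∃ t ∈ Icc (0 : ℝ) 1,
      (∃ y, s(p, q) = s(blue i b, yellow y) ∧
        edgeCurve p q u = pinch (abscissa (blue i b)) (t * height (yellow y : BVertex k))) ∨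
      (∃ r, s(p, q) = s(blue i b, red i r) ∧
        edgeCurve p q u = pinch (2 * (i : ℕ) + ((b : ℕ) + t * (1 / 2 - (b : ℕ))))
          (t * height (red i r))) := by
    rintro (y' | ⟨j, c⟩ | ⟨j, s⟩) (y | ⟨i, b⟩ | ⟨i, r⟩) h u hu <;> simp only [BEdge] at h
    · refine ⟨j, c, u, hu, Or.inl ⟨y, rfl, ?_⟩⟩
      simp only [edgeCurve, startAbscissa, height]
      congr 1 <;> ring
    · subst h
      refine ⟨i, c, u, hu, Or.inr ⟨r, rfl, ?_⟩⟩
      simp only [edgeCurve, startAbscissa, abscissa, height]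
      congr 1 <;> ring
  rcases h with h | h
  · obtain ⟨i, b, t, ht, h'⟩ := key q p h (1 - u) ⟨by linarith [hu.2], by linarith [hu.1]⟩
    refine ⟨i, b, t, ht, ?_⟩
    rw [Sym2.eq_swap, edgeCurve_symm q p u]
    exact h'
  · exact key p q h u hu

theorem point_blue (i : Fin k) (b : Fin 2) {F Y : ℝ} (hF : F = abscissa (blue i b)) (hY : Y = 0) :
    pinch F Y = (blue i b : BVertex k).point := by
  rw [hF, hY]; rfl

/-- Before pinching, yellow edges are vertical segments over the blue points, and the red edges of
pair `i` are segments inside the strip `[2i, 2i + 1]` that rise to different heights over its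
midline. Pinching is injective off the lines `Y = ±1`, which collapse to the yellow points. -/
theorem edgeCurve_plane {p q p' q' : BVertex k} (h : (B k).Adj p q) (h' : (B k).Adj p' q')
    (hne : s(p, q) ≠ s(p', q')) {u u' : ℝ} (hu : u ∈ Icc (0 : ℝ) 1) (hu' : u' ∈ Icc (0 : ℝ) 1)
    (heq : edgeCurve p q u = edgeCurve p' q' u') :
    ∃ v, v ∈ s(p, q) ∧ v ∈ s(p', q') ∧ edgeCurve p q u = point v := by
  -- A yellow edge has integer abscissa, while a red edge has one only at its blue end; so these two
  -- kinds meet only at a blue vertex.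
  have yr : ∀ (i j : Fin k) (b c : Fin 2) (y : Fin 2) (r : Fin (2 * k - 2)),
      ∀ t ∈ Icc (0 : ℝ) 1, ∀ t' ∈ Icc (0 : ℝ) 1,
      pinch (abscissa (blue i b)) (t * height (yellow y : BVertex k)) =
        pinch (2 * (j : ℕ) + ((c : ℕ) + t' * (1 / 2 - (c : ℕ)))) (t' * height (red j r)) →
      i = j ∧ b = c ∧ t = 0 ∧ t' = 0 := by
    intro i j b c y r t ht t' ht' he
    have hr := height_red_mem j r
    have hY : |t' * height (red j r)| ≠ 1 := by
      rw [abs_of_nonneg (mul_nonneg ht'.1 hr.1.le)]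
      nlinarith [ht'.1, ht'.2]
    obtain ⟨hF, hh⟩ := pinch_injective hY he.symm
    have hb := fin_two_cast_mem b
    simp only [abscissa] at hF
    have hij : j = i := by
      refine Fin.ext (two_mul_add_injective ?_ ?_ hb.1 hb.2 hF) <;>
      · fin_cases c <;> norm_num <;> linarith [ht'.1, ht'.2]
    subst hij
    have ht0 : b = c ∧ t' = 0 := by
      fin_cases c <;> fin_cases b <;> norm_num at hF ⊢ <;> linarith [ht'.1, ht'.2]
    refine ⟨rfl, ht0.1, ?_, ht0.2⟩
    rw [ht0.2, zero_mul] at hh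
    rcases mul_eq_zero.1 hh.symm with h0 | h0
    · exact h0
    · have := height_yellow_abs (k := k) y
      rw [h0] at this
      norm_num at this
  obtain ⟨i, b, t, ht, ⟨y, he, hc⟩ | ⟨r, he, hc⟩⟩ := edgeCurve_cases h hu <;>
  obtain ⟨j, c, t', ht', ⟨y', he', hc'⟩ | ⟨r', he', hc'⟩⟩ := edgeCurve_cases h' hu' <;>
  rw [he, he'] at hne ⊢ <;> rw [hc] at heq ⊢ <;> rw [hc'] at heq
  · have ha : |t * height (yellow y : BVertex k)| = t := by
      rw [abs_mul, height_yellow_abs, mul_one, abs_of_nonneg ht.1]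
    have ha' : |t' * height (yellow y' : BVertex k)| = t' := by
      rw [abs_mul, height_yellow_abs, mul_one, abs_of_nonneg ht'.1]
    have him : t * height (yellow y : BVertex k) = t' * height (yellow y' : BVertex k) :=
      congrArg Complex.im heq
    have htt : t = t' := by rw [← ha, him, ha']
    subst htt
    by_cases hyy : y = y'
    · subst hyy
      by_cases h1 : t = 1
      · refine ⟨yellow y, by simp, by simp, ?_⟩
        simp [h1, pinch, point, height_yellow_abs]
      · obtain ⟨hF, -⟩ := pinch_injective (by rwa [ha]) heq
        obtain ⟨rfl, rfl⟩ := blue_eq_of_abscissa_eq hF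
        exact absurd rfl hne
    · have h0 : t = 0 := by
        fin_cases y <;> fin_cases y' <;> simp [height] at him hyy <;> linarith
      obtain ⟨hF, -⟩ := pinch_injective (by rw [ha, h0]; norm_num) heq
      obtain ⟨rfl, rfl⟩ := blue_eq_of_abscissa_eq hF
      exact ⟨blue i b, by simp, by simp, point_blue i b rfl (by rw [h0, zero_mul])⟩
  · obtain ⟨rfl, rfl, h0, h0'⟩ := yr i j b c y r' t ht t' ht' heq
    exact ⟨blue i b, by simp, by simp, point_blue i b rfl (by rw [h0, zero_mul])⟩
  · obtain ⟨rfl, rfl, h0, h0'⟩ := yr j i c b y' r t' ht' t ht heq.symm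
    refine ⟨blue j c, by simp, by simp, point_blue j c ?_ (by rw [h0', zero_mul])⟩
    simp [h0', abscissa]
  · have hr := height_red_mem i r
    have hY : |t * height (red i r)| ≠ 1 := by
      rw [abs_of_nonneg (mul_nonneg ht.1 hr.1.le)]
      nlinarith [ht.1, ht.2]
    obtain ⟨hF, hh⟩ := pinch_injective hY heq
    have hij : i = j := by
      refine Fin.ext (two_mul_add_injective ?_ ?_ ?_ ?_ hF)
      · fin_cases b <;> norm_num <;> linarith [ht.1, ht.2]
      · fin_cases b <;> norm_num <;> linarith [ht.1, ht.2]
      · fin_cases c <;> norm_num <;> linarith [ht'.1, ht'.2]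
      · fin_cases c <;> norm_num <;> linarith [ht'.1, ht'.2]
    subst hij
    have hF' : ((b : ℕ) + t * (1 / 2 - (b : ℕ)) : ℝ) = (c : ℕ) + t' * (1 / 2 - (c : ℕ)) := by
      linarith
    by_cases hbc : b = c
    · subst hbc
      have htt : t = t' := by
        fin_cases b <;> norm_num at hF' <;> linarith
      subst htt
      by_cases h0 : t = 0
      · refine ⟨blue i b, by simp, by simp, point_blue i b ?_ (by rw [h0, zero_mul])⟩
        simp [h0, abscissa]
      · obtain rfl := height_red_injective (mul_left_cancel₀ h0 hh)
        exact absurd rfl hne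
    · have h1 : t = 1 ∧ t' = 1 := by
        fin_cases b <;> fin_cases c <;> norm_num at hF' hbc <;>
          constructor <;> linarith [ht.1, ht.2, ht'.1, ht'.2]
      rw [h1.1, h1.2, one_mul, one_mul] at hh
      obtain rfl := height_red_injective hh
      refine ⟨red i r, by simp, by simp, ?_⟩
      rw [h1.1, point]
      simp only [abscissa, one_mul]
      congr 1
      ring

theorem exists_adj (hk : 0 < k) (v : BVertex k) : ∃ w, (B k).Adj v w := by
  rcases v with y | ⟨i, b⟩ | ⟨i, r⟩
  · exact ⟨blue ⟨0, hk⟩ 0, Or.inl trivial⟩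
  · exact ⟨yellow 0, Or.inr trivial⟩
  · exact ⟨blue i 0, Or.inl rfl⟩

end BVertex

open BVertex in
/-- A crossing-free drawing of `B(k)`. -/
noncomputable def planeDrawing (k : ℕ) : Drawing (B k) where
  pos := point
  pos_injective := point_injective
  curve d := edgeCurve d.fst d.snd
  curve_zero d := by simp [edgeCurve, pinch_startAbscissa]
  curve_one d := by simp [edgeCurve, pinch_startAbscissa]
  curve_symm d u _ := edgeCurve_symm _ _ u
  curve_continuousOn d := by
    have : Continuous (edgeCurve d.fst d.snd) := by
      have h : edgeCurve d.fst d.snd = fun u => Complex.equivRealProdCLM.symm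
          (((1 - u) * startAbscissa d.fst d.snd + u * startAbscissa d.snd d.fst) *
            (1 - |(1 - u) * d.fst.height + u * d.snd.height|),
          (1 - u) * d.fst.height + u * d.snd.height) := by
        funext u
        simp [edgeCurve, pinch, Complex.ext_iff]
      rw [h]
      fun_prop
    exact this.continuousOn
  curve_injOn d := by
    intro u _ u' _ h
    have him : (1 - u) * d.fst.height + u * d.snd.height =
      (1 - u') * d.fst.height + u' * d.snd.height := congrArg Complex.im h
    have hne := height_ne_of_adj d.adj
    have : (u - u') * (d.snd.height - d.fst.height) = 0 := by linear_combination him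
    rcases mul_eq_zero.1 this with h0 | h0
    · linarith
    · exact absurd (by linarith) hne

open BVertex in
theorem B_isPlanarGraph {k : ℕ} (hk : 0 < k) : IsPlanarGraph (B k) := by
  have hplane : ∀ d d' : (B k).Dart, d.edge ≠ d'.edge → ∀ u ∈ Icc (0 : ℝ) 1,
      ∀ u' ∈ Icc (0 : ℝ) 1, (planeDrawing k).curve d u = (planeDrawing k).curve d' u' →
      ∃ v, v ∈ d.edge ∧ v ∈ d'.edge ∧ (planeDrawing k).curve d u = (planeDrawing k).pos v :=
    fun d d' hne u hu u' hu' heq => edgeCurve_plane d.adj d'.adj hne hu hu' heq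
  refine ⟨planeDrawing k, hplane, ?_⟩
  intro d v u hu h
  by_contra hv
  obtain ⟨w, hw⟩ := exists_adj hk v
  let d' : (B k).Dart := ⟨(v, w), hw⟩
  have hvd' : v ∈ d'.edge := Sym2.mem_mk_left v w
  obtain ⟨x, hx, -, hx'⟩ := hplane d d' (fun he => hv (he ▸ hvd')) u hu 0 (by simp)
    (by rw [h, (planeDrawing k).curve_zero d'])
  rw [h] at hx'
  exact hv ((planeDrawing k).pos_injective hx' ▸ hx)

/-! ### Circular arcs -/


/-- The chord of an arc of angle `2y` has signed length `2 sin y` and makes an angle `y` with the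
initial tangent. -/
theorem exp_mul_I_sub_one (y : ℝ) : Complex.exp ((2 * y : ℝ) * Complex.I) - 1 =
    2 * Complex.I * Real.sin y * Complex.exp (y * Complex.I) := by
  have h1 : Complex.exp ((2 * y : ℝ) * Complex.I) =
      Complex.exp (y * Complex.I) * Complex.exp (y * Complex.I) := by
    rw [← Complex.exp_add]; congr 1; push_cast; ring
  have h2 : Complex.exp (-(y : ℂ) * Complex.I) * Complex.exp (y * Complex.I) = 1 := by
    rw [← Complex.exp_add]; simp
  rw [h1, Complex.ofReal_sin, Complex.sin]
  linear_combination h2 - (Complex.exp (-(y : ℂ) * Complex.I) *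
    Complex.exp (y * Complex.I) - Complex.exp (y * Complex.I) * Complex.exp (y * Complex.I)) *
    Complex.I_sq

theorem div_sin_half_pos {s : ℝ} (h0 : s ≠ 0) (h : |s| < 2 * Real.pi) :
    0 < s / (2 * Real.sin (s / 2)) := by
  rw [abs_lt] at h
  rcases lt_or_gt_of_ne h0 with hs | hs
  · exact div_pos_of_neg_of_neg hs (by
      have := Real.sin_neg_of_neg_of_neg_pi_lt (x := s / 2) (by linarith) (by linarith)
      linarith)
  · have := Real.sin_pos_of_pos_of_lt_pi (x := s / 2) (by linarith) (by linarith)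
    positivity

/-- A circular arc from `p` to `q` is described by a unit `u ≠ -1`: its interior contains all
points `z` for which `(z - p) / (q - z)` is a positive multiple of `u`. -/
theorem IsCircularArc.exists_unit {γ : ℝ → ℂ} (h : IsCircularArc γ) :
    ∃ u : ℂ, ‖u‖ = 1 ∧ u ≠ -1 ∧
      (∃ g : ℝ, 0 < g ∧ HasDerivWithinAt γ (g * (u * (γ 1 - γ 0))) (Icc 0 1) 0) ∧
      (∃ g : ℝ, 0 < g ∧ HasDerivWithinAt γ (g * (conj u * (γ 1 - γ 0))) (Icc 0 1) 1) ∧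
      ∀ s : ℝ, 0 < s → ∃ t ∈ Ioo (0 : ℝ) 1, γ t - γ 0 = s * u * (γ 1 - γ t) := by
  have m0 : (0 : ℝ) ∈ Icc (0 : ℝ) 1 := by simp
  have m1 : (1 : ℝ) ∈ Icc (0 : ℝ) 1 := by simp
  rcases h with ⟨c, r, a, s, hr, hs0, hs, hγ⟩ | ⟨z, w, hw, hγ⟩
  · have hd : ∀ x ∈ Icc (0 : ℝ) 1, HasDerivWithinAt γ
        (r * (Complex.exp (((a + x * s : ℝ) : ℂ) * Complex.I) * (s * Complex.I))) (Icc 0 1) x := by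
      intro x hx
      refine HasDerivWithinAt.congr ?_ hγ (hγ x hx)
      have h1 : HasDerivAt (fun u : ℝ => (((a + u * s : ℝ) : ℂ) * Complex.I))
          ((s : ℂ) * Complex.I) x := by
        have := (((hasDerivAt_id x).mul_const s).const_add a).ofReal_comp
        simpa using this.mul_const Complex.I
      exact ((h1.cexp.const_mul (r : ℂ)).const_add c).hasDerivWithinAt
    have hS : Real.sin (s / 2) ≠ 0 := by
      intro h0
      have := div_sin_half_pos hs0 hs
      rw [h0] at this; simp at this
    have hSc : (Real.sin (s / 2) : ℂ) ≠ 0 := by exact_mod_cast hS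
    have hexp : ∀ x y : ℝ, Complex.exp (((x + y : ℝ) : ℂ) * Complex.I) =
        Complex.exp (x * Complex.I) * Complex.exp (y * Complex.I) := by
      intro x y; rw [← Complex.exp_add]; congr 1; push_cast; ring
    have hdiff : ∀ x ∈ Icc (0 : ℝ) 1, ∀ y ∈ Icc (0 : ℝ) 1, γ y - γ x =
        r * (Complex.exp (((a + x * s : ℝ) : ℂ) * Complex.I) * (2 * Complex.I *
          Real.sin ((y - x) * s / 2) * Complex.exp (((y - x) * s / 2 : ℝ) * Complex.I))) := by
      intro x hx y hy
      rw [hγ x hx, hγ y hy, ← exp_mul_I_sub_one, mul_sub (Complex.exp _), ← hexp]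
      rw [show a + x * s + 2 * ((y - x) * s / 2) = a + y * s by ring]
      ring
    have hu1 : Complex.exp ((-(s / 2) : ℝ) * Complex.I) * Complex.exp ((s / 2 : ℝ) * Complex.I) = 1 := by
      rw [← hexp]; simp
    -- By the inscribed angle theorem the two chords from a point of the arc to its ends enclose a
    -- constant angle; `-s / 2` is also the angle from the chord to the initial tangent. The factor
    -- `s / (2 sin (s / 2))` is the ratio of the speed to the chord length.
    refine ⟨Complex.exp ((-(s / 2) : ℝ) * Complex.I), Complex.norm_exp_ofReal_mul_I _, ?_,
      ⟨s / (2 * Real.sin (s / 2)), div_sin_half_pos hs0 hs, ?_⟩,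
      ⟨s / (2 * Real.sin (s / 2)), div_sin_half_pos hs0 hs, ?_⟩, ?_⟩
    · intro h
      have hre := congrArg Complex.re h
      rw [Complex.exp_ofReal_mul_I_re, Real.cos_neg] at hre
      have h2 : Real.cos s = 1 := by
        rw [show s = 2 * (s / 2) by ring, Real.cos_two_mul, hre]; norm_num
      have := (Real.cos_eq_one_iff_of_lt_of_lt (abs_lt.1 hs).1 (abs_lt.1 hs).2).1 h2
      exact hs0 this
    · convert hd 0 m0 using 1
      rw [hdiff 0 m0 1 m1]
      rw [show (1 - 0) * s / 2 = s / 2 by ring]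
      push_cast at hu1 hSc ⊢
      generalize Complex.exp (-(s / 2 : ℂ) * Complex.I) = E at hu1 ⊢
      generalize Complex.exp ((s / 2 : ℂ) * Complex.I) = E' at hu1 ⊢
      field_simp
      linear_combination (s * r : ℂ) * hu1
    · convert hd 1 m1 using 1
      rw [hdiff 0 m0 1 m1, ← Complex.exp_conj]
      rw [show (1 - 0) * s / 2 = s / 2 by ring,
        show a + 1 * s = a + 0 * s + (s / 2 + s / 2) by ring, hexp (a + 0 * s), hexp (s / 2)]
      simp only [map_mul, Complex.conj_ofReal, Complex.conj_I]
      push_cast at hSc ⊢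
      field_simp
    · intro σ hσ
      -- The ratio of the two chords at parameter `t` is `sin (ts/2) / sin ((1-t)s/2)`; a zero of
      -- `f` makes it equal to `σ`.
      let f : ℝ → ℝ := fun t => Real.sin (t * s / 2) - σ * Real.sin ((1 - t) * s / 2)
      have hf : Continuous f := by fun_prop
      have f0 : f 0 = -(σ * Real.sin (s / 2)) := by simp [f]
      have f1 : f 1 = Real.sin (s / 2) := by simp [f]
      have hmem : (0 : ℝ) ∈ uIcc (f 0) (f 1) := by
        rw [f0, f1, mem_uIcc]
        rcases lt_or_gt_of_ne hS with h | h
        · right; constructor <;> nlinarith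
        · left; constructor <;> nlinarith
      obtain ⟨t, ht, hft⟩ := intermediate_value_uIcc hf.continuousOn hmem
      rw [uIcc_of_le zero_le_one] at ht
      have ht0 : t ≠ 0 := by
        rintro rfl
        rw [f0] at hft
        exact mul_ne_zero hσ.ne' hS (by linarith)
      have ht1 : t ≠ 1 := by
        rintro rfl
        rw [f1] at hft
        exact hS hft
      refine ⟨t, ⟨lt_of_le_of_ne ht.1 ht0.symm, lt_of_le_of_ne ht.2 ht1⟩, ?_⟩
      have hsin : (Real.sin ((t - 0) * s / 2) : ℂ) = σ * Real.sin ((1 - t) * s / 2) := by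
        have : Real.sin (t * s / 2) = σ * Real.sin ((1 - t) * s / 2) := by
          simp only [f] at hft; linarith
        rw [sub_zero]
        exact_mod_cast this
      rw [hdiff 0 m0 t ht, hdiff t ht 1 m1, hsin]
      have e1 : Complex.exp (((t - 0) * s / 2 : ℝ) * Complex.I) *
          Complex.exp (((a + 0 * s : ℝ) : ℂ) * Complex.I) =
          Complex.exp ((-(s / 2) : ℝ) * Complex.I) * (Complex.exp (((a + t * s : ℝ) : ℂ) * Complex.I) *
            Complex.exp (((1 - t) * s / 2 : ℝ) * Complex.I)) := by
        rw [← hexp, ← hexp, ← hexp]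
        congr 3; ring
      linear_combination (r * (2 * Complex.I * (σ * Real.sin ((1 - t) * s / 2)))) * e1
  · have hd : ∀ x ∈ Icc (0 : ℝ) 1, HasDerivWithinAt γ w (Icc 0 1) x := by
      intro x hx
      refine HasDerivWithinAt.congr ?_ hγ (hγ x hx)
      have := ((hasDerivAt_id x).ofReal_comp.mul_const w).const_add z
      simpa using this.hasDerivWithinAt
    have hw' : γ 1 - γ 0 = w := by rw [hγ 1 m1, hγ 0 m0]; simp
    refine ⟨1, by simp, fun h => ?_, ⟨1, one_pos, ?_⟩, ⟨1, one_pos, ?_⟩, ?_⟩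
    · have := congrArg Complex.re h
      norm_num at this
    · rw [hw']; simpa using hd 0 m0
    · rw [hw']; simpa using hd 1 m1
    · intro s hs
      have hs1 : (1 + s : ℂ) ≠ 0 := by
        exact_mod_cast (by positivity : (1 + s : ℝ) ≠ 0)
      have ht : s / (1 + s) ∈ Ioo (0 : ℝ) 1 :=
        ⟨by positivity, by rw [div_lt_one (by positivity)]; linarith⟩
      refine ⟨s / (1 + s), ht, ?_⟩
      rw [hγ _ (Ioo_subset_Icc_self ht), hγ 0 m0, hγ 1 m1]
      push_cast
      field_simp
      ring

/-- Multiplication by a positive real does not change the normalization of a complex number. -/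
theorem pos_mul_div_norm {g : ℝ} (hg : 0 < g) (z : ℂ) : g * z / (‖(g * z : ℂ)‖ : ℂ) = z / ‖z‖ := by
  rw [norm_mul, Complex.norm_real, Real.norm_of_nonneg hg.le, Complex.ofReal_mul]
  exact mul_div_mul_left _ _ (by exact_mod_cast hg.ne')

namespace Drawing

variable {V : Type*} {G : SimpleGraph V}

theorem hasDerivWithinAt_symm (D : Drawing G) (d : G.Dart) {g : ℂ}
    (h : HasDerivWithinAt (D.curve d) g (Icc 0 1) 1) :
    HasDerivWithinAt (D.curve d.symm) (-g) (Icc 0 1) 0 := by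
  have h1 : HasDerivWithinAt (fun u : ℝ => 1 - u) (-1) (Icc 0 1) 0 := by
    simpa using ((hasDerivAt_id (0 : ℝ)).const_sub 1).hasDerivWithinAt
  have hmaps : MapsTo (fun u : ℝ => 1 - u) (Icc 0 1) (Icc 0 1) := fun u hu =>
    ⟨by linarith [hu.2], by linarith [hu.1]⟩
  have h' : HasDerivWithinAt (D.curve d) g (Icc 0 1) (1 - 0) := by simpa using h
  have h2 := HasDerivWithinAt.scomp (0 : ℝ) h' h1 hmaps
  refine HasDerivWithinAt.congr (by simpa using h2) ?_ ?_
  · intro u hu; exact D.curve_symm d u hu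
  · exact D.curve_symm d 0 (by simp)

theorem direction_eq (D : Drawing G) (d : G.Dart) {g z : ℂ} {r : ℝ} (hr : 0 < r) (hg : g = r * z)
    (h : HasDerivWithinAt (D.curve d) g (Icc 0 1) 0) : D.direction d = z / ‖z‖ := by
  rw [direction, h.derivWithin (uniqueDiffOn_Icc zero_lt_one 0 (by simp)), hg, pos_mul_div_norm hr]

/-- The shape of an edge that is drawn as a circular arc. -/
theorem exists_arc_unit (D : Drawing G) {p q : V} (h : G.Adj p q)
    (harc : IsCircularArc (D.curve ⟨(p, q), h⟩)) :
    ∃ u : ℂ, ‖u‖ = 1 ∧ u ≠ -1 ∧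
      D.direction ⟨(p, q), h⟩ =
        u * (D.pos q - D.pos p) / ‖u * (D.pos q - D.pos p)‖ ∧
      D.direction ⟨(q, p), h.symm⟩ =
        conj u * (D.pos p - D.pos q) / ‖conj u * (D.pos p - D.pos q)‖ ∧
      ∀ s : ℝ, 0 < s → ∀ z, z - D.pos p = s * u * (D.pos q - z) →
        ∃ t ∈ Ioo (0 : ℝ) 1, D.curve ⟨(p, q), h⟩ t = z := by
  have h0 := D.curve_zero ⟨(p, q), h⟩
  have h1 := D.curve_one ⟨(p, q), h⟩
  dsimp only at h0 h1
  obtain ⟨u, hu, hu1, ⟨g, hg, hd⟩, ⟨g', hg', hd'⟩, hz⟩ := harc.exists_unit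
  rw [h0, h1] at hd hd' hz
  refine ⟨u, hu, hu1, D.direction_eq _ hg rfl hd, ?_, ?_⟩
  · exact D.direction_eq ⟨(q, p), h.symm⟩ hg' (by ring) (D.hasDerivWithinAt_symm _ hd')
  · intro s hs z hz'
    obtain ⟨t, ht, he⟩ := hz s hs
    refine ⟨t, ht, ?_⟩
    -- The equation for `z` is affine with leading coefficient `1 + s * u`, so once this is nonzero
    -- the point found on the arc must be `z`.
    have hsu : (1 + s * u : ℂ) ≠ 0 := by
      intro hcon
      have hcon' : (s : ℂ) * u = -1 := by linear_combination hcon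
      have hn := congrArg norm hcon'
      rw [norm_mul, hu, Complex.norm_real, Real.norm_of_nonneg hs.le] at hn
      simp at hn
      rw [hn] at hcon'
      exact hu1 (by simpa using hcon')
    refine mul_left_cancel₀ hsu ?_
    linear_combination he - hz'

end Drawing

/-! ### A branch of the argument cut along a path from `0` to `∞`

The path consists of a circular arc from `0` to `B`, whose shape is given by `u`, and of a ray that
starts at `B`, in the direction `B * v`. -/


/-- The points of the arc from `0` to `B`. -/
noncomputable def leadArc (B u : ℂ) (τ : ℝ) : ℂ := B * (τ * u) / ((1 - τ) + τ * u)

/-- The points of the ray from `B`. -/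
noncomputable def tailRay (B v : ℂ) (t : ℝ) : ℂ := B * (1 + t * v)

/-- The point `w` lies neither on the path nor at `0`. -/
def OffPath (B u v w : ℂ) : Prop :=
  -(w / (u * (B - w))) ∈ slitPlane ∧ -((w - B) / (v * B)) ∈ slitPlane

/-- A branch of the argument that is continuous off the path. -/
noncomputable def cutArg (B u v w : ℂ) : ℝ :=
  arg B + arg (-(w / (u * (B - w)))) + arg (-((w - B) / (v * B))) + Real.pi + arg u + arg v

theorem exp_arg_mul_I {z : ℂ} (hz : z ≠ 0) : Complex.exp (arg z * Complex.I) = z / ‖z‖ := by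
  have h : (‖z‖ : ℂ) ≠ 0 := by exact_mod_cast norm_ne_zero_iff.2 hz
  rw [eq_div_iff h, mul_comm]
  exact Complex.norm_mul_exp_arg_mul_I z

theorem exp_add_mul_I (x y : ℝ) : Complex.exp (((x + y : ℝ) : ℂ) * Complex.I) =
    Complex.exp (x * Complex.I) * Complex.exp (y * Complex.I) := by
  rw [← Complex.exp_add]; congr 1; push_cast; ring

namespace OffPath

variable {B u v w : ℂ}

theorem ne (h : OffPath B u v w) : w ≠ 0 ∧ w ≠ B ∧ u ≠ 0 ∧ v ≠ 0 ∧ B ≠ 0 := by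
  have h1 := Complex.slitPlane_ne_zero h.1
  have h2 := Complex.slitPlane_ne_zero h.2
  refine ⟨?_, ?_, ?_, ?_, ?_⟩ <;> rintro rfl
  · simp at h1
  · simp at h1
  · simp at h1
  · simp at h2
  · simp at h2

/-- The numbers whose arguments are summed, with `-1` supplying the `π`, multiply to `w`. Each
`w`-dependent factor is a negative real exactly when `w` lies on the open arc, respectively on the
open ray, so the jumps of `arg` occur only on the path. -/
theorem exp_cutArg (h : OffPath B u v w) :
    Complex.exp (cutArg B u v w * Complex.I) = w / ‖w‖ := by
  obtain ⟨h1, h2, h3, h4, h5⟩ := h.ne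
  have h6 : B - w ≠ 0 := sub_ne_zero.2 h2.symm
  have h7 : w - B ≠ 0 := sub_ne_zero.2 h2
  rw [cutArg, exp_add_mul_I, exp_add_mul_I, exp_add_mul_I, exp_add_mul_I, exp_add_mul_I,
    exp_arg_mul_I h5, exp_arg_mul_I h3, exp_arg_mul_I h4, Complex.exp_pi_mul_I,
    exp_arg_mul_I (Complex.slitPlane_ne_zero h.1), exp_arg_mul_I (Complex.slitPlane_ne_zero h.2)]
  simp only [norm_neg, norm_div, norm_mul, norm_sub_rev w B]
  have n1 : (‖w‖ : ℂ) ≠ 0 := by exact_mod_cast norm_ne_zero_iff.2 h1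
  have n3 : (‖u‖ : ℂ) ≠ 0 := by exact_mod_cast norm_ne_zero_iff.2 h3
  have n4 : (‖v‖ : ℂ) ≠ 0 := by exact_mod_cast norm_ne_zero_iff.2 h4
  have n5 : (‖B‖ : ℂ) ≠ 0 := by exact_mod_cast norm_ne_zero_iff.2 h5
  have n6 : (‖B - w‖ : ℂ) ≠ 0 := by exact_mod_cast norm_ne_zero_iff.2 h6
  push_cast
  field_simp
  ring

theorem continuousAt_cutArg (h : OffPath B u v w) : ContinuousAt (cutArg B u v) w := by
  obtain ⟨h1, h2, h3, h4, h5⟩ := h.ne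
  have c1 : ContinuousAt (fun w => arg (-(w / (u * (B - w))))) w := by
    refine ContinuousAt.comp (f := fun w => -(w / (u * (B - w)))) (Complex.continuousAt_arg h.1) ?_
    exact (ContinuousAt.div (g := fun w => u * (B - w)) continuousAt_id (by fun_prop)
      (mul_ne_zero h3 (sub_ne_zero.2 h2.symm))).neg
  have c2 : ContinuousAt (fun w => arg (-((w - B) / (v * B)))) w := by
    refine ContinuousAt.comp (f := fun w => -((w - B) / (v * B))) (Complex.continuousAt_arg h.2) ?_
    fun_prop
  unfold cutArg
  exact ((((c1.const_add _).add c2).add_const _).add_const _).add_const _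

end OffPath

/-- Two continuous lifts of the same angle differ by a continuous function with values in the
discrete group `2πℤ`, which is constant on a connected set. -/
theorem exists_int_of_exp_eq {f g : ℝ → ℝ} {S : Set ℝ} (hS : IsPreconnected S)
    (hf : ContinuousOn f S) (hg : ContinuousOn g S)
    (h : ∀ x ∈ S, Complex.exp (f x * Complex.I) = Complex.exp (g x * Complex.I)) {x : ℝ}
    (hx : x ∈ S) : ∃ n : ℤ, ∀ y ∈ S, f y = g y + n * (2 * Real.pi) := by
  have key : ∀ y ∈ S, ∃ n : ℤ, f y - g y = n * (2 * Real.pi) := by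
    intro y hy
    obtain ⟨n, hn⟩ := Complex.exp_eq_exp_iff_exists_int.1 (h y hy)
    refine ⟨n, ?_⟩
    have h2 : ((f y - g y : ℝ) : ℂ) * Complex.I = ((n * (2 * Real.pi) : ℝ) : ℂ) * Complex.I := by
      push_cast
      linear_combination hn
    exact_mod_cast mul_right_cancel₀ Complex.I_ne_zero h2
  obtain ⟨n, hn⟩ := key x hx
  refine ⟨n, fun y hy => ?_⟩
  have hmaps : MapsTo (fun y => f y - g y) S
      (AddSubgroup.zmultiples (2 * Real.pi) : Set ℝ) := by
    intro y hy
    obtain ⟨m, hm⟩ := key y hy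
    exact AddSubgroup.mem_zmultiples_iff.2 ⟨m, by simp only [zsmul_eq_mul, hm]⟩
  have hd : IsDiscrete (AddSubgroup.zmultiples (2 * Real.pi) : Set ℝ) :=
    ⟨inferInstanceAs (DiscreteTopology (AddSubgroup.zmultiples (2 * Real.pi)))⟩
  have := hS.constant_of_mapsTo hd (hf.sub hg) hmaps hy hx
  simp only [Pi.sub_apply] at this
  linarith

/-! ### Lifts of the argument along a path and at its corner. -/

section Path

variable {B u v : ℂ}

theorem convex_mem_slitPlane (hu : u ∈ slitPlane) {τ : ℝ} (h0 : 0 ≤ τ) (h1 : τ ≤ 1) :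
    (1 - τ + τ * u : ℂ) ∈ slitPlane := by
  have := Complex.starConvex_one_slitPlane hu (a := 1 - τ) (b := τ) (by linarith) h0 (by ring)
  simpa [Complex.real_smul] using this

theorem one_add_mem_slitPlane (hv : v ∈ slitPlane) {t : ℝ} (h0 : 0 ≤ t) :
    (1 + t * v : ℂ) ∈ slitPlane := by
  rw [Complex.mem_slitPlane_iff] at hv ⊢
  rcases h0.eq_or_lt with rfl | h
  · left; simp
  · rcases hv with hv | hv
    · left; simp; positivity
    · right; simp [hv, h.ne']

theorem real_add_mem_slitPlane (hv : v ∈ slitPlane) {x : ℝ} (h0 : 0 ≤ x) :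
    (x + v : ℂ) ∈ slitPlane := by
  rw [Complex.mem_slitPlane_iff] at hv ⊢
  rcases hv with hv | hv
  · left; simp; positivity
  · right; simpa using hv

theorem inv_mem_slitPlane (hv : v ∈ slitPlane) : v⁻¹ ∈ slitPlane := by
  have h := Complex.mem_slitPlane_iff_arg.1 hv
  refine Complex.mem_slitPlane_iff_arg.2 ⟨?_, inv_ne_zero h.2⟩
  rw [Complex.arg_inv, if_neg h.1]
  linarith [Complex.neg_pi_lt_arg v]

/-- The argument along the arc. -/
noncomputable def leadArg (B u : ℂ) (τ : ℝ) : ℝ := arg B + arg u - arg (1 - τ + τ * u)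

/-- The argument along the ray. -/
noncomputable def tailArg (B v : ℂ) (t : ℝ) : ℝ := arg B + arg (1 + t * v)

theorem exp_leadArg (hB : B ≠ 0) (hu : u ∈ slitPlane) {τ : ℝ} (h0 : 0 < τ) (h1 : τ ≤ 1) :
    Complex.exp (leadArg B u τ * Complex.I) = leadArc B u τ / ‖leadArc B u τ‖ := by
  have hu0 := Complex.slitPlane_ne_zero hu
  have hd := Complex.slitPlane_ne_zero (convex_mem_slitPlane hu h0.le h1)
  have e : Complex.exp (leadArg B u τ * Complex.I) *
      Complex.exp (arg (1 - τ + τ * u) * Complex.I) = (B / ‖B‖) * (u / ‖u‖) := by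
    rw [← exp_arg_mul_I hB, ← exp_arg_mul_I hu0, ← exp_add_mul_I, ← exp_add_mul_I]
    congr 3
    simp [leadArg]
  rw [exp_arg_mul_I hd] at e
  have hn : ‖leadArc B u τ‖ = ‖B‖ * (τ * ‖u‖) / ‖(1 - τ + τ * u : ℂ)‖ := by
    rw [leadArc, norm_div, norm_mul, norm_mul, Complex.norm_real, Real.norm_of_nonneg h0.le]
  have n1 : (‖B‖ : ℂ) ≠ 0 := by exact_mod_cast norm_ne_zero_iff.2 hB
  have n2 : (‖u‖ : ℂ) ≠ 0 := by exact_mod_cast norm_ne_zero_iff.2 hu0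
  have n3 : (‖(1 - τ + τ * u : ℂ)‖ : ℂ) ≠ 0 := by exact_mod_cast norm_ne_zero_iff.2 hd
  have n4 : (τ : ℂ) ≠ 0 := by exact_mod_cast h0.ne'
  rw [hn, leadArc]
  push_cast
  refine mul_right_cancel₀ (div_ne_zero hd n3) (e.trans ?_)
  generalize (‖(1 - τ + τ * u : ℂ)‖ : ℂ) = N at n3 ⊢
  generalize (1 - τ + τ * u : ℂ) = d at hd ⊢
  field_simp

theorem exp_tailArg (hB : B ≠ 0) (hv : v ∈ slitPlane) {t : ℝ} (h0 : 0 ≤ t) :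
    Complex.exp (tailArg B v t * Complex.I) = tailRay B v t / ‖tailRay B v t‖ := by
  rw [tailArg, exp_add_mul_I, exp_arg_mul_I hB,
    exp_arg_mul_I (Complex.slitPlane_ne_zero (one_add_mem_slitPlane hv h0)), tailRay, norm_mul]
  push_cast
  exact div_mul_div_comm _ _ _ _

theorem continuousAt_leadArc (hu : u ∈ slitPlane) {τ : ℝ} (h0 : 0 ≤ τ) (h1 : τ ≤ 1) :
    ContinuousAt (leadArc B u) τ := by
  unfold leadArc
  exact ContinuousAt.div (by fun_prop) (by fun_prop)
    (Complex.slitPlane_ne_zero (convex_mem_slitPlane hu h0 h1))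

theorem continuousAt_leadArg (hu : u ∈ slitPlane) {τ : ℝ} (h0 : 0 ≤ τ) (h1 : τ ≤ 1) :
    ContinuousAt (leadArg B u) τ := by
  unfold leadArg
  refine continuousAt_const.sub ?_
  exact ContinuousAt.comp (f := fun τ : ℝ => (1 - τ + τ * u : ℂ))
    (Complex.continuousAt_arg (convex_mem_slitPlane hu h0 h1)) (by fun_prop)

theorem continuousAt_tailArg (hv : v ∈ slitPlane) {t : ℝ} (h0 : 0 ≤ t) :
    ContinuousAt (tailArg B v) t := by
  unfold tailArg
  refine continuousAt_const.add ?_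
  exact ContinuousAt.comp (f := fun τ : ℝ => (1 + τ * v : ℂ))
    (Complex.continuousAt_arg (one_add_mem_slitPlane hv h0)) (by fun_prop)

theorem leadArc_one (hu : u ≠ 0) : leadArc B u 1 = B := by
  simp [leadArc]; field_simp

theorem leadArg_zero : leadArg B u 0 = arg B + arg u := by simp [leadArg]

theorem leadArg_one : leadArg B u 1 = arg B := by simp [leadArg]

theorem tailRay_zero : tailRay B v 0 = B := by simp [tailRay]

theorem tailArg_zero : tailArg B v 0 = arg B := by simp [tailArg]

/-- Two disjoint paths do not wind around each other: some lift of the second path lies between two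
consecutive lifts of the first one, at both ends. -/
theorem exists_lift_between {B' u' v' : ℂ} (hu : u ∈ slitPlane) (hv : v ∈ slitPlane)
    (hB' : B' ≠ 0) (hu' : u' ∈ slitPlane) (hv' : v' ∈ slitPlane)
    (harc : ∀ τ : ℝ, 0 < τ → τ ≤ 1 → OffPath B u v (leadArc B' u' τ))
    (hray : ∀ t : ℝ, 0 ≤ t → OffPath B u v (tailRay B' v' t)) :
    ∃ n : ℤ, cutArg B u v B' = arg B' + n * (2 * Real.pi) ∧
      arg B + arg u ≤ arg B' + arg u' + n * (2 * Real.pi) ∧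
      arg B' + arg u' + n * (2 * Real.pi) ≤ arg B + arg u + 2 * Real.pi ∧
      arg B + arg v ≤ arg B' + arg v' + n * (2 * Real.pi) ∧
      arg B' + arg v' + n * (2 * Real.pi) ≤ arg B + arg v + 2 * Real.pi := by
  have hu0' := Complex.slitPlane_ne_zero hu'
  have hu0 := Complex.slitPlane_ne_zero hu
  have hv0 := Complex.slitPlane_ne_zero hv
  have hoff := hray 0 le_rfl
  rw [tailRay_zero] at hoff
  obtain ⟨-, -, -, -, hB⟩ := hoff.ne
  obtain ⟨n, hn⟩ := exists_int_of_exp_eq (S := Ioc 0 1) isPreconnected_Ioc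
    (f := fun τ => cutArg B u v (leadArc B' u' τ)) (g := leadArg B' u')
    (fun τ hτ => (ContinuousAt.comp (f := leadArc B' u') (harc τ hτ.1 hτ.2).continuousAt_cutArg
      (continuousAt_leadArc hu' hτ.1.le hτ.2)).continuousWithinAt)
    (fun τ hτ => (continuousAt_leadArg hu' hτ.1.le hτ.2).continuousWithinAt)
    (fun τ hτ => by rw [(harc τ hτ.1 hτ.2).exp_cutArg, exp_leadArg hB' hu' hτ.1 hτ.2])
    (x := 1) (by simp)
  obtain ⟨n', hn'⟩ := exists_int_of_exp_eq (S := Ici 0) isPreconnected_Ici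
    (f := fun t => cutArg B u v (tailRay B' v' t)) (g := tailArg B' v')
    (fun t ht => (ContinuousAt.comp (f := tailRay B' v') (hray t ht).continuousAt_cutArg
      (by unfold tailRay; fun_prop)).continuousWithinAt)
    (fun t ht => (continuousAt_tailArg hv' ht).continuousWithinAt)
    (fun t ht => by rw [(hray t ht).exp_cutArg, exp_tailArg hB' hv' ht])
    (x := 0) (by simp)
  have h1 := hn 1 (by simp)
  have h2 := hn' 0 (by simp)
  simp only [leadArc_one hu0', leadArg_one] at h1
  simp only [tailRay_zero, tailArg_zero] at h2
  -- Both lifts are evaluated at the common point `B'`, so a single integer governs the behaviour at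
  -- `0` and at `∞`.
  have hnn : n' = n := by
    have : ((n' : ℝ) - n) * (2 * Real.pi) = 0 := by linarith
    rcases mul_eq_zero.1 this with h | h
    · exact_mod_cast sub_eq_zero.1 h
    · exact absurd h Real.two_pi_pos.ne'
  subst hnn
  refine ⟨n', h1, ?_⟩
  -- The argument of the arc factor of `cutArg` need not converge at `0`. It is kept on the other
  -- side and only bounded by `-π` and `π`, while all remaining terms converge.
  have t1 : Tendsto (fun τ => leadArg B' u' τ + n' * (2 * Real.pi) -
      arg (-((leadArc B' u' τ - B) / (v * B)))) (𝓝[>] 0)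
      (𝓝 (arg B' + arg u' + n' * (2 * Real.pi) + arg v)) := by
    have hl : -((leadArc B' u' 0 - B) / (v * B)) = v⁻¹ := by
      simp [leadArc]; field_simp
    have c : ContinuousAt (fun τ => leadArg B' u' τ + n' * (2 * Real.pi) -
      arg (-((leadArc B' u' τ - B) / (v * B)))) 0 := by
      refine ((continuousAt_leadArg hu' le_rfl zero_le_one).add_const _).sub ?_
      refine ContinuousAt.comp (f := fun τ => -((leadArc B' u' τ - B) / (v * B))) (g := arg)
        (Complex.continuousAt_arg ?_) ?_
      · rw [hl]; exact inv_mem_slitPlane hv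
      · exact (((continuousAt_leadArc hu' le_rfl zero_le_one).sub_const _).div_const _).neg
    have := c.tendsto.mono_left (nhdsWithin_le_nhds (s := Ioi 0))
    rw [hl, Complex.arg_inv, if_neg (Complex.mem_slitPlane_iff_arg.1 hv).1, leadArg_zero,
      sub_neg_eq_add] at this
    exact this
  have b1 : ∀ᶠ τ in 𝓝[>] (0 : ℝ), leadArg B' u' τ + n' * (2 * Real.pi) -
      arg (-((leadArc B' u' τ - B) / (v * B))) =
      arg B + arg (-(leadArc B' u' τ / (u * (B - leadArc B' u' τ)))) + Real.pi + arg u + arg v := by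
    filter_upwards [Ioc_mem_nhdsGT (zero_lt_one' ℝ)] with τ hτ
    have := hn τ hτ
    simp only [cutArg] at this
    linarith
  -- The end at `∞` is treated with `x = 1 / t`: positive scaling does not affect `arg`, and the
  -- limit becomes one at `0` from the right. Here the ray factor is the one that is only bounded.
  have t2 : Tendsto (fun x : ℝ => arg B' + arg (x + v') + n' * (2 * Real.pi) -
      arg (-(B' * (x + v') / (u * (B * x - B' * (x + v')))))) (𝓝[>] 0)
      (𝓝 (arg B' + arg v' + n' * (2 * Real.pi) + arg u)) := by
    have hv0' := Complex.slitPlane_ne_zero hv'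
    have hl : -(B' * ((0 : ℝ) + v') / (u * (B * (0 : ℝ) - B' * ((0 : ℝ) + v')))) = u⁻¹ := by
      simp; field_simp
    have c : ContinuousAt (fun x : ℝ => arg B' + arg (x + v') + n' * (2 * Real.pi) -
      arg (-(B' * (x + v') / (u * (B * x - B' * (x + v')))))) 0 := by
      refine ContinuousAt.sub (ContinuousAt.add (continuousAt_const.add ?_) continuousAt_const) ?_
      · exact ContinuousAt.comp (f := fun x : ℝ => (x + v' : ℂ)) (g := arg)
          (Complex.continuousAt_arg (real_add_mem_slitPlane hv' le_rfl)) (by fun_prop)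
      · refine ContinuousAt.comp
          (f := fun x : ℝ => -(B' * (x + v') / (u * (B * x - B' * (x + v'))))) (g := arg)
          (Complex.continuousAt_arg ?_) ?_
        · rw [hl]; exact inv_mem_slitPlane hu
        · refine (ContinuousAt.div (by fun_prop) (by fun_prop) ?_).neg
          simp [hu0, hv0', hB']
    have := c.tendsto.mono_left (nhdsWithin_le_nhds (s := Ioi 0))
    rw [hl, Complex.arg_inv, if_neg (Complex.mem_slitPlane_iff_arg.1 hu).1, sub_neg_eq_add] at this
    simpa using this
  have b2 : ∀ᶠ x : ℝ in 𝓝[>] (0 : ℝ), arg B' + arg (x + v') + n' * (2 * Real.pi) -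
      arg (-(B' * (x + v') / (u * (B * x - B' * (x + v'))))) =
      arg B + arg (-((tailRay B' v' x⁻¹ - B) / (v * B))) + Real.pi + arg u + arg v := by
    filter_upwards [self_mem_nhdsWithin] with x hx
    have hx0 : (0 : ℝ) < x := hx
    have hxc : (x : ℂ) ≠ 0 := by exact_mod_cast hx0.ne'
    have := hn' x⁻¹ (inv_nonneg.2 hx0.le)
    simp only [cutArg, tailArg] at this
    have e1 : (1 + ((x⁻¹ : ℝ) : ℂ) * v') = ((x⁻¹ : ℝ) : ℂ) * (x + v') := by
      push_cast; field_simp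
    have e2 : tailRay B' v' x⁻¹ / (u * (B - tailRay B' v' x⁻¹)) =
        B' * (x + v') / (u * (B * x - B' * (x + v'))) := by
      have e3 : B * x - B' * (x + v') = x * (B - tailRay B' v' x⁻¹) := by
        rw [tailRay, e1]; push_cast; field_simp
      rw [e3, show B' * (x + v') = x * tailRay B' v' x⁻¹ by
        rw [tailRay, e1]; push_cast; field_simp, mul_left_comm u, mul_div_mul_left _ _ hxc]
    rw [e1, e2, Complex.arg_real_mul _ (inv_pos.2 hx0)] at this
    linarith
  refine ⟨?_, ?_, ?_, ?_⟩
  · have := ge_of_tendsto (b := arg B + arg u + arg v) t1 (b1.mono fun τ h => by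
      rw [h]; linarith [Complex.neg_pi_lt_arg (-(leadArc B' u' τ / (u * (B - leadArc B' u' τ))))])
    linarith
  · have := le_of_tendsto (b := arg B + arg u + arg v + 2 * Real.pi) t1 (b1.mono fun τ h => by
      rw [h]; linarith [Complex.arg_le_pi (-(leadArc B' u' τ / (u * (B - leadArc B' u' τ))))])
    linarith
  · have := ge_of_tendsto (b := arg B + arg u + arg v) t2 (b2.mono fun x h => by
      rw [h]; linarith [Complex.neg_pi_lt_arg (-((tailRay B' v' x⁻¹ - B) / (v * B)))])
    linarith
  · have := le_of_tendsto (b := arg B + arg u + arg v + 2 * Real.pi) t2 (b2.mono fun x h => by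
      rw [h]; linarith [Complex.arg_le_pi (-((tailRay B' v' x⁻¹ - B) / (v * B)))])
    linarith

/-- If the arc and the ray of a path do not cross, the path turns by less than `π` at `B`. -/
theorem abs_arg_add_arg_lt (hu : u ∈ slitPlane) (hv : v ∈ slitPlane) (huv : u * v ∈ slitPlane)
    (h : ∀ t x : ℝ, 0 < t → 0 < x → 1 + t * v + x * (u * v) ≠ 0) :
    |arg u + arg v| < Real.pi := by
  have hu0 := Complex.slitPlane_ne_zero hu
  have hv0 := Complex.slitPlane_ne_zero hv
  have hvn : 0 < Complex.normSq v := Complex.normSq_pos.2 hv0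
  -- Solving `1 + t v + x u v = 0` over the reals gives these two numbers, divided by `normSq v`, as
  -- `t` and `x`; they cannot both be positive.
  have hnd : ¬ (0 < -((u * v).im / u.im) ∧ 0 < v.im / u.im) := by
    rintro ⟨h1, h2⟩
    have hui : u.im ≠ 0 := by
      intro h0; rw [h0] at h2; simp at h2
    have hr : (Complex.normSq v)⁻¹ * (v.re * v.re + v.im * v.im) = 1 := by
      rw [← Complex.normSq_apply, inv_mul_cancel₀ hvn.ne']
    have hq : u.im * u.im⁻¹ = 1 := mul_inv_cancel₀ hui
    refine h (-((u * v).im / u.im) * (Complex.normSq v)⁻¹) (v.im / u.im * (Complex.normSq v)⁻¹)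
      (by positivity) (by positivity) ?_
    apply Complex.ext
    · simp only [Complex.add_re, Complex.mul_re, Complex.one_re, Complex.zero_re,
        Complex.ofReal_re, Complex.ofReal_im, Complex.mul_im, div_eq_mul_inv]
      linear_combination (-(Complex.normSq v)⁻¹ * (v.re * v.re + v.im * v.im)) * hq - hr
    · simp only [Complex.add_im, Complex.mul_re, Complex.one_im, Complex.zero_im,
        Complex.ofReal_re, Complex.ofReal_im, Complex.mul_im, div_eq_mul_inv]
      ring
  have hpu := Complex.mem_slitPlane_iff_arg.1 hu
  have hpv := Complex.mem_slitPlane_iff_arg.1 hv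
  have hlu := Complex.neg_pi_lt_arg u
  have hlv := Complex.neg_pi_lt_arg v
  have hu1 := lt_of_le_of_ne (Complex.arg_le_pi u) hpu.1
  have hv1 := lt_of_le_of_ne (Complex.arg_le_pi v) hpv.1
  have him : ∀ z : ℂ, z.im = ‖z‖ * Real.sin (arg z) := fun z => (Complex.norm_mul_sin_arg z).symm
  have huvi : (u * v).im = ‖u‖ * ‖v‖ * Real.sin (arg u + arg v) := by
    rw [Complex.mul_im, Real.sin_add, ← Complex.norm_mul_sin_arg, ← Complex.norm_mul_sin_arg,
      ← Complex.norm_mul_cos_arg, ← Complex.norm_mul_cos_arg]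
    ring
  have hnu : 0 < ‖u‖ := norm_pos_iff.2 hu0
  have hnv : 0 < ‖v‖ := norm_pos_iff.2 hv0
  have hne : arg u + arg v ≠ Real.pi ∧ arg u + arg v ≠ -Real.pi := by
    have e : u * v = ‖u‖ * ‖v‖ * Complex.exp ((arg u + arg v : ℝ) * Complex.I) := by
      rw [exp_add_mul_I]
      nth_rewrite 1 [← Complex.norm_mul_exp_arg_mul_I u]
      nth_rewrite 1 [← Complex.norm_mul_exp_arg_mul_I v]
      ring
    have hneg : ∀ z : ℂ, z = -1 → u * v ≠ ‖u‖ * ‖v‖ * z := by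
      rintro z rfl hz
      rw [Complex.mem_slitPlane_iff, hz] at huv
      have : 0 < ‖u‖ * ‖v‖ := by positivity
      simp at huv
      linarith
    constructor
    · intro hp
      rw [hp] at e
      exact hneg _ Complex.exp_pi_mul_I e
    · intro hp
      rw [hp] at e
      refine hneg _ ?_ e
      push_cast
      rw [neg_mul, Complex.exp_neg, Complex.exp_pi_mul_I]
      norm_num
  rw [abs_lt]
  -- A sum of arguments beyond `±π` forces both to have the same sign and the sine of the sum to
  -- have the opposite one, so both coordinates of the crossing become positive.
  constructor
  · by_contra hcon
    have hlt : arg u + arg v < -Real.pi := lt_of_le_of_ne (not_lt.1 hcon) hne.2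
    have s1 : Real.sin (arg u) < 0 := Real.sin_neg_of_neg_of_neg_pi_lt (by linarith) hlu
    have s2 : Real.sin (arg v) < 0 := Real.sin_neg_of_neg_of_neg_pi_lt (by linarith) hlv
    have s3 : 0 < Real.sin (arg u + arg v) := by
      rw [← Real.sin_add_two_pi]
      exact Real.sin_pos_of_pos_of_lt_pi (by linarith) (by linarith)
    refine hnd ⟨?_, ?_⟩
    · rw [huvi, him u, neg_pos]
      exact div_neg_of_pos_of_neg (by positivity) (mul_neg_of_pos_of_neg hnu s1)
    · rw [him u, him v]
      exact div_pos_of_neg_of_neg (mul_neg_of_pos_of_neg hnv s2) (mul_neg_of_pos_of_neg hnu s1)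
  · by_contra hcon
    have hlt : Real.pi < arg u + arg v := lt_of_le_of_ne (not_lt.1 hcon) hne.1.symm
    have s1 : 0 < Real.sin (arg u) := Real.sin_pos_of_pos_of_lt_pi (by linarith) hu1
    have s2 : 0 < Real.sin (arg v) := Real.sin_pos_of_pos_of_lt_pi (by linarith) hv1
    have s3 : Real.sin (arg u + arg v) < 0 := by
      rw [← Real.sin_sub_two_pi]
      exact Real.sin_neg_of_neg_of_neg_pi_lt (by linarith) (by linarith)
    refine hnd ⟨?_, ?_⟩
    · rw [huvi, him u, neg_pos]
      exact div_neg_of_neg_of_pos (mul_neg_of_pos_of_neg (by positivity) s3) (by positivity)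
    · rw [him u, him v]
      positivity

/-- The increase of `cutArg` over `arg B` when `B` is approached from the direction `B * e`. -/
noncomputable def sideArg (u v e : ℂ) : ℝ :=
  arg (u * e)⁻¹ + arg (-(e / v)) + Real.pi + arg u + arg v

/-- Both factors of `cutArg` degenerate at `B`. Rescaled by a positive real, they depend on the
difference quotient of the curve, whose limit is `e * B`; the slit plane conditions say that `e`
points neither along the arc nor along the ray. -/
theorem tendsto_cutArg {c : ℝ → ℂ} {e : ℂ} (hB : B ≠ 0) (hu : u ≠ 0) (he : e ≠ 0)
    (h1 : (u * e)⁻¹ ∈ slitPlane) (h2 : -(e / v) ∈ slitPlane) (hc0 : c 0 = B)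
    (hc : HasDerivWithinAt c (e * B) (Icc 0 1) 0) :
    Tendsto (fun t => cutArg B u v (c t)) (𝓝[>] 0) (𝓝 (arg B + sideArg u v e)) := by
  have hv : v ≠ 0 := by
    rintro rfl
    exact Complex.slitPlane_ne_zero h2 (by simp)
  have hs : Tendsto (fun t : ℝ => (c t - B) / t) (𝓝[>] 0) (𝓝 (e * B)) := by
    have := hasDerivWithinAt_iff_tendsto_slope.1 hc
    rw [Icc_sdiff_left, nhdsWithin_Ioc_eq_nhdsGT zero_lt_one] at this
    refine this.congr fun t => ?_
    rw [slope_def_module, hc0, sub_zero, Complex.real_smul, div_eq_inv_mul]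
    push_cast
    rfl
  have hcB : Tendsto c (𝓝[>] 0) (𝓝 B) := by
    have := hc.continuousWithinAt.tendsto
    rw [hc0] at this
    refine this.mono_left ?_
    rw [← nhdsWithin_Ioc_eq_nhdsGT (zero_lt_one' ℝ)]
    exact nhdsWithin_mono _ Ioc_subset_Icc_self
  have t1 : Tendsto (fun t : ℝ => c t / (u * ((c t - B) / t))) (𝓝[>] 0) (𝓝 (u * e)⁻¹) := by
    have := hcB.div (hs.const_mul u) (mul_ne_zero hu (mul_ne_zero he hB))
    have e0 : B / (u * (e * B)) = (u * e)⁻¹ := by field_simp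
    rw [e0] at this
    exact this
  have t2 : Tendsto (fun t : ℝ => -(((c t - B) / t) / (v * B))) (𝓝[>] 0) (𝓝 (-(e / v))) := by
    have := (hs.div_const (v * B)).neg
    convert this using 2
    field_simp
  have t3 := ((Complex.continuousAt_arg h1).tendsto.comp t1).add
    ((Complex.continuousAt_arg h2).tendsto.comp t2)
  have t4 := ((((t3.const_add (arg B)).add_const Real.pi).add_const (arg u)).add_const (arg v))
  have e0 : arg B + sideArg u v e =
      arg B + (arg (u * e)⁻¹ + arg (-(e / v))) + Real.pi + arg u + arg v := by
    rw [sideArg]; ring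
  rw [e0]
  refine t4.congr' ?_
  filter_upwards [self_mem_nhdsWithin] with t ht
  have ht0 : (0 : ℝ) < t := ht
  have htc : (t : ℂ) ≠ 0 := by exact_mod_cast ht0.ne'
  simp only [cutArg, Function.comp]
  have e1 : c t / (u * ((c t - B) / t)) = (t : ℝ) * -(c t / (u * (B - c t))) := by
    rw [← neg_sub (c t) B]
    simp only [div_eq_mul_inv, mul_inv, inv_inv, inv_neg, mul_neg, neg_neg]
    ring
  have e2 : -((c t - B) / t / (v * B)) = ((t⁻¹ : ℝ) : ℂ) * -((c t - B) / (v * B)) := by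
    push_cast
    field_simp
  rw [e1, e2, Complex.arg_real_mul _ ht0, Complex.arg_real_mul _ (inv_pos.2 ht0)]
  ring

/-- Comparison of two branches of the argument along a curve that avoids both paths. -/
theorem cutArg_sub_cutArg_const {B' u' v' : ℂ} {c : ℝ → ℂ} {S : Set ℝ} (hS : IsPreconnected S)
    (hc : ContinuousOn c S) (h : ∀ t ∈ S, OffPath B u v (c t))
    (h' : ∀ t ∈ S, OffPath B' u' v' (c t)) {x y : ℝ} (hx : x ∈ S) (hy : y ∈ S) :
    cutArg B' u' v' (c x) - cutArg B u v (c x) = cutArg B' u' v' (c y) - cutArg B u v (c y) := by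
  obtain ⟨n, hn⟩ := exists_int_of_exp_eq hS
    (f := fun t => cutArg B' u' v' (c t)) (g := fun t => cutArg B u v (c t))
    (fun t ht => ContinuousAt.comp_continuousWithinAt (h' t ht).continuousAt_cutArg (hc t ht))
    (fun t ht => ContinuousAt.comp_continuousWithinAt (h t ht).continuousAt_cutArg (hc t ht))
    (fun t ht => by rw [(h t ht).exp_cutArg, (h' t ht).exp_cutArg]) hx
  have h1 : cutArg B' u' v' (c x) = _ := hn x hx
  have h2 : cutArg B' u' v' (c y) = _ := hn y hy
  linarith

/-- The same comparison along a curve that starts at `B`. -/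
theorem cutArg_sub_cutArg_of_start {B' u' v' : ℂ} {c : ℝ → ℂ} {e : ℂ} (hB : B ≠ 0) (hu : u ≠ 0)
    (he : e ≠ 0) (h1 : (u * e)⁻¹ ∈ slitPlane) (h2 : -(e / v) ∈ slitPlane) (hc0 : c 0 = B)
    (hd : HasDerivWithinAt c (e * B) (Icc 0 1) 0) (hc : ContinuousOn c (Icc 0 1))
    (h : ∀ t ∈ Ioc (0 : ℝ) 1, OffPath B u v (c t))
    (h' : ∀ t ∈ Icc (0 : ℝ) 1, OffPath B' u' v' (c t)) :
    cutArg B' u' v' (c 1) - cutArg B u v (c 1) = cutArg B' u' v' B - (arg B + sideArg u v e) := by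
  have t1 := tendsto_cutArg hB hu he h1 h2 hc0 hd
  have m0 : (0 : ℝ) ∈ Icc (0 : ℝ) 1 := by simp
  have t2 : Tendsto (fun t => cutArg B' u' v' (c t)) (𝓝[>] 0) (𝓝 (cutArg B' u' v' B)) := by
    have hb : ContinuousWithinAt (fun t => cutArg B' u' v' (c t)) (Icc 0 1) 0 :=
      ContinuousAt.comp_continuousWithinAt (h' 0 m0).continuousAt_cutArg (hc 0 m0)
    have := hb.tendsto
    rw [hc0] at this
    refine this.mono_left ?_
    rw [← nhdsWithin_Ioc_eq_nhdsGT (zero_lt_one' ℝ)]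
    exact nhdsWithin_mono _ Ioc_subset_Icc_self
  refine tendsto_nhds_unique ?_ (t2.sub t1)
  refine Tendsto.congr' ?_ tendsto_const_nhds
  filter_upwards [Ioc_mem_nhdsGT (zero_lt_one' ℝ)] with t ht
  exact cutArg_sub_cutArg_const isPreconnected_Ioc (hc.mono Ioc_subset_Icc_self) h
    (fun t ht => h' t (Ioc_subset_Icc_self ht)) (by simp) ht

/-- The ray factor contributes exactly `τ - π`, and the arc factor lies strictly between `-π` and
`π`. So the value `0` belongs to the counterclockwise side of the path and `2π` to the other side.
-/
theorem sideArg_lt {e : ℂ} {τ : ℝ} {r : ℝ} (hr : 0 < r) (hv : v ≠ 0)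
    (h0 : 0 < τ) (h1 : τ < 2 * Real.pi) (he : e = r * (v * Complex.exp (τ * Complex.I)))
    (hue : (u * e)⁻¹ ∈ slitPlane) :
    (sideArg u v e = 0 → τ < Real.pi - (arg u + arg v)) ∧
    (sideArg u v e = 2 * Real.pi → Real.pi - (arg u + arg v) < τ) := by
  have ha : arg (-(e / v)) = τ - Real.pi := by
    have : -(e / v) = r * (Complex.cos ((τ - Real.pi : ℝ)) + Complex.sin ((τ - Real.pi : ℝ)) *
        Complex.I) := by
      rw [← Complex.exp_mul_I, he]
      push_cast
      rw [sub_mul, Complex.exp_sub, Complex.exp_pi_mul_I]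
      field_simp
    rw [this, Complex.arg_mul_cos_add_sin_mul_I hr ⟨by linarith, by linarith⟩]
  have hl := Complex.neg_pi_lt_arg (u * e)⁻¹
  have hu := lt_of_le_of_ne (Complex.arg_le_pi (u * e)⁻¹) (Complex.mem_slitPlane_iff_arg.1 hue).1
  rw [sideArg, ha]
  constructor <;> intro h <;> linarith

end Path

/-! ### Crossings of two consecutive paths -/

/-- The unit complex number with argument `x`. -/
noncomputable def cis (x : ℝ) : ℂ := Complex.exp (x * Complex.I)

theorem cis_add (x y : ℝ) : cis (x + y) = cis x * cis y := exp_add_mul_I x y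

theorem cis_zero : cis 0 = 1 := by simp [cis]

theorem cis_ne_zero (x : ℝ) : cis x ≠ 0 := Complex.exp_ne_zero _

theorem norm_cis (x : ℝ) : ‖cis x‖ = 1 := Complex.norm_exp_ofReal_mul_I x

theorem conj_cis (x : ℝ) : conj (cis x) = cis (-x) := by
  simp [cis, ← Complex.exp_conj]

theorem cis_re (x : ℝ) : (cis x).re = Real.cos x := Complex.exp_ofReal_mul_I_re x

theorem cis_im (x : ℝ) : (cis x).im = Real.sin x := Complex.exp_ofReal_mul_I_im x

theorem cis_mul_conj (x : ℝ) : cis x * conj (cis x) = 1 := by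
  rw [conj_cis, ← cis_add, add_neg_cancel, cis_zero]

/-- The linear relation between three unit vectors, that is, the sine rule; it supplies all
intersection points below. -/
theorem sin_mul_cis (a b c : ℝ) : (Real.sin (b - c) : ℂ) * cis a + Real.sin (c - a) * cis b +
    Real.sin (a - b) * cis c = 0 := by
  apply Complex.ext
  · simp only [Complex.add_re, Complex.mul_re, Complex.ofReal_re, Complex.ofReal_im, cis_re,
      Real.sin_sub, Complex.zero_re]
    ring
  · simp only [Complex.add_im, Complex.mul_im, Complex.ofReal_re, Complex.ofReal_im, cis_im,
      Real.sin_sub, Complex.zero_im]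
    ring

/-- Two arcs that leave `0` at angle `β` and bend towards each other cross. The arcs are given
by their images under inversion. -/
theorem le_of_arcs_disjoint {β h μ θ x y : ℝ} (hβ : 0 < β) (hβ' : β ≤ Real.pi / 9)
    (hh : h = (Real.pi - β) / 2) (hμ : 0 ≤ μ) (hμh : μ + h < Real.pi) (hx : 0 < x) (hy : 0 < y)
    (H : ∀ t t' : ℝ, 0 < t → 0 < t' →
      x * cis (θ + μ + h) + t * cis θ ≠ y * cis (θ + β + μ - h) + t' * cis (θ + β)) :
    x * Real.sin (μ + h) ≤ y * Real.sin (β + μ - h) := by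
  have hpi := Real.pi_pos
  by_contra hcon
  rw [not_le] at hcon
  have sβ : 0 < Real.sin β := Real.sin_pos_of_pos_of_lt_pi hβ (by linarith)
  have sβc : (Real.sin β : ℂ) ≠ 0 := by exact_mod_cast sβ.ne'
  have sa : 0 < Real.sin (μ + h - β) := Real.sin_pos_of_pos_of_lt_pi (by linarith) (by linarith)
  -- This makes the first parameter of the intersection positive; the negated goal does so for the
  -- second.
  have ht : y * Real.sin (μ - h) < x * Real.sin (μ + h - β) := by
    rcases le_or_gt μ h with hle | hlt
    · have : Real.sin (μ - h) ≤ 0 := Real.sin_nonpos_of_nonpos_of_neg_pi_le (by linarith) (by linarith)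
      nlinarith [mul_pos hx sa]
    · have s1 : 0 < Real.sin (μ - h) := Real.sin_pos_of_pos_of_lt_pi (by linarith) (by linarith)
      have s2 : 0 < Real.sin (β + μ - h) := Real.sin_pos_of_pos_of_lt_pi (by linarith) (by linarith)
      -- The two products have the same angle sum `2μ`, so the comparison reduces to `cos (2h) ≤ cos
      -- (2h - 2β)`.
      have key : Real.sin (μ + h) * Real.sin (μ - h) ≤
          Real.sin (μ + h - β) * Real.sin (β + μ - h) := by
        have p : ∀ a b : ℝ, Real.sin a * Real.sin b =
            (Real.cos (a - b) - Real.cos (a + b)) / 2 := by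
          intro a b; rw [Real.cos_sub, Real.cos_add]; ring
        rw [p, p, show μ + h - (μ - h) = 2 * h by ring,
          show μ + h - β - (β + μ - h) = 2 * h - 2 * β by ring,
          show μ + h - β + (β + μ - h) = μ + h + (μ - h) by ring]
        have := Real.cos_le_cos_of_nonneg_of_le_pi (x := 2 * h - 2 * β) (y := 2 * h)
          (by linarith) (by linarith) (by linarith)
        linarith
      have k1 : y * Real.sin (β + μ - h) * Real.sin (μ - h) <
          x * Real.sin (μ + h) * Real.sin (μ - h) := mul_lt_mul_of_pos_right hcon s1
      have k2 : x * (Real.sin (μ + h) * Real.sin (μ - h)) ≤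
          x * (Real.sin (μ + h - β) * Real.sin (β + μ - h)) := mul_le_mul_of_nonneg_left key hx.le
      refine lt_of_mul_lt_mul_right (a := Real.sin (β + μ - h)) ?_ s2.le
      linarith
  -- Each parameter is obtained by taking components perpendicular to the other ray.
  refine H ((x * Real.sin (μ + h - β) - y * Real.sin (μ - h)) / Real.sin β)
    ((x * Real.sin (μ + h) - y * Real.sin (β + μ - h)) / Real.sin β)
    (div_pos (by linarith) sβ) (div_pos (by linarith) sβ) ?_
  rw [show θ + μ + h = θ + (μ + h) by ring, show θ + β + μ - h = θ + (β + μ - h) by ring,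
    cis_add θ (μ + h), cis_add θ (β + μ - h), cis_add θ β]
  have e1 := sin_mul_cis (μ + h) β 0
  have e2 := sin_mul_cis (β + μ - h) β 0
  rw [sub_zero, zero_sub, Real.sin_neg, cis_zero] at e1 e2
  rw [show β + μ - h - β = μ - h by ring] at e2
  generalize Real.sin (μ + h) = A, Real.sin (μ + h - β) = A', Real.sin (β + μ - h) = C,
    Real.sin (μ - h) = C', Real.sin β = S, cis (μ + h) = E, cis (β + μ - h) = E',
    cis β = E₀ at e1 e2 sβc ⊢
  push_cast at e1 e2 ⊢
  field_simp
  linear_combination (x * cis θ) * e1 - (y * cis θ) * e2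

/-- If the ray of a path that turns right does not cross the arc of the next path, then that
arc is short. -/
theorem lt_of_ray_arc_disjoint {β h μ θ ρ ρ' : ℝ} (hβ : 0 < β) (hβ' : β ≤ Real.pi / 9)
    (hh : h = (Real.pi - β) / 2) (hμ : h < β + μ) (hμh : μ + h < Real.pi) (hρ : 0 < ρ)
    (hρ' : 0 < ρ')
    (H : ∀ t t' : ℝ, 0 < t → 0 < t' →
      (ρ * cis (θ + μ - h) + t * cis (θ + 2 * μ)) *
        conj ((ρ'⁻¹ : ℝ) * cis (θ + β + μ + h) + t' * cis (θ + β)) ≠ 1) :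
    ρ' * Real.sin (μ - β / 2) ^ 2 < ρ * Real.sin (μ + h) ^ 2 := by
  have hpi := Real.pi_pos
  by_contra hcon
  rw [not_lt] at hcon
  have hS : 0 < Real.sin (μ + h) := Real.sin_pos_of_pos_of_lt_pi (by linarith) hμh
  -- In direction `θ + x` the ray is at distance `ρ sin (μ + h) / sin (2μ - x)` from `0` and the arc
  -- at distance `ρ' sin (x - β) / sin (μ + h)`, so a zero of `f` is a crossing. The arc starts
  -- below the ray at `x = β`; the endpoint `μ + β / 2` is where the two sines agree.
  let f : ℝ → ℝ := fun x => ρ' * (Real.sin (x - β) * Real.sin (2 * μ - x)) -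
    ρ * Real.sin (μ + h) ^ 2
  have hf : Continuous f := by fun_prop
  have fa : f β < 0 := by
    simp only [f, sub_self, Real.sin_zero]
    nlinarith [mul_pos hρ (pow_pos hS 2)]
  have fb : 0 ≤ f (μ + β / 2) := by
    simp only [f]
    rw [show μ + β / 2 - β = μ - β / 2 by ring, show 2 * μ - (μ + β / 2) = μ - β / 2 by ring]
    nlinarith
  obtain ⟨x, ⟨hx1, hx2⟩, hfx⟩ := intermediate_value_Icc (by linarith : β ≤ μ + β / 2)
    hf.continuousOn ⟨fa.le, fb⟩
  have hxβ : β < x := by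
    refine lt_of_le_of_ne hx1 ?_
    rintro rfl
    exact fa.ne hfx
  have s1 : 0 < Real.sin (x - β) := Real.sin_pos_of_pos_of_lt_pi (by linarith) (by linarith)
  have s2 : 0 < Real.sin (2 * μ - x) := Real.sin_pos_of_pos_of_lt_pi (by linarith) (by linarith)
  have s3 : 0 < Real.sin (x - μ + h) := Real.sin_pos_of_pos_of_lt_pi (by linarith) (by linarith)
  have s4 : 0 < Real.sin (μ + h + β - x) := Real.sin_pos_of_pos_of_lt_pi (by linarith) (by linarith)
  have hfx' : ρ' * (Real.sin (x - β) * Real.sin (2 * μ - x)) = ρ * Real.sin (μ + h) ^ 2 := by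
    simp only [f] at hfx; linarith
  have c1 : (Real.sin (x - β) : ℂ) ≠ 0 := by exact_mod_cast s1.ne'
  have c2 : (Real.sin (2 * μ - x) : ℂ) ≠ 0 := by exact_mod_cast s2.ne'
  have c5 : (ρ' : ℂ) ≠ 0 := by exact_mod_cast hρ'.ne'
  have hr : ρ'⁻¹ * Real.sin (μ + h) / Real.sin (x - β) =
      (ρ * Real.sin (μ + h) / Real.sin (2 * μ - x))⁻¹ := by
    have : ρ * Real.sin (μ + h) * (ρ'⁻¹ * Real.sin (μ + h)) =
        Real.sin (x - β) * Real.sin (2 * μ - x) := by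
      rw [mul_mul_mul_comm, mul_comm ρ, mul_assoc, ← pow_two, ← hfx',
        inv_mul_cancel_left₀ hρ'.ne']
    rw [inv_div, div_eq_div_iff s1.ne' (by positivity)]
    linarith
  refine H (ρ * Real.sin (x - μ + h) / Real.sin (2 * μ - x))
    (ρ'⁻¹ * Real.sin (μ + h + β - x) / Real.sin (x - β)) (by positivity) (by positivity) ?_
  have e1 : (ρ * cis (θ + μ - h) + (ρ * Real.sin (x - μ + h) / Real.sin (2 * μ - x) : ℝ) *
      cis (θ + 2 * μ)) =
      (ρ * Real.sin (μ + h) / Real.sin (2 * μ - x) : ℝ) * cis (θ + x) := by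
    have e := sin_mul_cis (μ - h) x (2 * μ)
    rw [show x - 2 * μ = -(2 * μ - x) by ring, show 2 * μ - (μ - h) = μ + h by ring,
      show μ - h - x = -(x - μ + h) by ring, Real.sin_neg, Real.sin_neg] at e
    rw [show θ + μ - h = θ + (μ - h) by ring, cis_add θ (μ - h), cis_add θ (2 * μ), cis_add θ x]
    rw [Complex.ofReal_div, Complex.ofReal_div, Complex.ofReal_mul, Complex.ofReal_mul]
    rw [Complex.ofReal_neg, Complex.ofReal_neg] at e
    generalize Real.sin (2 * μ - x) = A, Real.sin (μ + h) = A', Real.sin (x - μ + h) = A'',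
      cis (μ - h) = E, cis (2 * μ) = E' at e c2 ⊢
    field_simp
    linear_combination (-(ρ * cis θ : ℂ)) * e
  have e2 : (ρ'⁻¹ : ℝ) * cis (θ + β + μ + h) +
      (ρ'⁻¹ * Real.sin (μ + h + β - x) / Real.sin (x - β) : ℝ) * cis (θ + β) =
      (ρ'⁻¹ * Real.sin (μ + h) / Real.sin (x - β) : ℝ) * cis (θ + x) := by
    have e := sin_mul_cis (μ + h + β) x β
    rw [show β - (μ + h + β) = -(μ + h) by ring, Real.sin_neg] at e
    rw [show θ + β + μ + h = θ + (μ + h + β) by ring, cis_add θ (μ + h + β), cis_add θ β,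
      cis_add θ x]
    rw [Complex.ofReal_div, Complex.ofReal_div, Complex.ofReal_mul, Complex.ofReal_mul]
    rw [Complex.ofReal_neg] at e
    generalize Real.sin (x - β) = A, Real.sin (μ + h) = A', Real.sin (μ + h + β - x) = A'',
      cis (μ + h + β) = E, cis β = E' at e c1 ⊢
    push_cast
    field_simp
    linear_combination (cis θ : ℂ) * e
  rw [e1, e2, hr, map_mul, Complex.conj_ofReal, mul_mul_mul_comm, cis_mul_conj, mul_one,
    ← Complex.ofReal_mul, mul_inv_cancel₀ (by positivity), Complex.ofReal_one]

/-- Three consecutive paths, turning left, right and left. -/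
theorem radius_lt {β h μ θ ρ₀ ρ₁ ρ₂ : ℝ} (hβ : 0 < β) (hβ' : β ≤ Real.pi / 9)
    (hh : h = (Real.pi - β) / 2) (hμ : 0 ≤ μ) (hμh : μ + h < Real.pi)
    (h₀ : 0 < ρ₀) (h₁ : 0 < ρ₁) (h₂ : 0 < ρ₂)
    (H : ∀ t t' : ℝ, 0 < t → 0 < t' →
      (ρ₀⁻¹ : ℝ) * cis (θ + μ + h) + t * cis θ ≠
        (ρ₁⁻¹ : ℝ) * cis (θ + β + μ - h) + t' * cis (θ + β))
    (H' : ∀ t t' : ℝ, 0 < t → 0 < t' →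
      (ρ₁ * cis (θ + β + μ - h) + t * cis (θ + β + 2 * μ)) *
        conj ((ρ₂⁻¹ : ℝ) * cis (θ + β + β + μ + h) + t' * cis (θ + β + β)) ≠ 1) :
    ρ₂ < ρ₀ := by
  have hpi := Real.pi_pos
  have hS : 0 < Real.sin (μ + h) := Real.sin_pos_of_pos_of_lt_pi (by linarith) hμh
  have h1 := le_of_arcs_disjoint hβ hβ' hh hμ hμh (inv_pos.2 h₀) (inv_pos.2 h₁) H
  -- The left side of `h1` is positive, hence so is `sin (β + μ - h)`; thus `μ` is nearly `π / 2` at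
  -- least.
  have h2 : h < β + μ := by
    by_contra hcon
    have : Real.sin (β + μ - h) ≤ 0 :=
      Real.sin_nonpos_of_nonpos_of_neg_pi_le (by linarith) (by linarith)
    have := mul_nonpos_of_nonneg_of_nonpos (inv_pos.2 h₁).le this
    have := mul_pos (inv_pos.2 h₀) hS
    linarith
  have h3 := lt_of_ray_arc_disjoint hβ hβ' hh h2 hμh h₁ h₂ H'
  have h4 : ρ₁ * Real.sin (μ + h) ≤ ρ₀ * Real.sin (β + μ - h) := by
    have := mul_le_mul_of_nonneg_left h1 (mul_pos h₀ h₁).le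
    field_simp at this
    linarith
  have h5 : ρ₂ * Real.sin (μ - β / 2) ^ 2 <
      ρ₀ * (Real.sin (μ + h) * Real.sin (β + μ - h)) := by
    nlinarith
  -- The angle difference is `2h - β = π - 2β`, so the product is at most `(1 - cos (2β)) / 2`.
  have h6 : Real.sin (μ + h) * Real.sin (β + μ - h) ≤ Real.sin β ^ 2 := by
    have p : Real.sin (μ + h) * Real.sin (β + μ - h) =
        (Real.cos (Real.pi - 2 * β) - Real.cos (2 * μ + β)) / 2 := by
      rw [show Real.pi - 2 * β = (μ + h) - (β + μ - h) by rw [hh]; ring,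
        show 2 * μ + β = (μ + h) + (β + μ - h) by ring, Real.cos_sub (μ + h), Real.cos_add (μ + h)]
      ring
    rw [p, Real.cos_pi_sub, Real.cos_two_mul, Real.cos_sq']
    linarith [Real.neg_one_le_cos (2 * μ + β)]
  -- The smallness of `β` enters here: `h2` gives `μ - β / 2 > π / 2 - 2β`, which exceeds `β`, and
  -- `μ + h < π` keeps the angle below `π / 2`.
  have h7 : Real.sin β < Real.sin (μ - β / 2) :=
    Real.sin_lt_sin_of_lt_of_le_pi_div_two (by linarith) (by linarith) (by linarith)
  have h8 : 0 < Real.sin β := Real.sin_pos_of_pos_of_lt_pi hβ (by linarith)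
  have h9 : Real.sin β ^ 2 < Real.sin (μ - β / 2) ^ 2 := by nlinarith
  have h10 : ρ₂ * Real.sin (μ - β / 2) ^ 2 < ρ₀ * Real.sin (μ - β / 2) ^ 2 := by nlinarith
  exact lt_of_mul_lt_mul_right h10 (by positivity)

/-! ### Cyclic orders -/

theorem Int.eq_zero_of_neg_lt_mul_lt {N x : ℤ} (hN : 0 < N) (h1 : -N < N * x) (h2 : N * x < N) :
    x = 0 := by
  have h3 : x < 1 := by nlinarith
  have h4 : -1 < x := by nlinarith
  omega

/-- If two cyclic orders agree, up to lifts, then they differ by a rotation. -/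
theorem exists_rotation {ι : Type*} [Finite ι] [Nonempty ι] {N : ℤ} (hN : 1 < N) {a c : ι → ℤ}
    (ha : ∀ m : ℤ, ∃ j, N ∣ a j - m) (hainj : ∀ i j, N ∣ a i - a j → i = j)
    (hc : ∀ i j, N ∣ c i - c j → i = j)
    (h : ∀ i j, i ≠ j → ∃ n : ℤ, a i ≤ a j + N * n ∧ a j + N * n ≤ a i + N ∧
      c i ≤ c j + N * n ∧ c j + N * n ≤ c i + N) :
    ∃ d, ∀ i, c i = a i + d := by
  -- Passing to the successor in the order `a` raises `a` by `1` and `c` by at least `1`, up to a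
  -- common lift. So `c - a` cannot drop, and its maximum propagates round the cycle.
  obtain ⟨i₀, hi₀⟩ := Finite.exists_max (fun i => c i - a i)
  refine ⟨c i₀ - a i₀, ?_⟩
  have key : ∀ m : ℕ, ∀ j, N ∣ a j - (a i₀ + m) → c j - a j = c i₀ - a i₀ := by
    intro m
    induction m with
    | zero =>
      intro j hj
      rw [hainj j i₀ (by simpa using hj)]
    | succ m ih =>
      intro j hj
      obtain ⟨i, hi⟩ := ha (a i₀ + m)
      have h1 := ih i hi
      have h2 : N ∣ a j - a i - 1 := by
        obtain ⟨x, hx⟩ := hj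
        obtain ⟨y, hy⟩ := hi
        exact ⟨x - y, by rw [mul_sub, ← hx, ← hy]; push_cast; ring⟩
      have hne : i ≠ j := by
        rintro rfl
        have := Int.le_of_dvd one_pos (by simpa using h2 : N ∣ 1)
        omega
      obtain ⟨n, l1, l2, l3, -⟩ := h i j hne
      obtain ⟨x, hx⟩ := h2
      have hxn : x + n = 0 := by
        have e : a j + N * n - a i - 1 = N * (x + n) := by rw [mul_add, ← hx]; ring
        refine Int.eq_zero_of_neg_lt_mul_lt (N := N) (by omega) ?_ ?_ <;> omega
      have e : a j + N * n = a i + 1 := by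
        have : N * (x + n) = 0 := by rw [hxn, mul_zero]
        rw [mul_add] at this
        omega
      have l4 : c j + N * n ≠ c i := by
        intro e'
        exact hne (hc i j ⟨n, by rw [← e']; ring⟩)
      have l5 := hi₀ j
      omega
  intro i
  have hpos : 0 ≤ (a i - a i₀) % N := Int.emod_nonneg _ (by omega)
  have := key ((a i - a i₀) % N).toNat i (by
    rw [Int.toNat_of_nonneg hpos]
    rw [show a i - (a i₀ + (a i - a i₀) % N) = a i - a i₀ - (a i - a i₀) % N by ring]
    exact Int.dvd_self_sub_emod)
  omega

/-- Two points that are not separated by any other pair of points are neighbours. -/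
theorem neighbours_of_not_separated {ι : Type*} {N : ℤ} (hN : 2 < N) {a : ι → ℤ}
    (ha : ∀ m : ℤ, ∃ j, N ∣ a j - m) (hainj : ∀ i j, N ∣ a i - a j → i = j) {n : ι → ι → ℤ}
    (hn : ∀ i j, i ≠ j → a i ≤ a j + N * n i j ∧ a j + N * n i j ≤ a i + N) {i i' : ι}
    (hii : i ≠ i') {M : ℤ} (h : ∀ l, l ≠ i → l ≠ i' → M = n l i - n l i' + n i i') :
    (N ∣ a i' - a i - 1 ∧ M = 0) ∨ (N ∣ a i' - a i + 1 ∧ M = 1) := by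
  have hs : ∀ i j, i ≠ j → a i < a j + N * n i j ∧ a j + N * n i j < a i + N := by
    intro i j hij
    obtain ⟨h1, h2⟩ := hn i j hij
    constructor
    · refine lt_of_le_of_ne h1 fun e => hij (hainj i j ⟨n i j, by omega⟩)
    · refine lt_of_le_of_ne h2 fun e => hij (hainj i j ⟨n i j - 1, by rw [mul_sub]; omega⟩)
  obtain ⟨p1, p2⟩ := hs i i' hii
  -- `M` records the cyclic orientation of the triple `l, i, i'`. Testing it on the successor `l` of
  -- `i` gives `1`, unless that successor is `i'`; the predecessor gives `0` in the same way. Being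
  -- constant, `M` cannot have both values.
  have hsucc : ¬ N ∣ a i' - a i - 1 → M = 1 := by
    intro hnot
    obtain ⟨l, r, hl⟩ := ha (a i + 1)
    have hli : l ≠ i := by
      rintro rfl
      have := Int.le_of_dvd one_pos (⟨-r, by rw [mul_neg]; omega⟩ : N ∣ 1)
      omega
    have hli' : l ≠ i' := by
      rintro rfl
      exact hnot ⟨r, by omega⟩
    obtain ⟨q1, q2⟩ := hs l i hli
    obtain ⟨q3, q4⟩ := hs l i' hli'
    have e1 : n l i - r - 1 = 0 := by
      refine Int.eq_zero_of_neg_lt_mul_lt (N := N) (by omega) ?_ ?_ <;>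
        rw [mul_sub, mul_sub] <;> omega
    have hne : a i' + N * n i i' ≠ a i + 1 := fun e => hnot ⟨-n i i', by rw [mul_neg]; omega⟩
    have e2 : n l i' - n i i' - r = 0 := by
      refine Int.eq_zero_of_neg_lt_mul_lt (N := N) (by omega) ?_ ?_ <;>
        rw [mul_sub, mul_sub] <;> omega
    have := h l hli hli'
    omega
  have hpred : ¬ N ∣ a i' - a i + 1 → M = 0 := by
    intro hnot
    obtain ⟨l, r, hl⟩ := ha (a i - 1)
    have hli : l ≠ i := by
      rintro rfl
      have := Int.le_of_dvd one_pos (⟨r, by omega⟩ : N ∣ 1)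
      omega
    have hli' : l ≠ i' := by
      rintro rfl
      exact hnot ⟨r, by omega⟩
    obtain ⟨q1, q2⟩ := hs l i hli
    obtain ⟨q3, q4⟩ := hs l i' hli'
    have e1 : n l i - r = 0 := by
      refine Int.eq_zero_of_neg_lt_mul_lt (N := N) (by omega) ?_ ?_ <;>
        rw [mul_sub] <;> omega
    have hne : a i' + N * n i i' ≠ a i - 1 + N := fun e =>
      hnot ⟨1 - n i i', by rw [mul_sub]; omega⟩
    have e2 : n l i' - n i i' - r = 0 := by
      refine Int.eq_zero_of_neg_lt_mul_lt (N := N) (by omega) ?_ ?_ <;>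
        rw [mul_sub, mul_sub] <;> omega
    have := h l hli hli'
    omega
  by_cases h1 : N ∣ a i' - a i - 1
  · refine Or.inl ⟨h1, hpred fun h2 => ?_⟩
    have := Int.le_of_dvd two_pos (by simpa using dvd_sub h2 h1 : N ∣ 2)
    omega
  · by_cases h2 : N ∣ a i' - a i + 1
    · exact Or.inr ⟨h2, hsucc h1⟩
    · have := hsucc h1
      have := hpred h2
      omega

/-! ### Normalized arcs and rays -/

theorem eq_norm_mul_cis (z : ℂ) : z = ‖z‖ * cis (arg z) := (Complex.norm_mul_exp_arg_mul_I z).symm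

theorem cis_add_int_mul_two_pi (x : ℝ) (n : ℤ) : cis (x + n * (2 * Real.pi)) = cis x := by
  refine Complex.exp_eq_exp_iff_exists_int.2 ⟨n, ?_⟩
  push_cast
  ring

theorem exists_int_of_cis_eq {x y : ℝ} (h : cis x = cis y) :
    ∃ n : ℤ, x = y + n * (2 * Real.pi) := by
  obtain ⟨n, hn⟩ := Complex.exp_eq_exp_iff_exists_int.1 h
  refine ⟨n, ?_⟩
  have h2 : (x : ℂ) * Complex.I = ((y + n * (2 * Real.pi) : ℝ) : ℂ) * Complex.I := by
    push_cast
    linear_combination hn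
  exact_mod_cast mul_right_cancel₀ Complex.I_ne_zero h2

theorem cis_eq_of_pos_mul_eq {r s x y : ℝ} (hr : 0 < r) (hs : 0 < s) (h : r * cis x = s * cis y) :
    cis x = cis y := by
  have hn := congrArg norm h
  rw [norm_mul, norm_mul, norm_cis, norm_cis, Complex.norm_real, Complex.norm_real,
    Real.norm_of_nonneg hr.le, Real.norm_of_nonneg hs.le, mul_one, mul_one] at hn
  rw [hn] at h
  exact mul_left_cancel₀ (by exact_mod_cast hs.ne') h

theorem exists_arg_add_arg_eq {z w : ℂ} {r x : ℝ} (hz : z ≠ 0) (hw : w ≠ 0) (hr : 0 < r)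
    (h : z * w = r * cis x) : ∃ n : ℤ, arg z + arg w = x + n * (2 * Real.pi) := by
  refine exists_int_of_cis_eq (cis_eq_of_pos_mul_eq
    (mul_pos (norm_pos_iff.2 hz) (norm_pos_iff.2 hw)) hr ?_)
  rw [← h, cis_add]
  nth_rewrite 3 [eq_norm_mul_cis z]
  nth_rewrite 3 [eq_norm_mul_cis w]
  push_cast
  ring

/-- This and its analogue for the ray turn `OffPath` back into honest disjointness of arcs and rays.
-/
theorem not_offPath_leadArc {B u v : ℂ} (hB : B ≠ 0) (hu : u ∈ slitPlane) {τ : ℝ} (h0 : 0 < τ)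
    (h1 : τ < 1) : ¬ OffPath B u v (leadArc B u τ) := by
  rintro ⟨h, -⟩
  have hu0 := Complex.slitPlane_ne_zero hu
  have hd := Complex.slitPlane_ne_zero (convex_mem_slitPlane hu h0.le h1.le)
  have hτ : (1 - τ : ℂ) ≠ 0 := by exact_mod_cast (sub_pos.2 h1).ne'
  have e : -(leadArc B u τ / (u * (B - leadArc B u τ))) = ((-(τ / (1 - τ)) : ℝ) : ℂ) := by
    have e1 : B - leadArc B u τ = B * (1 - τ) / (1 - τ + τ * u) := by
      rw [leadArc]; field_simp; ring
    rw [e1, leadArc]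
    push_cast
    field_simp
  rw [e, Complex.ofReal_mem_slitPlane] at h
  have : 0 < τ / (1 - τ) := div_pos h0 (sub_pos.2 h1)
  linarith

theorem not_offPath_tailRay {B u v : ℂ} (hB : B ≠ 0) (hv : v ≠ 0) {t : ℝ} (h0 : 0 < t) :
    ¬ OffPath B u v (tailRay B v t) := by
  rintro ⟨-, h⟩
  have e : -((tailRay B v t - B) / (v * B)) = ((-t : ℝ) : ℂ) := by
    rw [tailRay]
    push_cast
    field_simp
    ring
  rw [e, Complex.ofReal_mem_slitPlane] at h
  linarith

theorem exists_tailRay_eq {B v : ℂ} (hB : B ≠ 0) (hv : v ≠ 0) {t : ℝ} (h0 : 0 < t) :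
    ∃ t' : ℝ, 0 < t' ∧ ‖B‖ * cis (arg B) + t * cis (arg B + arg v) = tailRay B v t' := by
  have n1 : 0 < ‖B‖ := norm_pos_iff.2 hB
  have n2 : 0 < ‖v‖ := norm_pos_iff.2 hv
  have n1' : (‖B‖ : ℂ) ≠ 0 := by exact_mod_cast n1.ne'
  have n2' : (‖v‖ : ℂ) ≠ 0 := by exact_mod_cast n2.ne'
  refine ⟨t / (‖B‖ * ‖v‖), by positivity, ?_⟩
  rw [tailRay, cis_add]
  have e1 := eq_norm_mul_cis B
  have e2 := eq_norm_mul_cis v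
  generalize cis (arg B) = x at e1 ⊢
  generalize cis (arg v) = y at e2 ⊢
  generalize (‖B‖ : ℝ) = b at *
  generalize (‖v‖ : ℝ) = w at *
  subst e1 e2
  push_cast
  field_simp

/-- Inversion `z ↦ 1 / conj z` preserves arguments and straightens an arc from `0` into a ray to
`∞`. The parameter `τ` solves `(1 - τ) / τ = t * ‖B‖ * ‖u‖`. -/
theorem exists_leadArc_eq {B u : ℂ} (hB : B ≠ 0) (hu : u ∈ slitPlane) {t : ℝ} (h0 : 0 < t) :
    ∃ τ : ℝ, 0 < τ ∧ τ < 1 ∧ ((‖B‖⁻¹ : ℝ) * cis (arg B) + t * cis (arg B + arg u)) *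
      conj (leadArc B u τ) = 1 := by
  have hu0 := Complex.slitPlane_ne_zero hu
  have n1 : 0 < ‖B‖ := norm_pos_iff.2 hB
  have n2 : 0 < ‖u‖ := norm_pos_iff.2 hu0
  have n3 : 0 < 1 + t * ‖B‖ * ‖u‖ := by positivity
  have hτ0 : 0 < (1 + t * ‖B‖ * ‖u‖)⁻¹ := by positivity
  have hτ1 : (1 + t * ‖B‖ * ‖u‖)⁻¹ < 1 := inv_lt_one_of_one_lt₀ (by
    have : 0 < t * ‖B‖ * ‖u‖ := by positivity
    linarith)
  refine ⟨(1 + t * ‖B‖ * ‖u‖)⁻¹, hτ0, hτ1, ?_⟩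
  have hd := Complex.slitPlane_ne_zero (convex_mem_slitPlane hu hτ0.le hτ1.le)
  have hd' : 1 - ((1 + t * ‖B‖ * ‖u‖)⁻¹ : ℝ) + ((1 + t * ‖B‖ * ‖u‖)⁻¹ : ℝ) * conj u ≠ 0 := by
    have := (map_ne_zero (starRingEnd ℂ)).2 hd
    simpa only [map_add, map_sub, map_mul, map_one, Complex.conj_ofReal] using this
  rw [leadArc, map_div₀, map_add, map_sub, map_mul, map_mul, map_one, Complex.conj_ofReal,
    mul_div_assoc', div_eq_one_iff_eq hd', cis_add]
  have x1 := cis_mul_conj (arg B)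
  have x2 := cis_mul_conj (arg u)
  have e1 := congrArg conj (eq_norm_mul_cis B)
  have e2 := congrArg conj (eq_norm_mul_cis u)
  rw [map_mul, Complex.conj_ofReal] at e1 e2
  rw [e1, e2]
  have n1' : (‖B‖ : ℂ) ≠ 0 := by exact_mod_cast n1.ne'
  have hb := inv_mul_cancel₀ n1'
  have hT : ((1 + t * ‖B‖ * ‖u‖ : ℂ))⁻¹ * (1 + t * ‖B‖ * ‖u‖) = 1 :=
    inv_mul_cancel₀ (by exact_mod_cast n3.ne')
  push_cast
  generalize conj (cis (arg B)) = X' at *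
  generalize conj (cis (arg u)) = Y' at *
  generalize cis (arg B) = X at *
  generalize cis (arg u) = Y at *
  generalize (1 + t * ‖B‖ * ‖u‖ : ℂ)⁻¹ = T at *
  linear_combination (T * ‖u‖ * Y' * (1 + ‖B‖ * t * Y) : ℂ) * x1 + (T * ‖u‖ * ‖B‖ * t : ℂ) * x2 +
    (X * X' * T * ‖u‖ * Y') * hb + hT

/-! ### Systems of paths from `0` to `∞` -/

/-- The products `B j * w j` point in the `2k` directions that are multiples of `π / k` apart. -/
def EquallySpaced {ι : Type*} (k : ℕ) (B w : ι → ℂ) : Prop :=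
  ∃ (θ : ℝ) (σ : ι → ℤ), (∀ m : ℤ, ∃ j, (2 * k : ℤ) ∣ σ j - m) ∧
    (∀ i j, (2 * k : ℤ) ∣ σ i - σ j → i = j) ∧
    ∀ j, ∃ r : ℝ, 0 < r ∧ B j * w j = r * cis (θ + σ j * (Real.pi / k))

/-- A curve from `B j` to `B (p j)` that starts in the direction `B j * e` and avoids the paths. The
curve is composed of two pieces. -/
def HasConnection {ι : Type*} (p : ι → ι) (B u v : ι → ℂ) (j : ι) (e : ℂ) : Prop :=
  ∃ c c' : ℝ → ℂ, ContinuousOn c (Icc 0 1) ∧ ContinuousOn c' (Icc 0 1) ∧ c 0 = B j ∧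
    HasDerivWithinAt c (e * B j) (Icc 0 1) 0 ∧ c 1 = c' 0 ∧ c' 1 = B (p j) ∧
    (∀ t ∈ Ioc (0 : ℝ) 1, OffPath (B j) (u j) (v j) (c t)) ∧
    (∀ l, l ≠ j → ∀ t ∈ Icc (0 : ℝ) 1, OffPath (B l) (u l) (v l) (c t)) ∧
    ∀ l, l ≠ p j → ∀ t ∈ Icc (0 : ℝ) 1, OffPath (B l) (u l) (v l) (c' t)

/-- Disjoint paths from `0` to `∞` through the points `B j`, each consisting of an arc and a ray.
The directions at `0` and at `∞` are equally spaced, and so are the directions at each `B j`, where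
all directions other than those of the path belong to curves from `B j` to `B (p j)`. -/
structure IsPathSystem {ι : Type*} (p : ι → ι) (k : ℕ) (B u v : ι → ℂ) : Prop where
  base_ne : ∀ j, B j ≠ 0
  lead_mem : ∀ j, u j ∈ slitPlane
  tail_mem : ∀ j, v j ∈ slitPlane
  off_arc : ∀ i j, i ≠ j → ∀ τ : ℝ, 0 < τ → τ ≤ 1 →
    OffPath (B i) (u i) (v i) (leadArc (B j) (u j) τ)
  off_ray : ∀ i j, i ≠ j → ∀ t : ℝ, 0 ≤ t → OffPath (B i) (u i) (v i) (tailRay (B j) (v j) t)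
  simple : ∀ j, ∀ t x : ℝ, 0 < t → 0 < x → 1 + t * v j + x * (u j * v j) ≠ 0
  lead_spaced : EquallySpaced k B u
  tail_spaced : EquallySpaced k B v
  connection : ∀ j, ∃ X : ℤ, 0 < X ∧ X < 2 * k ∧
    (∃ r : ℝ, 0 < r ∧ -(u j)⁻¹ = r * (v j * cis (X * (Real.pi / k)))) ∧
    ∀ x : ℤ, 0 < x → x < 2 * k → x ≠ X → ∃ r : ℝ, 0 < r ∧
      HasConnection p B u v j (r * (v j * cis (x * (Real.pi / k))))

/-- The multiples of `2π` by which `arg (B j) + arg (w j)` misses the given angle are absorbed into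
the integers, which are only relevant modulo `2k`. -/
theorem EquallySpaced.exists_lift {ι : Type*} {k : ℕ} {B w : ι → ℂ} (hk : 0 < k)
    (h : EquallySpaced k B w) (hB : ∀ j, B j ≠ 0) (hw : ∀ j, w j ≠ 0) :
    ∃ (θ : ℝ) (a : ι → ℤ), (∀ m : ℤ, ∃ j, (2 * k : ℤ) ∣ a j - m) ∧
      (∀ i j, (2 * k : ℤ) ∣ a i - a j → i = j) ∧
      ∀ j, arg (B j) + arg (w j) = θ + a j * (Real.pi / k) := by
  obtain ⟨θ, σ, h1, h2, h3⟩ := h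
  have hkr : (k : ℝ) ≠ 0 := by exact_mod_cast hk.ne'
  have key : ∀ j, ∃ n : ℤ, arg (B j) + arg (w j) = θ + (σ j + 2 * k * n : ℤ) * (Real.pi / k) := by
    intro j
    obtain ⟨r, hr, he⟩ := h3 j
    obtain ⟨n, hn⟩ := exists_arg_add_arg_eq (hB j) (hw j) hr he
    refine ⟨n, ?_⟩
    rw [hn]
    push_cast
    field_simp
    ring
  choose n hn using key
  refine ⟨θ, fun j => σ j + 2 * k * n j, fun m => ?_, fun i j hij => h2 i j ?_, hn⟩
  · obtain ⟨j, hj⟩ := h1 m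
    refine ⟨j, ?_⟩
    rw [show σ j + 2 * k * n j - m = (σ j - m) + 2 * k * n j by ring]
    exact dvd_add hj (dvd_mul_right _ _)
  · have := dvd_sub hij (dvd_mul_right (2 * k : ℤ) (n i - n j))
    rwa [show σ i + 2 * k * n i - (σ j + 2 * k * n j) - 2 * k * (n i - n j) = σ i - σ j by ring]
      at this

namespace IsPathSystem

variable {ι : Type*} {p : ι → ι} {k : ℕ} {B u v : ι → ℂ}

theorem lead_ne (h : IsPathSystem p k B u v) (j : ι) : u j ≠ 0 :=
  Complex.slitPlane_ne_zero (h.lead_mem j)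

theorem tail_ne (h : IsPathSystem p k B u v) (j : ι) : v j ≠ 0 :=
  Complex.slitPlane_ne_zero (h.tail_mem j)

/-- The inverted arcs of two paths are disjoint. -/
theorem arcs_disjoint (h : IsPathSystem p k B u v) {i j : ι} (hij : i ≠ j) {t t' : ℝ} (ht : 0 < t)
    (ht' : 0 < t') :
    (‖B i‖⁻¹ : ℝ) * cis (arg (B i)) + t * cis (arg (B i) + arg (u i)) ≠
      (‖B j‖⁻¹ : ℝ) * cis (arg (B j)) + t' * cis (arg (B j) + arg (u j)) := by
  intro he
  obtain ⟨τ, h0, h1, e⟩ := exists_leadArc_eq (h.base_ne i) (h.lead_mem i) ht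
  obtain ⟨τ', h0', h1', e'⟩ := exists_leadArc_eq (h.base_ne j) (h.lead_mem j) ht'
  rw [he] at e
  have := (starRingEnd ℂ).injective (mul_left_cancel₀ (left_ne_zero_of_mul_eq_one e) (e.trans e'.symm))
  refine not_offPath_leadArc (v := v i) (h.base_ne i) (h.lead_mem i) h0 h1 ?_
  rw [this]
  exact h.off_arc i j hij τ' h0' h1'.le

theorem rays_disjoint (h : IsPathSystem p k B u v) {i j : ι} (hij : i ≠ j) {t t' : ℝ} (ht : 0 < t)
    (ht' : 0 < t') :
    ‖B i‖ * cis (arg (B i)) + t * cis (arg (B i) + arg (v i)) ≠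
      ‖B j‖ * cis (arg (B j)) + t' * cis (arg (B j) + arg (v j)) := by
  intro he
  obtain ⟨s, h0, e⟩ := exists_tailRay_eq (h.base_ne i) (h.tail_ne i) ht
  obtain ⟨s', h0', e'⟩ := exists_tailRay_eq (h.base_ne j) (h.tail_ne j) ht'
  refine not_offPath_tailRay (u := u i) (h.base_ne i) (h.tail_ne i) h0 ?_
  rw [← e, he, e']
  exact h.off_ray i j hij s' h0'.le

/-- The equation `z * conj w = 1` says that `z` is the inverse of `w`; it lets the ray be used
directly and the arc in its inverted form. -/
theorem ray_arc_disjoint (h : IsPathSystem p k B u v) {i j : ι} (hij : i ≠ j) {t t' : ℝ}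
    (ht : 0 < t) (ht' : 0 < t') :
    (‖B i‖ * cis (arg (B i)) + t * cis (arg (B i) + arg (v i))) *
      conj ((‖B j‖⁻¹ : ℝ) * cis (arg (B j)) + t' * cis (arg (B j) + arg (u j))) ≠ 1 := by
  intro he
  obtain ⟨s, h0, e⟩ := exists_tailRay_eq (h.base_ne i) (h.tail_ne i) ht
  obtain ⟨τ, h0', h1', e'⟩ := exists_leadArc_eq (h.base_ne j) (h.lead_mem j) ht'
  have e2 := congrArg conj e'
  rw [map_mul, Complex.conj_conj, map_one, mul_comm] at e2
  have := mul_right_cancel₀ (right_ne_zero_of_mul_eq_one e2) (e2.trans he.symm)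
  refine not_offPath_tailRay (u := u i) (h.base_ne i) (h.tail_ne i) h0 ?_
  rw [← e, ← this]
  exact h.off_arc i j hij τ h0' h1'.le

theorem third_index {N : ℤ} (hN : 2 < N) {a : ι → ℤ} (ha : ∀ m : ℤ, ∃ j, N ∣ a j - m) (i j : ι) :
    ∃ l, l ≠ i ∧ l ≠ j := by
  have key : ∀ l, ∃ m : ℤ, 0 ≤ m ∧ m < N ∧ N ∣ a l - m := fun l =>
    ⟨a l % N, Int.emod_nonneg _ (by omega), Int.emod_lt_of_pos _ (by omega), Int.dvd_self_sub_emod⟩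
  obtain ⟨x, hx0, hxN, hx⟩ := key i
  obtain ⟨y, hy0, hyN, hy⟩ := key j
  obtain ⟨z, hz0, hz3, hzx, hzy⟩ : ∃ z : ℤ, 0 ≤ z ∧ z < 3 ∧ z ≠ x ∧ z ≠ y := by
    by_cases h0 : (0 : ℤ) ≠ x ∧ (0 : ℤ) ≠ y
    · exact ⟨0, le_rfl, by norm_num, h0⟩
    by_cases h1 : (1 : ℤ) ≠ x ∧ (1 : ℤ) ≠ y
    · exact ⟨1, by norm_num, by norm_num, h1⟩
    exact ⟨2, by norm_num, by norm_num, by omega, by omega⟩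
  have huniq : ∀ w m : ℤ, 0 ≤ m → m < N → N ∣ w - m → N ∣ w - z → z = m := by
    intro w m h0 h1 h2 h3
    have h4 : N ∣ z - m := by simpa using dvd_sub h2 h3
    have := Int.eq_zero_of_abs_lt_dvd h4 (abs_lt.2 ⟨by omega, by omega⟩)
    omega
  obtain ⟨l, hl⟩ := ha z
  refine ⟨l, ?_, ?_⟩
  · rintro rfl
    exact hzx (huniq _ _ hx0 hxN hx hl)
  · rintro rfl
    exact hzy (huniq _ _ hy0 hyN hy hl)

/-- At `B` the arc leaves towards `0` in direction `-B * u⁻¹`, so `ω` is the counterclockwise angle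
from the ray to the arc, and `u * v` encodes the turn `π - ω`. -/
theorem mul_mem_slitPlane_of_turn {u v : ℂ} {r ω : ℝ} (hu : u ≠ 0) (hv : v ≠ 0) (hr : 0 < r)
    (h0 : 0 < ω) (h1 : ω < 2 * Real.pi) (h : -u⁻¹ = r * (v * cis ω)) :
    u * v = (r⁻¹ : ℝ) * cis (Real.pi - ω) ∧ arg (u * v) = Real.pi - ω ∧ u * v ∈ slitPlane := by
  have huv : u * v = (r⁻¹ : ℝ) * cis (Real.pi - ω) := by
    have e1 : cis (Real.pi - ω) * cis ω = -1 := by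
      rw [← cis_add, sub_add_cancel]; exact Complex.exp_pi_mul_I
    have e2 : u * (r * (v * cis ω)) = -1 := by
      rw [← h]; field_simp
    have hrc : (r : ℂ) ≠ 0 := by exact_mod_cast hr.ne'
    refine mul_right_cancel₀ (mul_ne_zero hrc (cis_ne_zero ω)) ?_
    generalize cis (Real.pi - ω) = E at *
    push_cast
    field_simp
    linear_combination e2 - e1
  have harg : arg (u * v) = Real.pi - ω := by
    rw [huv, cis, Complex.exp_mul_I]
    exact Complex.arg_mul_cos_add_sin_mul_I (inv_pos.2 hr) ⟨by linarith, by linarith⟩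
  refine ⟨huv, harg, Complex.mem_slitPlane_iff_arg.2 ⟨?_, mul_ne_zero hu hv⟩⟩
  rw [harg]
  intro he
  linarith

theorem neg_div_mem_slitPlane {v : ℂ} {s τ : ℝ} (hv : v ≠ 0) (hs : 0 < s) (h0 : 0 < τ)
    (h1 : τ < 2 * Real.pi) : -((s * (v * cis τ)) / v) ∈ slitPlane := by
  have e1 : -((s * (v * cis τ)) / v) = s * (Complex.cos ((τ - Real.pi : ℝ)) +
      Complex.sin ((τ - Real.pi : ℝ)) * Complex.I) := by
    rw [← Complex.exp_mul_I, cis, Complex.ofReal_sub, sub_mul, Complex.exp_sub,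
      Complex.exp_pi_mul_I]
    field_simp
  have hsc : (s : ℂ) ≠ 0 := by exact_mod_cast hs.ne'
  refine Complex.mem_slitPlane_iff_arg.2 ⟨?_, neg_ne_zero.2
    (div_ne_zero (mul_ne_zero hsc (mul_ne_zero hv (cis_ne_zero _))) hv)⟩
  rw [e1, Complex.arg_mul_cos_add_sin_mul_I hs ⟨by linarith, by linarith⟩]
  intro he
  linarith

/-- Membership fails only for a direction along the arc, that is, for `τ = ω` modulo `2π`. -/
theorem inv_mul_mem_slitPlane {u v : ℂ} {r s τ ω : ℝ} (hr : 0 < r) (hs : 0 < s)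
    (huv : u * v = (r⁻¹ : ℝ) * cis (Real.pi - ω)) (h1 : |ω - τ| < 2 * Real.pi) (hne : ω ≠ τ) :
    (u * (s * (v * cis τ)))⁻¹ ∈ slitPlane := by
  refine inv_mem_slitPlane ?_
  have e1 : u * (s * (v * cis τ)) = (s * r⁻¹ : ℝ) * cis (Real.pi - (ω - τ)) := by
    rw [show Real.pi - (ω - τ) = Real.pi - ω + τ by ring, cis_add]
    push_cast at huv ⊢
    linear_combination (s * cis τ) * huv
  have hpos : 0 < s * r⁻¹ := mul_pos hs (inv_pos.2 hr)
  rw [e1, Complex.mem_slitPlane_iff, Complex.re_ofReal_mul, Complex.im_ofReal_mul, cis_re, cis_im,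
    Real.sin_pi_sub, Real.cos_pi_sub]
  by_contra hcon
  push Not at hcon
  have hs0 : Real.sin (ω - τ) = 0 := (mul_eq_zero.1 hcon.2).resolve_left hpos.ne'
  have hs1 : -Real.cos (ω - τ) ≤ 0 := by
    by_contra hc
    exact absurd hcon.1 (not_le.2 (mul_pos hpos (not_le.1 hc)))
  have hc1 : Real.cos (ω - τ) = 1 := by
    nlinarith [Real.sin_sq_add_cos_sq (ω - τ)]
  rw [abs_lt] at h1
  have := (Real.cos_eq_one_iff_of_lt_of_lt h1.1 h1.2).1 hc1
  exact hne (by linarith)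

/-- The winding of the other paths determines the side on which a connection leaves its path. -/
theorem sideArg_eq (h : IsPathSystem p k B u v) {n : ι → ι → ℤ}
    (hn : ∀ i j, i ≠ j → cutArg (B i) (u i) (v i) (B j) = arg (B j) + n i j * (2 * Real.pi))
    {j : ι} (hp : p j ≠ j) {e : ℂ} (he : e ≠ 0) (h1 : (u j * e)⁻¹ ∈ slitPlane)
    (h2 : -(e / v j) ∈ slitPlane) (hc : HasConnection p B u v j e) {l : ι} (hlj : l ≠ j)
    (hlp : l ≠ p j) :
    sideArg (u j) (v j) e = ((n l j - n l (p j) + n j (p j) : ℤ) : ℝ) * (2 * Real.pi) := by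
  obtain ⟨c, c', hc, hc', c0, cd, c1, c1', o1, o2, o3⟩ := hc
  -- The difference of the branches cut along `l` and along `j` is constant on both halves of the
  -- connection. Equating its values at the two ends expresses the side by winding numbers.
  have d1 := cutArg_sub_cutArg_of_start (h.base_ne j) (h.lead_ne j) he h1 h2 c0 cd hc o1 (o2 l hlj)
  have d2 := cutArg_sub_cutArg_const isPreconnected_Icc hc' (o3 j hp.symm) (o3 l hlp)
    (x := 0) (y := 1) (by simp) (by simp)
  rw [← c1, d1, c1', hn l j hlj, hn l (p j) hlp, hn j (p j) hp.symm] at d2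
  push_cast
  linarith

/-- The lift inequalities divided by `π / k`. That one `n` serves both `a` and `c` is what ties the
order at `∞` to the order at `0`. -/
theorem exists_winding (h : IsPathSystem p k B u v) (hk : 0 < k) {θ φ : ℝ} {a c : ι → ℤ}
    (ha : ∀ j, arg (B j) + arg (u j) = θ + a j * (Real.pi / k))
    (hc : ∀ j, arg (B j) + arg (v j) = φ + c j * (Real.pi / k)) {i j : ι} (hij : i ≠ j) :
    ∃ n : ℤ, cutArg (B i) (u i) (v i) (B j) = arg (B j) + n * (2 * Real.pi) ∧
      (a i ≤ a j + 2 * k * n ∧ a j + 2 * k * n ≤ a i + 2 * k) ∧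
      (c i ≤ c j + 2 * k * n ∧ c j + 2 * k * n ≤ c i + 2 * k) := by
  have hk0 : (0 : ℝ) < k := by exact_mod_cast hk
  have hβ : 0 < Real.pi / k := div_pos Real.pi_pos hk0
  have hN : 2 * Real.pi = (2 * k : ℤ) * (Real.pi / k) := by push_cast; field_simp
  have hle : ∀ x y : ℤ, (x : ℝ) * (Real.pi / k) ≤ y * (Real.pi / k) → x ≤ y := fun x y hxy => by
    exact_mod_cast le_of_mul_le_mul_right hxy hβ
  obtain ⟨n, h1, h2, h3, h4, h5⟩ := exists_lift_between (h.lead_mem i) (h.tail_mem i) (h.base_ne j)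
    (h.lead_mem j) (h.tail_mem j) (h.off_arc i j hij) (h.off_ray i j hij)
  rw [ha, ha, hN] at h2 h3
  rw [hc, hc, hN] at h4 h5
  refine ⟨n, h1, ⟨hle _ _ ?_, hle _ _ ?_⟩, hle _ _ ?_, hle _ _ ?_⟩
  · push_cast at h2 ⊢; linarith
  · push_cast at h3 ⊢; linarith
  · push_cast at h4 ⊢; linarith
  · push_cast at h5 ⊢; linarith

/-- A path turns left at `B j` if the next path is its partner, and right otherwise. -/
theorem turn_eq (h : IsPathSystem p k B u v) (hk : 2 < k) {a : ι → ℤ}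
    (asurj : ∀ m : ℤ, ∃ j, (2 * k : ℤ) ∣ a j - m) (ainj : ∀ i j, (2 * k : ℤ) ∣ a i - a j → i = j)
    {n : ι → ι → ℤ}
    (hn : ∀ i j, i ≠ j → cutArg (B i) (u i) (v i) (B j) = arg (B j) + n i j * (2 * Real.pi))
    (hna : ∀ i j, i ≠ j → a i ≤ a j + 2 * k * n i j ∧ a j + 2 * k * n i j ≤ a i + 2 * k)
    {j : ι} (hp : p j ≠ j) :
    ((2 * k : ℤ) ∣ a (p j) - a j - 1 ∧ arg (u j) + arg (v j) = Real.pi / k - Real.pi) ∨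
      ((2 * k : ℤ) ∣ a (p j) - a j + 1 ∧ arg (u j) + arg (v j) = Real.pi - Real.pi / k) := by
  have hk0 : (0 : ℝ) < k := by exact_mod_cast (by omega : 0 < k)
  have hβ : 0 < Real.pi / k := div_pos Real.pi_pos hk0
  have hN : 2 * Real.pi = (2 * k : ℤ) * (Real.pi / k) := by push_cast; field_simp
  obtain ⟨X, hX0, hXN, ⟨r, hr, hXe⟩, hconn⟩ := h.connection j
  have hv0 := h.tail_ne j
  have hbound : ∀ x : ℤ, 0 < x → x < 2 * k →
      0 < x * (Real.pi / k) ∧ x * (Real.pi / k) < 2 * Real.pi := fun x h0 h1 =>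
    ⟨mul_pos (by exact_mod_cast h0) hβ, by
      rw [hN]; exact mul_lt_mul_of_pos_right (by exact_mod_cast h1) hβ⟩
  obtain ⟨hXpos, hXlt⟩ := hbound X hX0 hXN
  obtain ⟨huv, harg, huvmem⟩ := mul_mem_slitPlane_of_turn (h.lead_ne j) hv0 hr hXpos hXlt hXe
  have hturn := abs_lt.1 (abs_arg_add_arg_lt (h.lead_mem j) (h.tail_mem j) huvmem (h.simple j))
  have hsum : arg (u j) + arg (v j) = Real.pi - X * (Real.pi / k) := by
    rw [← harg, Complex.arg_mul (h.lead_ne j) hv0 ⟨hturn.1, hturn.2.le⟩]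
  -- A red edge in direction `x` has index below `X` if it leaves on the counterclockwise side of
  -- the path, and above `X` otherwise; its side is determined by the position of the partner.
  have hside : ∀ x : ℤ, 0 < x → x < 2 * k → x ≠ X →
      ((2 * k : ℤ) ∣ a (p j) - a j - 1 ∧ x < X) ∨ ((2 * k : ℤ) ∣ a (p j) - a j + 1 ∧ X < x) := by
    intro x hx0 hxN hxX
    obtain ⟨s, hs, hc⟩ := hconn x hx0 hxN hxX
    obtain ⟨hxpos, hxlt⟩ := hbound x hx0 hxN
    have hsc : (s : ℂ) ≠ 0 := by exact_mod_cast hs.ne'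
    have he0 : (s * (v j * cis (x * (Real.pi / k)))) ≠ 0 :=
      mul_ne_zero hsc (mul_ne_zero hv0 (cis_ne_zero _))
    have m2 := neg_div_mem_slitPlane hv0 hs hxpos hxlt
    have m1 := inv_mul_mem_slitPlane (τ := x * (Real.pi / k)) hr hs huv
      (abs_lt.2 ⟨by linarith, by linarith⟩) (fun e => hxX (by
        exact_mod_cast (mul_right_cancel₀ hβ.ne' e).symm))
    have hM := fun l => h.sideArg_eq hn hp he0 m1 m2 hc (l := l)
    obtain ⟨l₀, hl₀, hl₀'⟩ := third_index (by omega) asurj j (p j)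
    have hlt := sideArg_lt (e := s * (v j * cis (x * (Real.pi / k)))) hs hv0 hxpos hxlt rfl m1
    rw [hM l₀ hl₀ hl₀', hsum, sub_sub_cancel] at hlt
    rcases neighbours_of_not_separated (N := 2 * k) (by omega) asurj ainj hna hp.symm
      (M := n l₀ j - n l₀ (p j) + n j (p j)) (fun l hl hl' => by
        have := (hM l₀ hl₀ hl₀').symm.trans (hM l hl hl')
        exact_mod_cast mul_right_cancel₀ Real.two_pi_pos.ne' this) with ⟨hd1, hM0⟩ | ⟨hd1, hM1⟩
    · refine Or.inl ⟨hd1, ?_⟩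
      have := hlt.1 (by rw [hM0]; simp)
      exact_mod_cast lt_of_mul_lt_mul_right this hβ.le
    · refine Or.inr ⟨hd1, ?_⟩
      have := hlt.2 (by rw [hM1]; simp)
      exact_mod_cast lt_of_mul_lt_mul_right this hβ.le
  have hexcl : (2 * k : ℤ) ∣ a (p j) - a j - 1 → ¬ (2 * k : ℤ) ∣ a (p j) - a j + 1 := by
    intro h1 h2
    have := Int.le_of_dvd two_pos (by simpa using dvd_sub h2 h1)
    omega
  -- All red directions are on the same side of `X`, so `X` is extreme among `1, …, 2k - 1`.
  -- Followed from `∞` to `0`, the path turns left for `X = 2k - 1` and right for `X = 1`.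
  have hkey : ((2 * k : ℤ) ∣ a (p j) - a j - 1 ∧ X = 2 * k - 1) ∨
      ((2 * k : ℤ) ∣ a (p j) - a j + 1 ∧ X = 1) := by
    by_cases hX1 : X = 1
    · refine Or.inr ⟨?_, hX1⟩
      rcases hside 2 two_pos (by omega) (by omega) with hs | hs
      · omega
      · exact hs.1
    · left
      rcases hside 1 one_pos (by omega) (Ne.symm hX1) with hs | hs
      · refine ⟨hs.1, ?_⟩
        by_contra hne
        rcases hside (2 * k - 1) (by omega) (by omega) (Ne.symm hne) with hs' | hs'
        · omega
        · exact hexcl hs.1 hs'.1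
      · omega
  rw [hsum]
  rcases hkey with ⟨h1, h2⟩ | ⟨h1, h2⟩
  · refine Or.inl ⟨h1, ?_⟩
    rw [h2]
    push_cast
    field_simp
    ring
  · refine Or.inr ⟨h1, ?_⟩
    rw [h2]
    push_cast
    ring

/-- The directions at `0` are numbered by `a`, all paths have the same total turn `2 μ`, and the
partner of a path is one of its two neighbours. -/
theorem exists_positions [Finite ι] [Nonempty ι] (h : IsPathSystem p k B u v) (hk : 2 < k)
    (hp : ∀ j, p j ≠ j) :
    ∃ (θ μ : ℝ) (a : ι → ℤ), (∀ m : ℤ, ∃ j, (2 * k : ℤ) ∣ a j - m) ∧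
      (∀ i j, (2 * k : ℤ) ∣ a i - a j → i = j) ∧
      (∀ j, arg (B j) + arg (u j) = θ + a j * (Real.pi / k)) ∧
      (∀ j, arg (v j) - arg (u j) = 2 * μ) ∧
      ∀ j, ((2 * k : ℤ) ∣ a (p j) - a j - 1 ∧ arg (u j) + arg (v j) = Real.pi / k - Real.pi) ∨
        ((2 * k : ℤ) ∣ a (p j) - a j + 1 ∧ arg (u j) + arg (v j) = Real.pi - Real.pi / k) := by
  obtain ⟨θ, a, asurj, ainj, ha⟩ := h.lead_spaced.exists_lift (by omega) h.base_ne h.lead_ne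
  obtain ⟨φ, c, -, cinj, hc⟩ := h.tail_spaced.exists_lift (by omega) h.base_ne h.tail_ne
  have key : ∀ i j, ∃ n : ℤ, i ≠ j →
      cutArg (B i) (u i) (v i) (B j) = arg (B j) + n * (2 * Real.pi) ∧
      (a i ≤ a j + 2 * k * n ∧ a j + 2 * k * n ≤ a i + 2 * k) ∧
      (c i ≤ c j + 2 * k * n ∧ c j + 2 * k * n ≤ c i + 2 * k) := by
    intro i j
    by_cases hij : i = j
    · exact ⟨0, fun hne => absurd hij hne⟩
    obtain ⟨n, hn⟩ := h.exists_winding (by omega) ha hc hij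
    exact ⟨n, fun _ => hn⟩
  choose n hn using key
  obtain ⟨d, hd⟩ := exists_rotation (N := 2 * k) (by omega) asurj ainj cinj
    (fun i j hij => ⟨n i j, (hn i j hij).2.1.1, (hn i j hij).2.1.2, (hn i j hij).2.2.1,
      (hn i j hij).2.2.2⟩)
  refine ⟨θ, (φ + d * (Real.pi / k) - θ) / 2, a, asurj, ainj, ha, fun j => ?_, fun j =>
    h.turn_eq hk asurj ainj (fun i j hij => (hn i j hij).1) (fun i j hij => (hn i j hij).2.1) (hp j)⟩
  have h1 := ha j
  have h2 := hc j
  rw [hd j] at h2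
  push_cast at h2
  linarith

/-- The radii of three consecutive paths, turning left, right and left. -/
theorem norm_lt_of_consecutive (h : IsPathSystem p k B u v) {β η μ Θ : ℝ} (hβ : 0 < β)
    (hβ' : β ≤ Real.pi / 9) (hη : η = (Real.pi - β) / 2) {j₀ j₁ j₂ : ι} (h01 : j₀ ≠ j₁)
    (h12 : j₁ ≠ j₂) (hl : -Real.pi < -μ - η) (hr : -Real.pi < μ - η)
    (hb₀ : cis (arg (B j₀)) = cis (Θ + μ + η))
    (hu₀ : cis (arg (B j₀) + arg (u j₀)) = cis Θ)
    (hv₀ : cis (arg (B j₀) + arg (v j₀)) = cis (Θ + 2 * μ))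
    (hb₁ : cis (arg (B j₁)) = cis (Θ + β + μ - η))
    (hu₁ : cis (arg (B j₁) + arg (u j₁)) = cis (Θ + β))
    (hv₁ : cis (arg (B j₁) + arg (v j₁)) = cis (Θ + β + 2 * μ))
    (hb₂ : cis (arg (B j₂)) = cis (Θ + β + β + μ + η))
    (hu₂ : cis (arg (B j₂) + arg (u j₂)) = cis (Θ + β + β))
    (hv₂ : cis (arg (B j₂) + arg (v j₂)) = cis (Θ + β + β + 2 * μ)) :
    (0 ≤ μ → ‖B j₂‖ < ‖B j₀‖) ∧ (μ < 0 → ‖B j₂‖⁻¹ < ‖B j₀‖⁻¹) := by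
  have n₀ : 0 < ‖B j₀‖ := norm_pos_iff.2 (h.base_ne j₀)
  have n₁ : 0 < ‖B j₁‖ := norm_pos_iff.2 (h.base_ne j₁)
  have n₂ : 0 < ‖B j₂‖ := norm_pos_iff.2 (h.base_ne j₂)
  constructor <;> intro hμ
  · refine radius_lt (θ := Θ) hβ hβ' hη hμ (by linarith) n₀ n₁ n₂ (fun t t' ht ht' => ?_)
      (fun t t' ht ht' => ?_)
    · have := h.arcs_disjoint h01 ht ht'
      rwa [hb₀, hu₀, hb₁, hu₁] at this
    · have := h.ray_arc_disjoint h12 ht ht'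
      rwa [hb₁, hv₁, hb₂, hu₂] at this
  -- Inversion exchanges the roles of arcs and rays: the directions at `∞` become those at `0`, the
  -- radii become their inverses, and `μ` changes sign.
  · refine radius_lt (θ := Θ + 2 * μ) (μ := -μ) hβ hβ' hη (by linarith) (by linarith)
      (inv_pos.2 n₀) (inv_pos.2 n₁) (inv_pos.2 n₂) (fun t t' ht ht' => ?_) (fun t t' ht ht' he => ?_)
    · have := h.rays_disjoint h01 ht ht'
      rw [hb₀, hv₀, hb₁, hv₁] at this
      rwa [inv_inv, inv_inv, show Θ + 2 * μ + -μ + η = Θ + μ + η by ring,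
        show Θ + 2 * μ + β + -μ - η = Θ + β + μ - η by ring,
        show Θ + 2 * μ + β = Θ + β + 2 * μ by ring]
    · refine h.ray_arc_disjoint h12.symm ht' ht ?_
      rw [hb₂, hv₂, hb₁, hu₁]
      have he' := congrArg conj he
      rw [map_mul, Complex.conj_conj, map_one, inv_inv,
        show Θ + 2 * μ + β + -μ - η = Θ + β + μ - η by ring,
        show Θ + 2 * μ + β + 2 * -μ = Θ + β by ring,
        show Θ + 2 * μ + β + β + -μ + η = Θ + β + β + μ + η by ring,
        show Θ + 2 * μ + β + β = Θ + β + β + 2 * μ by ring] at he'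
      rw [mul_comm]
      exact he'

theorem false_of_eight_lt [Finite ι] [Nonempty ι] (h : IsPathSystem p k B u v) (hk : 8 < k)
    (hp : ∀ j, p j ≠ j) (hpp : ∀ j, p (p j) = j) : False := by
  obtain ⟨θ, μ, a, asurj, ainj, ha, hμ, hturn⟩ := h.exists_positions (by omega) hp
  have hk9 : (9 : ℝ) ≤ k := by exact_mod_cast hk
  have hk0 : (0 : ℝ) < k := by linarith
  have hβ : 0 < Real.pi / k := div_pos Real.pi_pos hk0
  have hβ' : Real.pi / k ≤ Real.pi / 9 := div_le_div_of_nonneg_left Real.pi_pos.le (by norm_num) hk9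
  have hN : 2 * Real.pi = (2 * k : ℤ) * (Real.pi / k) := by push_cast; field_simp
  generalize Real.pi / k = β at *
  obtain ⟨η, hη⟩ : ∃ η, η = (Real.pi - β) / 2 := ⟨_, rfl⟩
  have hnot : ∀ m : ℤ, 0 < m → m ≤ 2 → ¬ (2 * k : ℤ) ∣ m := by
    intro m h0 h2 hd
    have := Int.le_of_dvd h0 hd
    omega
  have hcis : ∀ i j, (2 * k : ℤ) ∣ a j - a i - 1 → ∀ y : ℝ,
      cis (θ + a j * β + y) = cis (θ + a i * β + β + y) := by
    rintro i j ⟨m, hm⟩ y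
    rw [← cis_add_int_mul_two_pi (θ + a i * β + β + y) m, hN]
    have : (a j : ℝ) = a i + 1 + 2 * k * m := by
      have : a j = a i + 1 + 2 * k * m := by linarith
      exact_mod_cast this
    rw [this]
    push_cast
    ring_nf
  have hQ : ∀ j, (2 * k : ℤ) ∣ a (p j) - a j - 1 → arg (u j) = -μ - η ∧ arg (v j) = μ - η := by
    intro j hj
    rcases hturn j with ⟨-, hs⟩ | ⟨hd, -⟩
    · have := hμ j
      constructor <;> linarith
    · exact absurd (by simpa using dvd_sub hd hj) (hnot 2 two_pos le_rfl)
  have hP : ∀ j, (2 * k : ℤ) ∣ a (p j) - a j + 1 → arg (u j) = η - μ ∧ arg (v j) = η + μ := by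
    intro j hj
    rcases hturn j with ⟨hd, -⟩ | ⟨-, hs⟩
    · exact absurd (by simpa using dvd_sub hj hd) (hnot 2 two_pos le_rfl)
    · have := hμ j
      constructor <;> linarith
  have hstep : ∀ j, (2 * k : ℤ) ∣ a (p j) - a j - 1 → ∃ j', (2 * k : ℤ) ∣ a (p j') - a j' - 1 ∧
      ((0 ≤ μ → ‖B j'‖ < ‖B j‖) ∧ (μ < 0 → ‖B j'‖⁻¹ < ‖B j‖⁻¹)) := by
    intro j hj
    have hPj : (2 * k : ℤ) ∣ a (p (p j)) - a (p j) + 1 := by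
      rw [hpp, ← dvd_neg, show -(a j - a (p j) + 1) = a (p j) - a j - 1 by ring]
      exact hj
    obtain ⟨j', hj'⟩ := asurj (a (p j) + 1)
    rw [show a j' - (a (p j) + 1) = a j' - a (p j) - 1 by ring] at hj'
    have hne2 : p j ≠ j' := by
      intro e
      rw [← e] at hj'
      simp only [sub_self, zero_sub, dvd_neg] at hj'
      exact hnot 1 one_pos one_le_two hj'
    -- Were the partner of `j'` the previous path, it would be `p j`, so `j' = j`, and `j` would be
    -- both predecessor and successor of `p j`.
    have hQj' : (2 * k : ℤ) ∣ a (p j') - a j' - 1 := by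
      rcases hturn j' with ⟨hd, -⟩ | ⟨hd, -⟩
      · exact hd
      · exfalso
        have hd2 : (2 * k : ℤ) ∣ a (p j') - a (p j) := by
          have := dvd_add hd hj'
          rwa [show a (p j') - a j' + 1 + (a j' - a (p j) - 1) = a (p j') - a (p j) by ring] at this
        have e : j' = j := by rw [← hpp j', ainj _ _ hd2, hpp]
        rw [e] at hj'
        have := dvd_add hj hj'
        rw [show a (p j) - a j - 1 + (a j - a (p j) - 1) = -2 by ring, dvd_neg] at this
        exact hnot 2 two_pos le_rfl this
    obtain ⟨q1, q2⟩ := hQ j hj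
    obtain ⟨q3, q4⟩ := hP (p j) hPj
    obtain ⟨q5, q6⟩ := hQ j' hQj'
    have a0 := ha j
    have a1 := ha (p j)
    have a2 := ha j'
    have s1 := hcis j (p j) hj
    have s2 : ∀ y, cis (θ + a j' * β + y) = cis (θ + a j * β + β + β + y) := by
      intro y
      rw [hcis (p j) j' hj', add_assoc _ β y, s1]
      congr 1; ring
    refine ⟨j', hQj', h.norm_lt_of_consecutive (Θ := θ + a j * β) hβ hβ' hη (hp j).symm hne2
      (by rw [← q1]; exact Complex.neg_pi_lt_arg _) (by rw [← q2]; exact Complex.neg_pi_lt_arg _)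
      ?_ ?_ ?_ ?_ ?_ ?_ ?_ ?_ ?_⟩
    · congr 1; linarith
    · congr 1
    · congr 1; linarith
    · rw [show arg (B (p j)) = θ + a (p j) * β + (μ - η) by linarith, s1]
      congr 1; ring
    · rw [a1, ← add_zero (θ + a (p j) * β), s1, add_zero]
    · rw [show arg (B (p j)) + arg (v (p j)) = θ + a (p j) * β + 2 * μ by linarith, s1]
    · rw [show arg (B j') = θ + a j' * β + (μ + η) by linarith, s2]
      congr 1; ring
    · rw [a2, ← add_zero (θ + a j' * β), s2, add_zero]
    · rw [show arg (B j') + arg (v j') = θ + a j' * β + 2 * μ by linarith, s2]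
  -- The paths whose partner comes next. By `hstep` no element of this finite set can have the
  -- smallest radius, or the smallest inverse radius if `μ < 0`.
  let Q : Set ι := {j | (2 * k : ℤ) ∣ a (p j) - a j - 1}
  have hQne : Q.Nonempty := by
    obtain ⟨j⟩ := ‹Nonempty ι›
    rcases hturn j with ⟨hd, -⟩ | ⟨hd, -⟩
    · exact ⟨j, hd⟩
    · refine ⟨p j, ?_⟩
      rw [Set.mem_ofPred_eq, hpp, ← dvd_neg, show -(a j - a (p j) - 1) = a (p j) - a j + 1 by ring]
      exact hd
  rcases le_or_gt 0 μ with hμ0 | hμ0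
  · obtain ⟨j, hj, hmin⟩ := Set.exists_min_image Q (fun j => ‖B j‖) Q.toFinite hQne
    obtain ⟨j', hj', hlt, -⟩ := hstep j hj
    exact absurd (hlt hμ0) (not_lt.2 (hmin j' hj'))
  · obtain ⟨j, hj, hmin⟩ := Set.exists_min_image Q (fun j => ‖B j‖⁻¹) Q.toFinite hQne
    obtain ⟨j', hj', -, hlt⟩ := hstep j hj
    exact absurd (hlt hμ0) (not_lt.2 (hmin j' hj'))

end IsPathSystem

/-! ### Sending two points to `0` and `∞` -/

/-- The Möbius transformation that sends `y` to `0` and `y'` to `∞`. -/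
noncomputable def toZeroInfty (y y' z : ℂ) : ℂ := (z - y) / (y' - z)

section Moebius

variable {y y' b z u v : ℂ}

theorem one_add_toZeroInfty (hb : b ≠ y') : 1 + toZeroInfty y y' b = (y' - y) / (y' - b) := by
  have : y' - b ≠ 0 := sub_ne_zero.2 hb.symm
  rw [toZeroInfty]
  field_simp
  ring

/-- This identity produces the transformed shapes: the ratio describing an arc from `y` to `b` is
divided by `1 + toZeroInfty y y' b`, and an arc from `b` to `y'` becomes a ray. -/
theorem toZeroInfty_sub (hb : b ≠ y') (hz : z ≠ y') : toZeroInfty y y' b - toZeroInfty y y' z =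
    (1 + toZeroInfty y y' b) * ((b - z) / (y' - z)) := by
  have h1 : y' - b ≠ 0 := sub_ne_zero.2 hb.symm
  have h2 : y' - z ≠ 0 := sub_ne_zero.2 hz.symm
  rw [toZeroInfty, toZeroInfty]
  field_simp
  ring

theorem toZeroInfty_ne_zero (hy : b ≠ y) (hy' : b ≠ y') : toZeroInfty y y' b ≠ 0 :=
  div_ne_zero (sub_ne_zero.2 hy) (sub_ne_zero.2 hy'.symm)

theorem one_add_toZeroInfty_ne_zero (hyy : y ≠ y') (hy' : b ≠ y') :
    1 + toZeroInfty y y' b ≠ 0 := by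
  rw [one_add_toZeroInfty hy']
  exact div_ne_zero (sub_ne_zero.2 hyy.symm) (sub_ne_zero.2 hy'.symm)

theorem mem_slitPlane_of_ne {z : ℂ} (h0 : z ≠ 0) (h : ∀ s : ℝ, 0 < s → z ≠ -s) :
    z ∈ slitPlane := by
  by_contra hz
  rw [Complex.mem_slitPlane_iff] at hz
  push Not at hz
  have hre : z.re ≠ 0 := fun he => h0 (Complex.ext he hz.2)
  refine h (-z.re) (neg_pos.2 (lt_of_le_of_ne hz.1 hre)) (Complex.ext ?_ ?_) <;> simp [hz.2]

theorem one_add_mul_ne_zero (hu : ‖u‖ = 1) (hu1 : u ≠ -1) {s : ℝ} (hs : 0 < s) :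
    (1 + s * u : ℂ) ≠ 0 := by
  intro hcon
  have hcon' : (s : ℂ) * u = -1 := by linear_combination hcon
  have hn := congrArg norm hcon'
  rw [norm_mul, hu, Complex.norm_real, Real.norm_of_nonneg hs.le] at hn
  simp at hn
  rw [hn] at hcon'
  exact hu1 (by simpa using hcon')

theorem offPath_toZeroInfty (hyy : y ≠ y') (hby : b ≠ y) (hby' : b ≠ y') (hzy : z ≠ y)
    (hzy' : z ≠ y') (hzb : z ≠ b) (hu : u ≠ 0) (hv : v ≠ 0)
    (h1 : ∀ s : ℝ, 0 < s → z - y ≠ s * u * (b - z))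
    (h2 : ∀ s : ℝ, 0 < s → z - b ≠ s * v * (y' - z)) :
    OffPath (toZeroInfty y y' b) (u / (1 + toZeroInfty y y' b))
      (v * (1 + toZeroInfty y y' b) / toZeroInfty y y' b) (toZeroInfty y y' z) := by
  have hB := toZeroInfty_ne_zero hby hby'
  have hB1 := one_add_toZeroInfty_ne_zero hyy hby'
  have hz' : y' - z ≠ 0 := sub_ne_zero.2 hzy'.symm
  have hbz : b - z ≠ 0 := sub_ne_zero.2 hzb.symm
  have hzb' : z - b ≠ 0 := sub_ne_zero.2 hzb
  have hzy0 : z - y ≠ 0 := sub_ne_zero.2 hzy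
  have e1 : toZeroInfty y y' z / (u / (1 + toZeroInfty y y' b) *
      (toZeroInfty y y' b - toZeroInfty y y' z)) = (z - y) / (u * (b - z)) := by
    rw [toZeroInfty_sub hby' hzy']
    nth_rewrite 1 [toZeroInfty]
    field_simp
  have e2 : (toZeroInfty y y' z - toZeroInfty y y' b) /
      (v * (1 + toZeroInfty y y' b) / toZeroInfty y y' b * toZeroInfty y y' b) =
      (z - b) / (v * (y' - z)) := by
    rw [← neg_sub (toZeroInfty y y' b), toZeroInfty_sub hby' hzy', div_mul_cancel₀ _ hB]
    field_simp
    ring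
  rw [OffPath, e1, e2]
  refine ⟨mem_slitPlane_of_ne (neg_ne_zero.2 (div_ne_zero hzy0 (mul_ne_zero hu hbz))) ?_,
    mem_slitPlane_of_ne (neg_ne_zero.2 (div_ne_zero hzb' (mul_ne_zero hv hz'))) ?_⟩
  · intro s hs he
    rw [neg_inj, div_eq_iff (mul_ne_zero hu hbz)] at he
    exact h1 s hs (by rw [he]; ring)
  · intro s hs he
    rw [neg_inj, div_eq_iff (mul_ne_zero hv hz')] at he
    exact h2 s hs (by rw [he]; ring)

theorem toZeroInfty_eq_leadArc (hyy : y ≠ y') (hby' : b ≠ y')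
    (hU : u / (1 + toZeroInfty y y' b) ∈ slitPlane) (hzy' : z ≠ y') {τ : ℝ} (h0 : 0 < τ)
    (h1 : τ < 1) (h : z - y = (τ / (1 - τ) : ℝ) * u * (b - z)) :
    toZeroInfty y y' z = leadArc (toZeroInfty y y' b) (u / (1 + toZeroInfty y y' b)) τ := by
  have hd := Complex.slitPlane_ne_zero (convex_mem_slitPlane hU h0.le h1.le)
  have hB1 := one_add_toZeroInfty_ne_zero hyy hby'
  have hτ : (1 - τ : ℂ) ≠ 0 := by exact_mod_cast (sub_pos.2 h1).ne'
  have hz' : y' - z ≠ 0 := sub_ne_zero.2 hzy'.symm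
  have e : toZeroInfty y y' z * (1 - τ) = τ * (u / (1 + toZeroInfty y y' b)) *
      (toZeroInfty y y' b - toZeroInfty y y' z) := by
    rw [toZeroInfty_sub hby' hzy']
    have e1 : toZeroInfty y y' z = ((τ / (1 - τ) : ℝ) * u * (b - z)) / (y' - z) := by
      rw [← h, toZeroInfty]
    rw [e1]
    push_cast
    field_simp
  rw [leadArc, eq_div_iff hd]
  linear_combination e

theorem toZeroInfty_eq_tailRay (hby : b ≠ y) (hby' : b ≠ y') (hzy' : z ≠ y') {t : ℝ}
    (h : z - b = t * v * (y' - z)) : toZeroInfty y y' z =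
      tailRay (toZeroInfty y y' b) (v * (1 + toZeroInfty y y' b) / toZeroInfty y y' b) t := by
  have hB := toZeroInfty_ne_zero hby hby'
  have hz' : y' - z ≠ 0 := sub_ne_zero.2 hzy'.symm
  have e := toZeroInfty_sub (y := y) hby' hzy'
  rw [← neg_sub z b, h, neg_div, mul_div_assoc, div_self hz'] at e
  rw [tailRay]
  have e2 : toZeroInfty y y' b * (t * (v * (1 + toZeroInfty y y' b) / toZeroInfty y y' b)) =
      t * (v * (1 + toZeroInfty y y' b)) := by
    field_simp
  linear_combination -e - e2

end Moebius

/-! ### The paths of a planar Lombardi drawing -/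

namespace Drawing

section

variable {V : Type*} {G : SimpleGraph V}

theorem IsPlane.curve_ne_pos {D : Drawing G} (hD : D.IsPlane) (d : G.Dart) {t : ℝ}
    (ht : t ∈ Ioo (0 : ℝ) 1) (v : V) : D.curve d t ≠ D.pos v := by
  intro he
  have ht' := Ioo_subset_Icc_self ht
  have hv : v ∈ s(d.fst, d.snd) := hD.2 d v t ht' he
  rcases Sym2.mem_iff.1 hv with rfl | rfl
  · rw [← D.curve_zero d] at he
    exact ht.1.ne' (D.curve_injOn d ht' (by simp) he)
  · rw [← D.curve_one d] at he
    exact ht.2.ne (D.curve_injOn d ht' (by simp) he)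

theorem IsPlane.curve_ne_curve {D : Drawing G} (hD : D.IsPlane) {d d' : G.Dart}
    (hne : d.edge ≠ d'.edge) {t t' : ℝ} (ht : t ∈ Ioo (0 : ℝ) 1) (ht' : t' ∈ Icc (0 : ℝ) 1) :
    D.curve d t ≠ D.curve d' t' := by
  intro he
  obtain ⟨v, -, -, hv⟩ := hD.1 d d' hne t (Ioo_subset_Icc_self ht) t' ht' he
  exact hD.curve_ne_pos d ht v hv

theorem IsPlane.curve_ne_pos_of_notMem {D : Drawing G} (hD : D.IsPlane) {d : G.Dart} {t : ℝ}
    (ht : t ∈ Icc (0 : ℝ) 1) {v : V} (hv : v ∉ d.edge) : D.curve d t ≠ D.pos v :=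
  fun he => hv (hD.2 d v t ht he)

theorem exists_hasDerivWithinAt_direction (D : Drawing G) (d : G.Dart)
    (harc : IsCircularArc (D.curve d)) :
    ∃ r : ℝ, 0 < r ∧ HasDerivWithinAt (D.curve d) (r * D.direction d) (Icc 0 1) 0 := by
  obtain ⟨u, hu, -, ⟨g, hg, hd⟩, -⟩ := harc.exists_unit
  rw [D.curve_zero, D.curve_one] at hd
  have hz : u * (D.pos d.snd - D.pos d.fst) ≠ 0 := by
    refine mul_ne_zero (fun h => by simp [h] at hu) (sub_ne_zero.2 fun h => ?_)
    exact d.adj.ne (D.pos_injective h).symm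
  have hn : 0 < ‖u * (D.pos d.snd - D.pos d.fst)‖ := norm_pos_iff.2 hz
  refine ⟨g * ‖u * (D.pos d.snd - D.pos d.fst)‖, by positivity, ?_⟩
  rw [D.direction_eq d hg rfl hd]
  convert hd using 1
  have hn' : (‖u * (D.pos d.snd - D.pos d.fst)‖ : ℂ) ≠ 0 := by exact_mod_cast hn.ne'
  rw [Complex.ofReal_mul, mul_assoc, mul_div_cancel₀ _ hn']

/-- In a Lombardi drawing, the edges at a vertex of degree `2k` can be numbered by integers that
represent all residues modulo `2k`. -/
theorem IsLombardi.exists_numbering {D : Drawing G} (hD : D.IsLombardi) {k : ℕ} (hk : 0 < k) {v : V}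
    (hv : Nat.card (G.neighborSet v) = 2 * k) :
    ∃ (a : ℝ) (σ : G.neighborSet v → ℤ), (∀ m : ℤ, ∃ w, (2 * k : ℤ) ∣ σ w - m) ∧
      (∀ w w', (2 * k : ℤ) ∣ σ w - σ w' → w = w') ∧
      ∀ w : G.neighborSet v, D.direction ⟨(v, (w : V)), w.2⟩ = cis (a + σ w * (Real.pi / k)) := by
  obtain ⟨a, σ, hσ⟩ := hD.2 v
  have hkr : (k : ℝ) ≠ 0 := by exact_mod_cast hk.ne'
  have hlt : ∀ w, ((σ w : ℕ) : ℤ) < 2 * k := fun w => by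
    have := (σ w).2
    omega
  refine ⟨a, fun w => ((σ w : ℕ) : ℤ), fun m => ?_, fun w w' h => ?_, fun w => ?_⟩
  · have h0 : 0 ≤ m % (2 * k) := Int.emod_nonneg _ (by omega)
    have h1 : m % (2 * k) < 2 * k := Int.emod_lt_of_pos _ (by omega)
    refine ⟨σ.symm ⟨(m % (2 * k)).toNat, by omega⟩, ?_⟩
    simp only [Equiv.apply_symm_apply, Int.toNat_of_nonneg h0]
    rw [← dvd_neg, neg_sub]
    exact Int.dvd_self_sub_emod
  · refine σ.injective (Fin.ext ?_)
    have h1 := hlt w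
    have h2 := hlt w'
    dsimp only at h
    have := Int.eq_zero_of_abs_lt_dvd h (abs_lt.2 ⟨by omega, by omega⟩)
    omega
  · have hv' : (Nat.card (G.neighborSet v) : ℝ) = 2 * k := by rw [hv]; push_cast; rfl
    rw [hσ w, hv', cis]
    congr 3
    push_cast
    field_simp

end

/-! ### Blue vertices, their edges, and the degrees in `B k`. -/

section

variable {k : ℕ}

/-- A blue vertex. -/
def blueAt (j : Fin k × Fin 2) : BVertex k := .blue j.1 j.2

/-- The other vertex of a pair of blue vertices. -/
def partner (j : Fin k × Fin 2) : Fin k × Fin 2 := (j.1, j.2 + 1)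

theorem partner_ne (j : Fin k × Fin 2) : partner j ≠ j := by
  rcases j with ⟨i, b⟩
  intro h
  have : b + 1 = b := congrArg Prod.snd h
  fin_cases b <;> simp at this

theorem partner_partner (j : Fin k × Fin 2) : partner (partner j) = j := by
  rcases j with ⟨i, b⟩
  simp only [partner, Prod.mk.injEq, true_and]
  fin_cases b <;> rfl

theorem blueAt_injective : Function.Injective (blueAt : Fin k × Fin 2 → BVertex k) := by
  rintro ⟨i, b⟩ ⟨j, c⟩ h
  simpa [blueAt] using h

theorem adj_yellow_blueAt (y : Fin 2) (j : Fin k × Fin 2) : (B k).Adj (.yellow y) (blueAt j) :=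
  Or.inl trivial

theorem adj_blueAt_red (j : Fin k × Fin 2) (r : Fin (2 * k - 2)) :
    (B k).Adj (blueAt j) (.red j.1 r) :=
  Or.inr rfl

/-- The dart from a yellow vertex to a blue one. -/
def yellowDart (y : Fin 2) (j : Fin k × Fin 2) : (B k).Dart :=
  ⟨(.yellow y, blueAt j), adj_yellow_blueAt y j⟩

/-- The dart from a blue vertex to a red one. -/
def redDart (j : Fin k × Fin 2) (r : Fin (2 * k - 2)) : (B k).Dart :=
  ⟨(blueAt j, .red j.1 r), adj_blueAt_red j r⟩

theorem yellowDart_edge (y : Fin 2) (j : Fin k × Fin 2) :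
    (yellowDart y j).edge = s(.yellow y, blueAt j) := rfl

theorem redDart_edge (j : Fin k × Fin 2) (r : Fin (2 * k - 2)) :
    (redDart j r).edge = s(blueAt j, .red j.1 r) := rfl

theorem yellowDart_edge_ne {y y' : Fin 2} {i j : Fin k × Fin 2} (h : y ≠ y' ∨ i ≠ j) :
    (yellowDart y i).edge ≠ (yellowDart y' j).edge := by
  rw [yellowDart_edge, yellowDart_edge]
  intro he
  rcases Sym2.eq_iff.1 he with ⟨h1, h2⟩ | ⟨h1, -⟩
  · rcases h with h | h
    · exact h (BVertex.yellow.inj h1)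
    · exact h (blueAt_injective h2)
  · simp [blueAt] at h1

theorem yellowDart_edge_ne_redDart (y : Fin 2) (i j : Fin k × Fin 2) (r : Fin (2 * k - 2)) :
    (yellowDart y i).edge ≠ (redDart j r).edge := by
  rw [yellowDart_edge, redDart_edge]
  intro he
  rcases Sym2.eq_iff.1 he with ⟨h1, -⟩ | ⟨h1, -⟩ <;> simp [blueAt] at h1

theorem card_neighborSet_yellow (y : Fin 2) :
    Nat.card ((B k).neighborSet (.yellow y)) = 2 * k := by
  have e : Fin k × Fin 2 ≃ (B k).neighborSet (.yellow y) :=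
    Equiv.ofBijective (fun j => ⟨blueAt j, adj_yellow_blueAt y j⟩) ⟨fun i j h =>
      blueAt_injective (congrArg Subtype.val h), by
      rintro ⟨_ | ⟨i, b⟩ | _, h⟩
      · rcases h with h | h <;> exact h.elim
      · exact ⟨(i, b), rfl⟩
      · rcases h with h | h <;> exact h.elim⟩
  rw [← Nat.card_congr e]
  simp [mul_comm]

theorem card_neighborSet_blue (hk : 0 < k) (j : Fin k × Fin 2) :
    Nat.card ((B k).neighborSet (blueAt j)) = 2 * k := by
  have e : Fin 2 ⊕ Fin (2 * k - 2) ≃ (B k).neighborSet (blueAt j) :=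
    Equiv.ofBijective (Sum.elim (fun y => ⟨.yellow y, (adj_yellow_blueAt y j).symm⟩)
      (fun r => ⟨.red j.1 r, adj_blueAt_red j r⟩)) ⟨by
      rintro (y | r) (y' | r') h <;> simpa using congrArg Subtype.val h, by
      rintro ⟨y | _ | ⟨i, r⟩, h⟩
      · exact ⟨Sum.inl y, rfl⟩
      · rcases h with h | h <;> exact h.elim
      · rcases h with h | h
        · exact h.elim
        · have : i = j.1 := h
          subst this
          exact ⟨Sum.inr r, rfl⟩⟩
  rw [← Nat.card_congr e]
  simp
  omega

end

end Drawing

/-! ### Directions, and the derivative of the Möbius transformation. -/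

theorem cis_add_mul_congr {k : ℕ} (hk : 0 < k) (x : ℝ) {m n : ℤ} (h : (2 * k : ℤ) ∣ m - n) :
    cis (x + m * (Real.pi / k)) = cis (x + n * (Real.pi / k)) := by
  obtain ⟨q, hq⟩ := h
  have hkr : (k : ℝ) ≠ 0 := by exact_mod_cast hk.ne'
  have hm : (m : ℝ) = n + 2 * k * q := by
    have : m = n + 2 * k * q := by linarith
    exact_mod_cast this
  rw [← cis_add_int_mul_two_pi (x + n * (Real.pi / k)) q, hm]
  congr 1
  field_simp
  ring

theorem hasDerivAt_toZeroInfty {y y' b : ℂ} (hb : b ≠ y') :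
    HasDerivAt (toZeroInfty y y') ((y' - y) / (y' - b) ^ 2) b := by
  have h : y' - b ≠ 0 := sub_ne_zero.2 hb.symm
  have := ((hasDerivAt_id b).sub_const y).div ((hasDerivAt_id b).const_sub y') h
  refine this.congr_deriv ?_
  simp only [id]
  congr 1
  ring

theorem eq_norm_mul_cis_of_div_eq {z : ℂ} {x : ℝ} (hz : z ≠ 0) (h : z / ‖z‖ = cis x) :
    z = ‖z‖ * cis x := by
  rw [div_eq_iff (by exact_mod_cast norm_ne_zero_iff.2 hz)] at h
  rw [mul_comm]
  exact h

theorem pos_mul_cis_div {w : ℂ} {r x : ℝ} (hw : w ≠ 0) :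
    r * cis x / w = ((r / ‖w‖ : ℝ) : ℂ) * cis (x - arg w) := by
  have hn : (‖w‖ : ℂ) ≠ 0 := by exact_mod_cast norm_ne_zero_iff.2 hw
  have e1 : cis (x - arg w) * cis (arg w) = cis x := by rw [← cis_add, sub_add_cancel]
  have e2 := eq_norm_mul_cis w
  rw [div_eq_iff hw]
  generalize cis (arg w) = c at *
  generalize (‖w‖ : ℝ) = n at *
  subst e2
  push_cast
  field_simp
  linear_combination (-r : ℂ) * e1

/-! ### The path system obtained by normalizing a drawing. -/

namespace Drawing

variable {k : ℕ}

/-- The numbers `U y j` describe the shapes of the edges from the yellow vertices to the blue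
vertices. -/
structure IsShape (D : Drawing (B k)) (U : Fin 2 → Fin k × Fin 2 → ℂ) : Prop where
  norm_eq : ∀ y j, ‖U y j‖ = 1
  ne_neg_one : ∀ y j, U y j ≠ -1
  direction_eq : ∀ y j, D.direction ⟨(.yellow y, blueAt j), adj_yellow_blueAt y j⟩ =
    U y j * (D.pos (blueAt j) - D.pos (.yellow y)) /
      ‖U y j * (D.pos (blueAt j) - D.pos (.yellow y))‖
  direction_symm_eq : ∀ y j, D.direction ⟨(blueAt j, .yellow y), (adj_yellow_blueAt y j).symm⟩ =
    conj (U y j) * (D.pos (.yellow y) - D.pos (blueAt j)) /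
      ‖conj (U y j) * (D.pos (.yellow y) - D.pos (blueAt j))‖
  exists_curve_eq : ∀ y j, ∀ s : ℝ, 0 < s → ∀ z,
    z - D.pos (.yellow y) = s * U y j * (D.pos (blueAt j) - z) →
      ∃ t ∈ Ioo (0 : ℝ) 1, D.curve (yellowDart y j) t = z

theorem IsLombardi.exists_isShape {D : Drawing (B k)} (hL : D.IsLombardi) : ∃ U, IsShape D U := by
  have := fun y j => D.exists_arc_unit (adj_yellow_blueAt y j) (hL.1 _)
  choose U h1 h2 h3 h4 h5 using this
  exact ⟨U, h1, h2, h3, h4, h5⟩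

/-- The position of a point after a yellow vertex is sent to `0` and the other one to `∞`. -/
noncomputable def normalized (D : Drawing (B k)) (z : ℂ) : ℂ :=
  toZeroInfty (D.pos (.yellow 0)) (D.pos (.yellow 1)) z

/-- The normalized position of a blue vertex. -/
noncomputable def base (D : Drawing (B k)) (j : Fin k × Fin 2) : ℂ := D.normalized (D.pos (blueAt j))

/-- The shape of the arc from `0` to a blue vertex. -/
noncomputable def leadShape (D : Drawing (B k)) (U : Fin 2 → Fin k × Fin 2 → ℂ)
    (j : Fin k × Fin 2) : ℂ := U 0 j / (1 + D.base j)

/-- The direction of the ray from a blue vertex to `∞`. -/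
noncomputable def tailShape (D : Drawing (B k)) (U : Fin 2 → Fin k × Fin 2 → ℂ)
    (j : Fin k × Fin 2) : ℂ := (U 1 j)⁻¹ * (1 + D.base j) / D.base j

theorem yellow_ne (D : Drawing (B k)) : D.pos (.yellow 0) ≠ D.pos (.yellow 1) := fun h => by
  simpa using D.pos_injective h

theorem blue_ne_yellow (D : Drawing (B k)) (j : Fin k × Fin 2) (y : Fin 2) :
    D.pos (blueAt j) ≠ D.pos (.yellow y) := fun h => by
  simpa [blueAt] using D.pos_injective h

theorem base_ne_zero (D : Drawing (B k)) (j : Fin k × Fin 2) : D.base j ≠ 0 :=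
  toZeroInfty_ne_zero (D.blue_ne_yellow j 0) (D.blue_ne_yellow j 1)

theorem one_add_base_ne_zero (D : Drawing (B k)) (j : Fin k × Fin 2) : 1 + D.base j ≠ 0 :=
  one_add_toZeroInfty_ne_zero D.yellow_ne (D.blue_ne_yellow j 1)

theorem one_add_base (D : Drawing (B k)) (j : Fin k × Fin 2) : 1 + D.base j =
    (D.pos (.yellow 1) - D.pos (.yellow 0)) / (D.pos (.yellow 1) - D.pos (blueAt j)) :=
  one_add_toZeroInfty (D.blue_ne_yellow j 1)

namespace IsShape

variable {D : Drawing (B k)} {U : Fin 2 → Fin k × Fin 2 → ℂ}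

theorem ne_zero (hU : IsShape D U) (y : Fin 2) (j : Fin k × Fin 2) : U y j ≠ 0 := fun h => by
  have := hU.norm_eq y j
  rw [h] at this
  simp at this

theorem exists_tail_curve_eq (hU : IsShape D U) (j : Fin k × Fin 2) {s : ℝ} (hs : 0 < s) {z : ℂ}
    (h : z - D.pos (blueAt j) = s * (U 1 j)⁻¹ * (D.pos (.yellow 1) - z)) :
    ∃ t ∈ Ioo (0 : ℝ) 1, D.curve (yellowDart 1 j) t = z := by
  refine hU.exists_curve_eq 1 j s⁻¹ (inv_pos.2 hs) z ?_
  have h0 := hU.ne_zero 1 j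
  have hsc : (s : ℂ) ≠ 0 := by exact_mod_cast hs.ne'
  rw [← neg_sub z (D.pos (blueAt j)), h]
  push_cast
  field_simp
  ring

/-- A negative real shape would make the normalized arc pass through `∞`, that is, the edge through
the second yellow vertex. For `tailShape` the forbidden point is `0`, the first yellow vertex. -/
theorem leadShape_mem (hU : IsShape D U) (hP : D.IsPlane) (j : Fin k × Fin 2) :
    D.leadShape U j ∈ slitPlane := by
  have h0 := hU.ne_zero 0 j
  have h1 := D.one_add_base_ne_zero j
  refine mem_slitPlane_of_ne (div_ne_zero h0 h1) fun s hs he => ?_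
  have hsc : (s : ℂ) ≠ 0 := by exact_mod_cast hs.ne'
  obtain ⟨t, ht, h⟩ := hU.exists_curve_eq 0 j s⁻¹ (inv_pos.2 hs) (D.pos (.yellow 1)) (by
    rw [leadShape, div_eq_iff h1, D.one_add_base] at he
    rw [he]
    have h2 := sub_ne_zero.2 (D.blue_ne_yellow j 1).symm
    push_cast
    field_simp
    ring)
  exact hP.curve_ne_pos _ ht _ h

theorem tailShape_mem (hU : IsShape D U) (hP : D.IsPlane) (j : Fin k × Fin 2) :
    D.tailShape U j ∈ slitPlane := by
  have h0 := hU.ne_zero 1 j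
  have h1 := D.one_add_base_ne_zero j
  have hB := D.base_ne_zero j
  refine mem_slitPlane_of_ne (div_ne_zero (mul_ne_zero (inv_ne_zero h0) h1) hB) fun s hs he => ?_
  have hsc : (s : ℂ) ≠ 0 := by exact_mod_cast hs.ne'
  obtain ⟨t, ht, h⟩ := hU.exists_tail_curve_eq j (inv_pos.2 hs) (z := D.pos (.yellow 0)) (by
    rw [tailShape, div_eq_iff hB, D.one_add_base, base, normalized, toZeroInfty] at he
    have h2 := sub_ne_zero.2 (D.blue_ne_yellow j 1).symm
    have h3 : (U 1 j)⁻¹ * (D.pos (.yellow 1) - D.pos (.yellow 0)) =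
        -s * (D.pos (blueAt j) - D.pos (.yellow 0)) := by
      field_simp at he ⊢
      linear_combination he
    rw [mul_assoc, h3]
    push_cast
    field_simp
    ring)
  exact hP.curve_ne_pos _ ht _ h

theorem offPath (hU : IsShape D U) {j : Fin k × Fin 2} {z : ℂ} (hy : ∀ y, z ≠ D.pos (.yellow y))
    (hb : z ≠ D.pos (blueAt j)) (hc : ∀ y, ∀ t ∈ Ioo (0 : ℝ) 1, D.curve (yellowDart y j) t ≠ z) :
    OffPath (D.base j) (D.leadShape U j) (D.tailShape U j) (D.normalized z) := by
  refine offPath_toZeroInfty D.yellow_ne (D.blue_ne_yellow j 0) (D.blue_ne_yellow j 1) (hy 0) (hy 1)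
    hb (hU.ne_zero 0 j) (inv_ne_zero (hU.ne_zero 1 j)) (fun s hs he => ?_) (fun s hs he => ?_)
  · obtain ⟨t, ht, h⟩ := hU.exists_curve_eq 0 j s hs z he
    exact hc 0 t ht h
  · obtain ⟨t, ht, h⟩ := hU.exists_tail_curve_eq j hs he
    exact hc 1 t ht h

/-- A point on an edge other than the two edges of a path is not on that path. -/
theorem offPath_curve (hU : IsShape D U) (hP : D.IsPlane) {j : Fin k × Fin 2} {d : (B k).Dart}
    (hd : ∀ y, (yellowDart y j).edge ≠ d.edge) {t : ℝ} (ht : t ∈ Icc (0 : ℝ) 1)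
    (hy : ∀ y, D.curve d t ≠ D.pos (.yellow y)) (hb : D.curve d t ≠ D.pos (blueAt j)) :
    OffPath (D.base j) (D.leadShape U j) (D.tailShape U j) (D.normalized (D.curve d t)) :=
  hU.offPath hy hb fun y _ ht' => hP.curve_ne_curve (hd y) ht' ht

theorem offPath_base (hU : IsShape D U) (hP : D.IsPlane) {i j : Fin k × Fin 2} (hij : i ≠ j) :
    OffPath (D.base i) (D.leadShape U i) (D.tailShape U i) (D.base j) :=
  hU.offPath (D.blue_ne_yellow j) (fun h => hij (blueAt_injective (D.pos_injective h)).symm)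
    fun _ _ ht => hP.curve_ne_pos _ ht _

/-- The points of the normalized arc come from points of the edge. -/
theorem exists_leadArc_eq (hU : IsShape D U) (hP : D.IsPlane) (j : Fin k × Fin 2) {τ : ℝ}
    (h0 : 0 < τ) (h1 : τ < 1) : ∃ t ∈ Ioo (0 : ℝ) 1,
      D.normalized (D.curve (yellowDart 0 j) t) = leadArc (D.base j) (D.leadShape U j) τ := by
  have hs : 0 < τ / (1 - τ) := div_pos h0 (sub_pos.2 h1)
  have hn := one_add_mul_ne_zero (hU.norm_eq 0 j) (hU.ne_neg_one 0 j) hs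
  have hz : (D.pos (.yellow 0) + (τ / (1 - τ) : ℝ) * U 0 j * D.pos (blueAt j)) /
      (1 + (τ / (1 - τ) : ℝ) * U 0 j) - D.pos (.yellow 0) = (τ / (1 - τ) : ℝ) * U 0 j *
      (D.pos (blueAt j) - (D.pos (.yellow 0) + (τ / (1 - τ) : ℝ) * U 0 j * D.pos (blueAt j)) /
      (1 + (τ / (1 - τ) : ℝ) * U 0 j)) := by
    generalize ((τ / (1 - τ) : ℝ) : ℂ) = s at *
    field_simp
    ring
  obtain ⟨t, ht, h⟩ := hU.exists_curve_eq 0 j _ hs _ hz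
  refine ⟨t, ht, toZeroInfty_eq_leadArc D.yellow_ne (D.blue_ne_yellow j 1) (hU.leadShape_mem hP j)
    (hP.curve_ne_pos _ ht _) h0 h1 ?_⟩
  rw [h]
  exact hz

/-- The points of the normalized ray come from points of the edge. -/
theorem exists_tailRay_eq (hU : IsShape D U) (hP : D.IsPlane) (j : Fin k × Fin 2) {s : ℝ}
    (hs : 0 < s) : ∃ t ∈ Ioo (0 : ℝ) 1,
      D.normalized (D.curve (yellowDart 1 j) t) = tailRay (D.base j) (D.tailShape U j) s := by
  have hn : (1 + s * (U 1 j)⁻¹ : ℂ) ≠ 0 := one_add_mul_ne_zero (by rw [norm_inv, hU.norm_eq, inv_one])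
    (fun h => hU.ne_neg_one 1 j (by rw [← inv_inv (U 1 j), h]; norm_num)) hs
  have hz : (D.pos (blueAt j) + s * (U 1 j)⁻¹ * D.pos (.yellow 1)) / (1 + s * (U 1 j)⁻¹) -
      D.pos (blueAt j) = s * (U 1 j)⁻¹ * (D.pos (.yellow 1) -
      (D.pos (blueAt j) + s * (U 1 j)⁻¹ * D.pos (.yellow 1)) / (1 + s * (U 1 j)⁻¹)) := by
    generalize (U 1 j)⁻¹ = v at *
    field_simp
    ring
  obtain ⟨t, ht, h⟩ := hU.exists_tail_curve_eq j hs hz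
  refine ⟨t, ht, toZeroInfty_eq_tailRay (D.blue_ne_yellow j 0) (D.blue_ne_yellow j 1)
    (hP.curve_ne_pos _ ht _) ?_⟩
  rw [h]
  exact hz

theorem lead_spaced (hU : IsShape D U) (hL : D.IsLombardi) (hk : 0 < k) :
    EquallySpaced k D.base (D.leadShape U) := by
  obtain ⟨a, σ, h1, h2, h3⟩ := hL.exists_numbering hk (card_neighborSet_yellow (k := k) 0)
  have hyy := sub_ne_zero.2 D.yellow_ne.symm
  refine ⟨a - arg (D.pos (.yellow 1) - D.pos (.yellow 0)),
    fun j => σ ⟨blueAt j, adj_yellow_blueAt 0 j⟩, fun m => ?_, fun i j hij => ?_, fun j => ?_⟩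
  · obtain ⟨⟨_ | ⟨i, b⟩ | _, h⟩, hw⟩ := h1 m
    · rcases h with h | h <;> exact h.elim
    · exact ⟨(i, b), hw⟩
    · rcases h with h | h <;> exact h.elim
  · exact blueAt_injective (congrArg Subtype.val (h2 _ _ hij))
  · have hb := sub_ne_zero.2 (D.blue_ne_yellow j 0)
    have hb1 := sub_ne_zero.2 (D.blue_ne_yellow j 1).symm
    have hne := mul_ne_zero (hU.ne_zero 0 j) hb
    have e := eq_norm_mul_cis_of_div_eq hne
      ((hU.direction_eq 0 j).symm.trans (h3 ⟨blueAt j, adj_yellow_blueAt 0 j⟩))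
    refine ⟨_, div_pos (norm_pos_iff.2 hne) (norm_pos_iff.2 hyy), ?_⟩
    have e2 : D.base j * D.leadShape U j = U 0 j * (D.pos (blueAt j) - D.pos (.yellow 0)) /
        (D.pos (.yellow 1) - D.pos (.yellow 0)) := by
      rw [leadShape, D.one_add_base, base, normalized, toZeroInfty]
      field_simp
    rw [e2, sub_add_eq_add_sub, ← pos_mul_cis_div hyy, ← e]

theorem tail_spaced (hU : IsShape D U) (hL : D.IsLombardi) (hk : 0 < k) :
    EquallySpaced k D.base (D.tailShape U) := by
  obtain ⟨a, σ, h1, h2, h3⟩ := hL.exists_numbering hk (card_neighborSet_yellow (k := k) 1)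
  have hyy := sub_ne_zero.2 D.yellow_ne
  refine ⟨arg (D.pos (.yellow 0) - D.pos (.yellow 1)) - a,
    -- The map has a pole at the second yellow vertex, so the directions there enter through their
    -- inverses and the numbering is reversed.
    fun j => -σ ⟨blueAt j, adj_yellow_blueAt 1 j⟩, fun m => ?_, fun i j hij => ?_, fun j => ?_⟩
  · obtain ⟨⟨_ | ⟨i, b⟩ | _, h⟩, hw⟩ := h1 (-m)
    · rcases h with h | h <;> exact h.elim
    · refine ⟨(i, b), ?_⟩
      rw [← dvd_neg, neg_sub, sub_neg_eq_add, add_comm, ← sub_neg_eq_add]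
      exact hw
    · rcases h with h | h <;> exact h.elim
  · rw [neg_sub_neg] at hij
    exact (blueAt_injective (congrArg Subtype.val (h2 _ _ hij))).symm
  · have hb := sub_ne_zero.2 (D.blue_ne_yellow j 1)
    have hb1 := sub_ne_zero.2 (D.blue_ne_yellow j 1).symm
    have hB := D.base_ne_zero j
    have hU0 := hU.ne_zero 1 j
    have hne := mul_ne_zero hU0 hb
    have e := eq_norm_mul_cis_of_div_eq hne
      ((hU.direction_eq 1 j).symm.trans (h3 ⟨blueAt j, adj_yellow_blueAt 1 j⟩))
    refine ⟨_, div_pos (norm_pos_iff.2 hyy) (norm_pos_iff.2 hne), ?_⟩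
    have e2 : D.base j * D.tailShape U j = (D.pos (.yellow 0) - D.pos (.yellow 1)) /
        (U 1 j * (D.pos (blueAt j) - D.pos (.yellow 1))) := by
      rw [tailShape, D.one_add_base]
      field_simp
      ring
    have e3 : cis (arg (D.pos (.yellow 0) - D.pos (.yellow 1)) - a +
        ((-σ ⟨blueAt j, adj_yellow_blueAt 1 j⟩ : ℤ) : ℝ) * (Real.pi / k)) *
        cis (a + σ ⟨blueAt j, adj_yellow_blueAt 1 j⟩ * (Real.pi / k)) =
        cis (arg (D.pos (.yellow 0) - D.pos (.yellow 1))) := by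
      rw [← cis_add]
      congr 1
      push_cast
      ring
    have hn : (‖U 1 j * (D.pos (blueAt j) - D.pos (.yellow 1))‖ : ℂ) ≠ 0 := by
      exact_mod_cast norm_ne_zero_iff.2 hne
    have e4 := eq_norm_mul_cis (D.pos (.yellow 0) - D.pos (.yellow 1))
    have e5 := div_mul_cancel₀ (‖D.pos (.yellow 0) - D.pos (.yellow 1)‖ : ℂ) hn
    rw [e2, div_eq_iff hne, Complex.ofReal_div]
    beta_reduce
    generalize cis (arg (D.pos (.yellow 0) - D.pos (.yellow 1)) - a + _) = c at e3 ⊢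
    generalize cis (a + _) = c' at e e3
    generalize (‖D.pos (.yellow 0) - D.pos (.yellow 1)‖ : ℂ) = x at *
    generalize (‖U 1 j * (D.pos (blueAt j) - D.pos (.yellow 1))‖ : ℂ) = x' at *
    linear_combination e4 - x / x' * c * e - x * e3 - c * c' * e5

theorem off_arc (hU : IsShape D U) (hP : D.IsPlane) {i j : Fin k × Fin 2} (hij : i ≠ j) {τ : ℝ}
    (h0 : 0 < τ) (h1 : τ ≤ 1) : OffPath (D.base i) (D.leadShape U i) (D.tailShape U i)
      (leadArc (D.base j) (D.leadShape U j) τ) := by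
  rcases h1.lt_or_eq with h1 | rfl
  · obtain ⟨t, ht, e⟩ := hU.exists_leadArc_eq hP j h0 h1
    rw [← e]
    exact hU.offPath_curve hP (fun y => yellowDart_edge_ne (Or.inr hij)) (Ioo_subset_Icc_self ht)
      (fun y => hP.curve_ne_pos _ ht _) (hP.curve_ne_pos _ ht _)
  · rw [leadArc_one (Complex.slitPlane_ne_zero (hU.leadShape_mem hP j))]
    exact hU.offPath_base hP hij

theorem off_ray (hU : IsShape D U) (hP : D.IsPlane) {i j : Fin k × Fin 2} (hij : i ≠ j) {t : ℝ}
    (h0 : 0 ≤ t) : OffPath (D.base i) (D.leadShape U i) (D.tailShape U i)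
      (tailRay (D.base j) (D.tailShape U j) t) := by
  rcases h0.lt_or_eq with h0 | rfl
  · obtain ⟨t, ht, e⟩ := hU.exists_tailRay_eq hP j h0
    rw [← e]
    exact hU.offPath_curve hP (fun y => yellowDart_edge_ne (Or.inr hij)) (Ioo_subset_Icc_self ht)
      (fun y => hP.curve_ne_pos _ ht _) (hP.curve_ne_pos _ ht _)
  · rw [tailRay_zero]
    exact hU.offPath_base hP hij

/-- The equation says that the arc at parameter `x / (t + x)` meets the ray at parameter `t`; pulled
back, the two yellow edges of one blue vertex would cross. -/
theorem simple (hU : IsShape D U) (hP : D.IsPlane) (j : Fin k × Fin 2) {t x : ℝ} (ht : 0 < t)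
    (hx : 0 < x) : 1 + t * D.tailShape U j + x * (D.leadShape U j * D.tailShape U j) ≠ 0 := by
  intro he
  have htx : 0 < t + x := add_pos ht hx
  obtain ⟨τ, hτ, e⟩ := hU.exists_leadArc_eq hP j (div_pos hx htx)
    ((div_lt_one htx).2 (by linarith))
  obtain ⟨τ', hτ', e'⟩ := hU.exists_tailRay_eq hP j ht
  have hu := Complex.slitPlane_ne_zero (hU.leadShape_mem hP j)
  have hxc : (x : ℂ) ≠ 0 := by exact_mod_cast hx.ne'
  have htxc : (t + x : ℂ) ≠ 0 := by exact_mod_cast htx.ne'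
  have key : leadArc (D.base j) (D.leadShape U j) (x / (t + x)) =
      tailRay (D.base j) (D.tailShape U j) t := by
    have h1 : (1 + t * D.tailShape U j) * (t + x * D.leadShape U j) = x * D.leadShape U j := by
      linear_combination (t : ℂ) * he
    have h2 : (t + x * D.leadShape U j : ℂ) ≠ 0 :=
      right_ne_zero_of_mul (h1 ▸ mul_ne_zero hxc hu)
    have h3 : (1 - (x / (t + x) : ℝ) : ℂ) + (x / (t + x) : ℝ) * D.leadShape U j =
        (t + x * D.leadShape U j) / (t + x) := by
      push_cast
      field_simp
      ring
    rw [leadArc, tailRay, h3, div_eq_iff (div_ne_zero h2 htxc)]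
    push_cast
    rw [mul_assoc, ← mul_div_assoc, h1, div_mul_eq_mul_div]
  rw [← e, ← e', normalized, normalized, ← sub_eq_zero,
    toZeroInfty_sub (hP.curve_ne_pos _ hτ _) (hP.curve_ne_pos _ hτ' _)] at key
  rcases mul_eq_zero.1 key with h | h
  · exact one_add_toZeroInfty_ne_zero D.yellow_ne (hP.curve_ne_pos _ hτ _) h
  rcases div_eq_zero_iff.1 h with h | h
  · exact hP.curve_ne_curve (yellowDart_edge_ne (Or.inl (by simp))) hτ (Ioo_subset_Icc_self hτ')
      (sub_eq_zero.1 h)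
  · exact hP.curve_ne_pos _ hτ' _ (sub_eq_zero.1 h).symm

/-- The connection follows the edge from `j` to the red vertex `r` and then the edge from the
partner to `r` backwards. The condition on `e` is the chain rule for the normalizing map at the blue
vertex. -/
theorem hasConnection (hU : IsShape D U) (hP : D.IsPlane) (hL : D.IsLombardi) (j : Fin k × Fin 2)
    (r : Fin (2 * k - 2)) : ∃ ρ : ℝ, 0 < ρ ∧ ∀ e, e * D.base j =
      (D.pos (.yellow 1) - D.pos (.yellow 0)) / (D.pos (.yellow 1) - D.pos (blueAt j)) ^ 2 *
        (ρ * D.direction (redDart j r)) →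
      HasConnection partner D.base (D.leadShape U) (D.tailShape U) j e := by
  obtain ⟨ρ, hρ, hd⟩ := D.exists_hasDerivWithinAt_direction (redDart j r) (hL.1 _)
  have hy : ∀ j, ∀ y, ∀ t ∈ Icc (0 : ℝ) 1, D.curve (redDart j r) t ≠ D.pos (.yellow y) :=
    fun j y t ht => hP.curve_ne_pos_of_notMem ht (by simp [redDart_edge, blueAt])
  have hb : ∀ j l, l ≠ j → ∀ t ∈ Icc (0 : ℝ) 1, D.curve (redDart j r) t ≠ D.pos (blueAt l) :=
    fun j l hl t ht => hP.curve_ne_pos_of_notMem ht (by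
      rw [redDart_edge, Sym2.mem_iff]
      rintro (h | h)
      · exact hl (blueAt_injective h)
      · simp [blueAt] at h)
  have hc : ∀ j, ContinuousOn (fun t => D.normalized (D.curve (redDart j r) t)) (Icc 0 1) :=
    fun j => ((D.curve_continuousOn _).sub continuousOn_const).div
      (continuousOn_const.sub (D.curve_continuousOn _)) fun t ht => sub_ne_zero.2 (hy j 1 t ht).symm
  have hrev : MapsTo (fun t : ℝ => 1 - t) (Icc 0 1) (Icc 0 1) := fun t ht =>
    ⟨by linarith [ht.2], by linarith [ht.1]⟩
  have hoff : ∀ j l, l ≠ j → ∀ t ∈ Icc (0 : ℝ) 1, OffPath (D.base l) (D.leadShape U l)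
      (D.tailShape U l) (D.normalized (D.curve (redDart j r) t)) := fun j l hl t ht =>
    hU.offPath_curve hP (fun y => yellowDart_edge_ne_redDart y l j r) ht (fun y => hy j y t ht)
      (hb j l hl t ht)
  refine ⟨ρ, hρ, fun e he => ⟨fun t => D.normalized (D.curve (redDart j r) t),
    fun t => D.normalized (D.curve (redDart (partner j) r) (1 - t)), hc j,
    (hc (partner j)).comp (continuousOn_const.sub continuousOn_id) hrev, ?_, ?_, ?_, ?_, ?_, ?_, ?_⟩⟩
  · simp only [D.curve_zero]
    rfl
  · rw [he]
    refine HasDerivAt.comp_hasDerivWithinAt (0 : ℝ) ?_ hd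
    rw [D.curve_zero]
    exact hasDerivAt_toZeroInfty (D.blue_ne_yellow j 1)
  · simp only [sub_zero, D.curve_one]
    rfl
  · simp only [sub_self, D.curve_zero]
    rfl
  · intro t ht
    have ht' := Ioc_subset_Icc_self ht
    refine hU.offPath_curve hP (fun y => yellowDart_edge_ne_redDart y j j r) ht'
      (fun y => hy j y t ht') fun h => ?_
    exact ht.1.ne' (D.curve_injOn (redDart j r) ht' (by simp) (h.trans (D.curve_zero (redDart j r)).symm))
  · exact fun l hl t ht => hoff j l hl t ht
  · exact fun l hl t ht => hoff (partner j) l hl _ (hrev ht)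

theorem connection (hU : IsShape D U) (hP : D.IsPlane) (hL : D.IsLombardi) (hk : 0 < k)
    (j : Fin k × Fin 2) : ∃ X : ℤ, 0 < X ∧ X < 2 * k ∧
    (∃ r : ℝ, 0 < r ∧ -(D.leadShape U j)⁻¹ = r * (D.tailShape U j * cis (X * (Real.pi / k)))) ∧
    ∀ x : ℤ, 0 < x → x < 2 * k → x ≠ X → ∃ r : ℝ, 0 < r ∧ HasConnection partner D.base
      (D.leadShape U) (D.tailShape U) j (r * (D.tailShape U j * cis (x * (Real.pi / k)))) := by
  obtain ⟨a, σ, h1, h2, h3⟩ := hL.exists_numbering hk (card_neighborSet_blue hk j)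
  have hconj : ∀ y, conj (U y j) = (U y j)⁻¹ := fun y =>
    (Complex.inv_eq_conj (hU.norm_eq y j)).symm
  have hne : ∀ y, (U y j)⁻¹ * (D.pos (.yellow y) - D.pos (blueAt j)) ≠ 0 := fun y =>
    mul_ne_zero (inv_ne_zero (hU.ne_zero y j)) (sub_ne_zero.2 (D.blue_ne_yellow j y).symm)
  let w : Fin 2 → (B k).neighborSet (blueAt j) := fun y => ⟨.yellow y, (adj_yellow_blueAt y j).symm⟩
  obtain ⟨n, hn, e⟩ : ∃ n : Fin 2 → ℝ, (∀ y, 0 < n y) ∧ ∀ y, (U y j)⁻¹ *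
      (D.pos (.yellow y) - D.pos (blueAt j)) = n y * cis (a + σ (w y) * (Real.pi / k)) :=
    ⟨fun y => ‖(U y j)⁻¹ * (D.pos (.yellow y) - D.pos (blueAt j))‖,
      fun y => norm_pos_iff.2 (hne y), fun y => eq_norm_mul_cis_of_div_eq (hne y) (by
        rw [← hconj, ← hU.direction_symm_eq y j, ← h3 (w y)])⟩
  have hnc : ∀ y, (n y : ℂ) ≠ 0 := fun y => by exact_mod_cast (hn y).ne'
  have hb0 := sub_ne_zero.2 (D.blue_ne_yellow j 0)
  have hb1 := sub_ne_zero.2 (D.blue_ne_yellow j 1).symm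
  have hyy := sub_ne_zero.2 D.yellow_ne.symm
  have hu0 := hU.ne_zero 0 j
  have hu1 := hU.ne_zero 1 j
  have e0 : D.base j = (D.pos (blueAt j) - D.pos (.yellow 0)) /
    (D.pos (.yellow 1) - D.pos (blueAt j)) := rfl
  have turn : ∀ x : ℤ, cis (a + σ (w 1) * (Real.pi / k)) * cis (x * (Real.pi / k)) =
      cis (a + (σ (w 1) + x : ℤ) * (Real.pi / k)) := fun x => by
    rw [← cis_add]
    congr 1
    push_cast
    ring
  -- `X` counts the steps of `π / k` counterclockwise from the second yellow edge to the first; the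
  -- normalizing map is conformal at the blue vertex and keeps this count.
  have hX : (2 * k : ℤ) ∣ (σ (w 0) - σ (w 1)) - (σ (w 0) - σ (w 1)) % (2 * k) :=
    Int.dvd_self_sub_emod
  have hX0 : 0 ≤ (σ (w 0) - σ (w 1)) % (2 * k) := Int.emod_nonneg _ (by omega)
  have hX1 : (σ (w 0) - σ (w 1)) % (2 * k) < 2 * k := Int.emod_lt_of_pos _ (by omega)
  generalize (σ (w 0) - σ (w 1)) % (2 * k) = X at hX hX0 hX1
  refine ⟨X, hX0.lt_of_ne ?_, hX1, ⟨n 0 / n 1, div_pos (hn 0) (hn 1), ?_⟩, fun x hx0 hx1 hxX => ?_⟩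
  · rintro rfl
    rw [sub_zero] at hX
    have := congrArg Subtype.val (h2 _ _ hX)
    simp [w] at this
  · have e1 := turn X
    rw [cis_add_mul_congr hk a (m := σ (w 1) + X) (n := σ (w 0)) (by
      rwa [← dvd_neg, neg_sub, ← sub_sub])] at e1
    have e2 := e 0
    have e3 := e 1
    rw [← e1] at e2
    generalize cis (a + _) = c at e2 e3
    have e4 : (U 0 j)⁻¹ * (D.pos (.yellow 0) - D.pos (blueAt j)) = n 0 / n 1 * ((U 1 j)⁻¹ *
        (D.pos (.yellow 1) - D.pos (blueAt j)) * cis (X * (Real.pi / k))) := by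
      rw [e2, e3]
      have := hnc 1
      field_simp
    have e5 : -(D.leadShape U j)⁻¹ = (U 0 j)⁻¹ * (D.pos (.yellow 0) - D.pos (blueAt j)) *
        ((1 + D.base j) / (D.pos (blueAt j) - D.pos (.yellow 0))) := by
      rw [leadShape]
      field_simp
      ring
    have e6 : D.tailShape U j = (U 1 j)⁻¹ * (D.pos (.yellow 1) - D.pos (blueAt j)) *
        ((1 + D.base j) / (D.pos (blueAt j) - D.pos (.yellow 0))) := by
      rw [tailShape, e0]
      field_simp
    rw [e5, e4, e6, Complex.ofReal_div]
    ring
  -- The two yellow edges occupy the residues `0` and `X` relative to `σ (w 1)`, so every other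
  -- direction belongs to a red edge of the same pair.
  · obtain ⟨⟨y | _ | ⟨i, r⟩, h⟩, hw⟩ := h1 (σ (w 1) + x)
    · exfalso
      fin_cases y
      · have h4 : (2 * k : ℤ) ∣ x - X := by
          have h5 : (2 * k : ℤ) ∣ σ (w 0) - (σ (w 1) + x) := hw
          have := dvd_sub hX h5
          rwa [show σ (w 0) - σ (w 1) - X - (σ (w 0) - (σ (w 1) + x)) = x - X by ring] at this
        have := Int.eq_zero_of_abs_lt_dvd h4 (abs_lt.2 ⟨by omega, by omega⟩)
        omega
      · have h4 : (2 * k : ℤ) ∣ x := by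
          have h5 : (2 * k : ℤ) ∣ σ (w 1) - (σ (w 1) + x) := hw
          rwa [sub_add_cancel_left, dvd_neg] at h5
        exact absurd (Int.le_of_dvd hx0 h4) (by omega)
    · rcases h with h | h <;> exact h.elim
    · have hi : i = j.1 := by
        rcases h with h | h
        · exact h.elim
        · exact h
      subst hi
      obtain ⟨ρ, hρ, hc⟩ := hU.hasConnection hP hL j r
      refine ⟨ρ / n 1, div_pos hρ (hn 1), hc _ ?_⟩
      have e1 : D.direction (redDart j r) = _ := h3 ⟨.red j.1 r, h⟩
      rw [e1, cis_add_mul_congr hk a hw, ← turn x]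
      have e3 := e 1
      have e6 : D.tailShape U j * D.base j = (U 1 j)⁻¹ * (D.pos (.yellow 1) - D.pos (blueAt j)) *
          ((D.pos (.yellow 1) - D.pos (.yellow 0)) /
            (D.pos (.yellow 1) - D.pos (blueAt j)) ^ 2) := by
        rw [tailShape, D.one_add_base, div_mul_cancel₀ _ (D.base_ne_zero j)]
        field_simp
      rw [e3] at e6
      have := div_mul_cancel₀ (ρ : ℂ) (hnc 1)
      push_cast
      generalize cis (a + _) = c at e6
      generalize cis (x * _) = c'
      generalize (D.pos (.yellow 1) - D.pos (.yellow 0)) /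
            (D.pos (.yellow 1) - D.pos (blueAt j)) ^ 2 = q at e6 ⊢
      linear_combination (ρ / n 1 * c') * e6 + c * c' * q * this

end IsShape

theorem exists_isPathSystem {D : Drawing (B k)} (hP : D.IsPlane) (hL : D.IsLombardi) (hk : 0 < k) :
    ∃ b u v : Fin k × Fin 2 → ℂ, IsPathSystem partner k b u v := by
  obtain ⟨U, hU⟩ := hL.exists_isShape
  exact ⟨D.base, D.leadShape U, D.tailShape U, {
    base_ne := D.base_ne_zero
    lead_mem := hU.leadShape_mem hP
    tail_mem := hU.tailShape_mem hP
    off_arc := fun i j hij τ h0 h1 => hU.off_arc hP hij h0 h1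
    off_ray := fun i j hij t h0 => hU.off_ray hP hij h0
    simple := fun j t x ht hx => hU.simple hP j ht hx
    lead_spaced := hU.lead_spaced hL hk
    tail_spaced := hU.tail_spaced hL hk
    connection := hU.connection hP hL hk }⟩

end Drawing

theorem theorem1 (k : ℕ) (hk : 8 < k) :
    (B k).IsBipartite ∧ IsPlanarGraph (B k) ∧ ¬ HasPlanarLombardiDrawing (B k) := by
  refine ⟨B_isBipartite k, B_isPlanarGraph (by omega), ?_⟩
  rintro ⟨D, hP, hL⟩
  obtain ⟨b, u, v, h⟩ := Drawing.exists_isPathSystem hP hL (by omega)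
  have : Nonempty (Fin k × Fin 2) := ⟨(⟨0, by omega⟩, 0)⟩
  exact h.false_of_eight_lt hk Drawing.partner_ne Drawing.partner_partner
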